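/- Conventions. $S^n$ is the standard smooth sphere, $B^4\subset\mathbb R^4$ is the closed unit ball, and a self-map of $B^4$ is smooth if it is the restriction of a smooth map $\mathbb R^4\to\mathbb R^4$. An involution of a pair $(X,S)$ is a map $\sigma\colon X\to X$ with $\sigma\circ\sigma=\mathrm{id}$ and $\sigma(S)=S$; $\mathrm{Fix}(\sigma)$ is its fixed-point set. A knot is a smoothly embedded circle $K\subset S^3$. A pair $(K,\sigma)$ of a knot $K$ and a smooth involution $\sigma$ of $(S^3,K)$ is strongly negative amphichiral if $\sigma$ has exactly two fixed points, both on $K$. A double branched cover of $X$ along $S$ is a continuous map $p\colon\Sigma\to X$ from a topological space $\Sigma$ that is a two-sheeted covering over $X\setminus S$ and is given near each point of $S$, in suitable local (topological) coordinates on $X$ and $\Sigma$ in which $S$ is $\{z=0\}$, by $(b,z)\mapsto(b,z^2)$, where $z\in\mathbb C$ and $b$ ranges over $\mathbb R^2$ if $X=S^4$, over a closed half-plane if $X=B^4$, and over $\mathbb R$ if $X=S^3$. A lift of $\sigma\colon X\to X$ is a continuous map $g\colon\Sigma\to\Sigma$ with $p\circ g=\sigma\circ p$. A deck transformation is a homeomorphism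 $t\colon \Sigma\to\Sigma$ with $p\circ t=p$. Proposition. Let $(X,S,\sigma)$ be one of the following. 1. $X=S^4$, $S\subset S^4$ is a closed, connected, smoothly embedded surface, and $\sigma$ is a smooth involution of $(S^4,S)$ such that $\mathrm{Fix}(\sigma)$ is non-empty and contained in $S$. 2. $X=B^4$, $S\subset B^4$ is a compact, smooth, properly embedded surface (meeting $S^3=\partial B^4$ transversely, and exactly in $\partial S$) whose boundary is a knot $K\subset S^3$, and $\sigma$ is a smooth involution of $(B^4,S)$ such that either $\sigma$ restricts to an involution $\sigma_0$ of $S^3$ for which $(K,\sigma_0)$ is strongly negative amphichiral, or $\mathrm{Fix}(\sigma)$ is non-empty and contained in $S$. 3. $X=S^3$, $S=K$ is a knot, and $\sigma$ is a smooth involution of $(S^3,K)$ such that $\mathrm{Fix}(\sigma)$ is non-empty and contained in $K$ (for example, $(K,\sigma)$ is strongly negative amphichiral). Let $p\colon\Sigma\to X$ be any double branched cover of $X$ along $S$. Then $p$ has a unique non-trivial deck transformation $\tau$. There is a homeomorphism $\widetilde\sigma\colon\Sigma\to\Sigma$ with $p\circ\widetilde\sigma=\sigma\circ p$, and $\sigma$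 has exactly two lifts, the two distinct maps $\widetilde\sigma$ and $\widetilde\sigma^{3}$. Moreover $\widetilde\sigma^{2}=(\widetilde\sigma^{3})^{2}=\tau$, and both lifts have order $4$. -/

import Mathlib

open scoped Manifold ContDiff

namespace BranchedLift

/-- The sphere `S⁴ ⊆ ℝ⁵`, with Mathlib's smooth structure. -/
abbrev S4 : Type := Metric.sphere (0 : EuclideanSpace ℝ (Fin 5)) 1

/-- The sphere `S³ ⊆ ℝ⁴`, with Mathlib's smooth structure. -/
abbrev S3 : Type := Metric.sphere (0 : EuclideanSpace ℝ (Fin 4)) 1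

/-- The closed unit ball `B⁴ ⊆ ℝ⁴`; its boundary is `S³`. -/
abbrev B4 : Type := Metric.closedBall (0 : EuclideanSpace ℝ (Fin 4)) 1

/-- The inclusion `S³ = ∂B⁴ → B⁴`. -/
def boundaryInclusion (x : S3) : B4 := ⟨x.1, Metric.sphere_subset_closedBall x.2⟩

/-- A self-map of `B⁴` is smooth (up to the boundary) if it is the restriction of a smooth map
`ℝ⁴ → ℝ⁴`. -/
def SmoothOnB4 (σ : B4 → B4) : Prop :=
  ∃ g : EuclideanSpace ℝ (Fin 4) → EuclideanSpace ℝ (Fin 4),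
    ContDiff ℝ ∞ g ∧ ∀ x : B4, g x = (σ x : EuclideanSpace ℝ (Fin 4))

/-- `f : F → B⁴` is a proper smooth embedding of the surface with boundary `F`, with
`f(∂F) = K ⊆ S³`: a smooth embedding, with `f⁻¹(S³) = ∂F`, which meets `S³` transversely
(that is, `d(‖f‖²) ≠ 0` at the boundary points). -/
structure IsProperSmoothEmbedding {F : Type*} [TopologicalSpace F]
    [ChartedSpace (EuclideanHalfSpace 2) F] (f : F → B4) (K : Set S3) : Prop where
  embedding : Manifold.IsSmoothEmbedding (𝓡∂ 2) (𝓡 4) ∞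
    (fun x => (f x : EuclideanSpace ℝ (Fin 4)))
  proper : ∀ x : F, ‖(f x : EuclideanSpace ℝ (Fin 4))‖ = 1 ↔ x ∈ (𝓡∂ 2).boundary F
  transverse : ∀ x ∈ (𝓡∂ 2).boundary F,
    mfderiv (𝓡∂ 2) 𝓘(ℝ, ℝ) (fun y => ‖(f y : EuclideanSpace ℝ (Fin 4))‖ ^ 2) x ≠ 0
  boundary : f '' (𝓡∂ 2).boundary F = boundaryInclusion '' K

/-- `σ` is an involution of the pair `(X, S)`. -/
structure IsInvolutionOfPair {X : Type*} (σ : X → X) (S : Set X) : Prop where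
  involutive : Function.Involutive σ
  preserves : σ '' S = S

/-- The fixed-point set of `σ` is non-empty and contained in `S`. -/
structure FixedSetIn {X : Type*} (σ : X → X) (S : Set X) : Prop where
  nonempty : (Function.fixedPoints σ).Nonempty
  subset : Function.fixedPoints σ ⊆ S

/-- `(k(S¹), σ)` is a strongly negative amphichiral knot: `k` is a smooth embedding of the circle
in `S³`, and `σ` is a smooth involution of `S³` that preserves the knot and has exactly two fixed
points, both on the knot. (Such an involution automatically reverses the orientation.) -/
structure IsStronglyNegativeAmphichiral (k : Circle → S3) (σ : S3 → S3) : Prop where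
  knot : Manifold.IsSmoothEmbedding (𝓡 1) (𝓡 3) ∞ k
  smooth : ContMDiff (𝓡 3) (𝓡 3) ∞ σ
  involution : IsInvolutionOfPair σ (Set.range k)
  two_fixed : (Function.fixedPoints σ).ncard = 2
  fixed_on_knot : Function.fixedPoints σ ⊆ Set.range k

/-- The local model `(b, z) ↦ (b, z²)` of a double branched cover, branched along `B × {0}`. -/
def squareModel (B : Type*) (y : B × ℂ) : B × ℂ := (y.1, y.2 ^ 2)

/-- `p : Y → X` is a double cover of `X` branched (exactly) along `S`: it is a two-sheeted covering
over the complement of `S`, and every point of `S` has an open neighbourhood `U` such that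
`(U, U ∩ S)` and `p : p⁻¹(U) → U` are, in suitable coordinates, given by `(B × ℂ, B × {0})` and
`(b, z) ↦ (b, z²)`, restricted to an open subset of the target and its full preimage.
Here `B` is `ℝᵏ`, or a half-space if `X` has a boundary that `S` meets transversely. -/
structure IsDoubleBranchedCover (B : Type*) [TopologicalSpace B]
    {X Y : Type*} [TopologicalSpace X] [TopologicalSpace Y] (p : Y → X) (S : Set X) : Prop where
  continuous : Continuous p
  covering : IsCoveringMapOn p Sᶜ
  two_sheeted : ∀ x ∈ Sᶜ, (p ⁻¹' {x}).ncard = 2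
  branched : ∀ s ∈ S, ∃ (φ : OpenPartialHomeomorph X (B × ℂ)) (ψ : OpenPartialHomeomorph Y (B × ℂ)),
    s ∈ φ.source ∧ ψ.source = p ⁻¹' φ.source ∧ ψ.target = squareModel B ⁻¹' φ.target ∧
    (∀ y ∈ ψ.source, φ (p y) = squareModel B (ψ y)) ∧
    (∀ x ∈ φ.source, x ∈ S ↔ (φ x).2 = 0)

/-- `τ` is a non-trivial deck transformation of `p`. -/
def IsNontrivialDeck {X Y : Type*} [TopologicalSpace Y] (p : Y → X) (τ : Y ≃ₜ Y) : Prop :=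
  p ∘ τ = p ∧ τ ≠ 1

/-- The set of all lifts of `σ : X → X` along `p : Y → X`: continuous maps `g : Y → Y` such that
`p ∘ g = σ ∘ p`. -/
def lifts {X Y : Type*} [TopologicalSpace Y] (p : Y → X) (σ : X → X) : Set (Y → Y) :=
  {g | Continuous g ∧ p ∘ g = σ ∘ p}

/-- `p` has a unique non-trivial deck transformation `τ`, and `σ` has exactly two lifts along `p`;
these are two different homeomorphisms `σ'` and `σ'³`, both of order four and with square `τ`. -/
def HasExactlyTwoLiftsOfOrderFour {X Y : Type*} [TopologicalSpace Y]
    (p : Y → X) (σ : X → X) : Prop :=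
  (∃! τ : Y ≃ₜ Y, IsNontrivialDeck p τ) ∧
  ∀ τ : Y ≃ₜ Y, IsNontrivialDeck p τ →
    ∃ σ' : Y ≃ₜ Y,
      lifts p σ = {⇑σ', ⇑(σ' ^ 3)} ∧ σ' ≠ σ' ^ 3 ∧
      σ' ^ 2 = τ ∧ (σ' ^ 3) ^ 2 = τ ∧ orderOf σ' = 4 ∧ orderOf (σ' ^ 3) = 4

end BranchedLift

/-!
Let `p : Σ → X` be a double cover branched along `S`, and `σ` an involution of the pair `(X, S)`.

Uniqueness. Near a branch point, `X` is `B × ℂ` with `B` convex and `S = B × 0`, and `p` is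
`(b, w) ↦ (b, w ^ 2)`. Hence the preimage of a small punctured neighbourhood of a branch point is
connected, and so is the preimage of the complement of `S`
(`IsTameDoubleCover.isPreconnected_preimage_diff`). By uniqueness of lifts along coverings, two
lifts of `σ` are equal or differ by the map `τ = sheetSwap p`, which exchanges the two points of
each fibre; for `σ = id` this says that `τ` is the only nontrivial deck transformation.

Existence. A lift of `σ` is the same as an isomorphism from `p` to the double cover `σ ∘ p`, whose
branch set is also `S`. Such isomorphisms exist locally: off `S` because coverings are locally
trivial, and at a point of `S` because every double cover that is connected over the punctured
neighbourhoods of `S` is parametrized by the square root of the normal coordinate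
(`FlatChart.exists_rootParametrization`). Each point has exactly two germs of isomorphisms, and
these germs form a double cover of `X`, branch points included. It has a section over any simply
connected piece of `X` (`exists_sheetIso_of_simplyConnected`), which provides an isomorphism there.
The ball is one such piece, and a sphere is the union of two, the complements of two points, whose
intersection is connected (`IsSheetIso.exists_union`).

Order. The square of a lift `g` is a lift of `σ ∘ σ = id`, so it is `id` or `τ`, and one point that
it moves suffices to see that it is `τ`. This is where smoothness and the hypothesis on the fixed
points enter. At a fixed point on `S`, the derivative of `σ` acts by `-1` on the normal directions
of `S`, because `σ` is conjugate to its derivative, and all its fixed points lie on `S`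
(`fderiv_involution_normal`). In the square root `w` of the normal coordinate `z`, the map `z ↦ -z`
becomes a turn by a right angle, in one direction or the other, and the square of either is
`w ↦ -w` (`IsTameDoubleCover.exists_lift_lift_ne`). The charts of the given cover are only
topological, so the comparison is made in smooth charts adapted to `S`, in which the cover is
parametrized anew.

For the ball, the fixed point may lie on the boundary sphere, and the hypothesis may concern the
fixed points on this sphere only. Then one uses coordinates in which both the sphere and the
surface are flat (`exists_boundary_straightening`), where transversality is needed. The derivative
is `-1` on normal vectors along the sphere by the same argument as before, and it preserves the
tangent plane of the surface, which contains the inward direction (`fderiv_boundary_involution`).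
-/

open scoped Manifold ContDiff

namespace BranchedLift

open Topology Set Filter

/-! ### Double covers branched along a closed set -/

section DoubleCovers

variable {X Y A : Type*} [TopologicalSpace X] [TopologicalSpace Y] [TopologicalSpace A]

/-- The topological properties of a double cover branched along a closed set `S` on which the
argument relies. Unlike the existence of coordinates `(b, z) ↦ (b, z ^ 2)`, they mention no model,
so they visibly survive composition with a homeomorphism of the base that preserves `S`. A branch
point has a single preimage, whose neighbourhoods all contain the full preimage of a neighbourhood
of the branch point (`nhds_le`), and the branching is nontrivial: the preimage of a small punctured
neighbourhood `V \ S` is connected (`connected`). -/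
structure IsTameDoubleCover (p : Y → X) (S : Set X) : Prop where
  continuous : Continuous p
  isClosed : IsClosed S
  covering : IsCoveringMapOn p Sᶜ
  two_sheeted : ∀ x ∈ Sᶜ, (p ⁻¹' {x}).ncard = 2
  surj : ∀ x ∈ S, ∃ y, p y = x
  eq_of_mem : ∀ y y', p y ∈ S → p y' = p y → y' = y
  nhds_le : ∀ y, p y ∈ S → comap p (𝓝 (p y)) ≤ 𝓝 y
  neBot : ∀ s ∈ S, (𝓝[Sᶜ] s).NeBot
  connected : ∀ s ∈ S, ∀ U ∈ 𝓝 s, ∃ V ∈ 𝓝 s, V ⊆ U ∧ IsPreconnected (p ⁻¹' (V \ S))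

open Classical in
/-- The other point of the fibre through `y`, or `y` itself if it is alone in its fibre. In a
two-element fibre, the choice is no choice. -/
noncomputable def sheetSwap {X Y : Type*} (p : Y → X) (y : Y) : Y :=
  if h : ∃ y', p y' = p y ∧ y' ≠ y then h.choose else y

theorem map_sheetSwap {X Y : Type*} (p : Y → X) (y : Y) : p (sheetSwap p y) = p y := by
  unfold sheetSwap
  split_ifs with h
  · exact h.choose_spec.1
  · rfl

namespace IsTameDoubleCover

variable {p : Y → X} {S : Set X} (hp : IsTameDoubleCover p S)
include hp

theorem surjective : Function.Surjective p := by
  intro x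
  by_cases hx : x ∈ S
  · exact hp.surj x hx
  · have h := hp.two_sheeted x hx
    have : (p ⁻¹' {x}).Nonempty := by
      rw [← Set.ncard_pos (Set.finite_of_ncard_ne_zero (by omega))]; omega
    exact this

theorem sheetSwap_of_mem {y : Y} (hy : p y ∈ S) : sheetSwap p y = y :=
  hp.eq_of_mem _ _ hy (map_sheetSwap p y)

theorem exists_fiber_eq {x : X} (hx : x ∉ S) : ∃ y y', y ≠ y' ∧ p ⁻¹' {x} = {y, y'} :=
  Set.ncard_eq_two.1 (hp.two_sheeted x hx)

theorem sheetSwap_ne {y : Y} (hy : p y ∉ S) : sheetSwap p y ≠ y := by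
  obtain ⟨a, b, hab, h⟩ := hp.exists_fiber_eq hy
  have hex : ∃ y', p y' = p y ∧ y' ≠ y := by
    have ha : p a = p y := by
      have : a ∈ p ⁻¹' {p y} := by rw [h]; simp
      exact this
    have hb : p b = p y := by
      have : b ∈ p ⁻¹' {p y} := by rw [h]; simp
      exact this
    by_cases hya : a = y
    · exact ⟨b, hb, fun hb' => hab (hya.trans hb'.symm)⟩
    · exact ⟨a, ha, hya⟩
  unfold sheetSwap
  rw [dif_pos hex]
  exact hex.choose_spec.2

theorem eq_or_eq_sheetSwap {y y' : Y} (h : p y' = p y) : y' = y ∨ y' = sheetSwap p y := by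
  by_cases hy : p y ∈ S
  · exact Or.inl (hp.eq_of_mem _ _ hy h)
  · obtain ⟨a, b, hab, hf⟩ := hp.exists_fiber_eq hy
    have h1 : y ∈ p ⁻¹' {p y} := rfl
    have h2 : y' ∈ p ⁻¹' {p y} := h
    have h3 : sheetSwap p y ∈ p ⁻¹' {p y} := map_sheetSwap p y
    have h4 := hp.sheetSwap_ne hy
    rw [hf] at h1 h2 h3
    simp only [mem_insert_iff, mem_singleton_iff] at h1 h2 h3
    grind

theorem sheetSwap_sheetSwap (y : Y) : sheetSwap p (sheetSwap p y) = y := by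
  by_cases hy : p y ∈ S
  · rw [hp.sheetSwap_of_mem hy, hp.sheetSwap_of_mem hy]
  · have h1 := hp.sheetSwap_ne (y := sheetSwap p y) (by rwa [map_sheetSwap p])
    rcases hp.eq_or_eq_sheetSwap
      (show p (sheetSwap p (sheetSwap p y)) = p y by simp [map_sheetSwap p]) with h | h
    · exact h
    · exact absurd h h1

/-- Two points in the same fibre which are distinct are exchanged by the sheet swap. -/
theorem eq_sheetSwap_of_ne {y y' : Y} (h : p y' = p y) (hne : y' ≠ y) : y' = sheetSwap p y :=
  (hp.eq_or_eq_sheetSwap h).resolve_left hne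

/-- Off the branch set, `p` has locally two complementary sections with open images; together they
trivialize `p`. -/
theorem exists_sections {x : X} (hx : x ∉ S) : ∃ U : Set X, IsOpen U ∧ x ∈ U ∧ U ⊆ Sᶜ ∧
    ∃ s s' : X → Y, ContinuousOn s U ∧ ContinuousOn s' U ∧
      (∀ u ∈ U, p (s u) = u) ∧ (∀ u ∈ U, s' u = sheetSwap p (s u)) ∧
      IsOpen {y | p y ∈ U ∧ y = s (p y)} ∧ IsOpen {y | p y ∈ U ∧ y = s' (p y)} := by
  obtain ⟨hd, U, hxU, hU, -, H, hH⟩ := hp.covering x hx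
  obtain ⟨a, b, hab, hf⟩ := hp.exists_fiber_eq hx
  have ha : a ∈ p ⁻¹' {x} := by rw [hf]; simp
  have hb : b ∈ p ⁻¹' {x} := by rw [hf]; simp
  have hd' : DiscreteTopology (p ⁻¹' {x}) := hd
  have hy0 : Nonempty Y := ⟨a⟩
  have key : ∀ i : p ⁻¹' {x}, ∃ s : X → Y, ContinuousOn s U ∧ (∀ u (hu : u ∈ U), s u =
      (H.symm (⟨u, hu⟩, i)).1) ∧ (∀ u ∈ U, p (s u) = u) ∧
      {y | p y ∈ U ∧ y = s (p y)} = Subtype.val '' {y : p ⁻¹' U | (H y).2 = i} := by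
    intro i
    classical
    let s : X → Y := fun u => if hu : u ∈ U then (H.symm (⟨u, hu⟩, i)).1 else Classical.arbitrary Y
    have hs : ∀ u (hu : u ∈ U), s u = (H.symm (⟨u, hu⟩, i)).1 := fun u hu => dif_pos hu
    have hps : ∀ u ∈ U, p (s u) = u := by
      intro u hu
      rw [hs u hu, ← hH]; simp
    refine ⟨s, ?_, hs, hps, ?_⟩
    · rw [continuousOn_iff_continuous_domRestrict]
      have : U.domRestrict s = fun u : U => (H.symm (u, i)).1 := by
        ext u; exact hs u.1 u.2
      rw [this]
      fun_prop
    · ext y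
      constructor
      · rintro ⟨hy, h⟩
        refine ⟨⟨y, hy⟩, ?_, rfl⟩
        have : (⟨y, hy⟩ : p ⁻¹' U) = H.symm (⟨p y, hy⟩, i) :=
          Subtype.ext (h.trans (hs _ hy))
        simp [this]
      · rintro ⟨y, hy, rfl⟩
        refine ⟨y.2, ?_⟩
        rw [hs _ y.2]
        have : (⟨p y, y.2⟩, i) = H y := Prod.ext (Subtype.ext (hH y).symm) hy.symm
        rw [this]; simp
  have hV : IsOpen (U ∩ Sᶜ) := hU.inter hp.isClosed.isOpen_compl
  have hopen : ∀ (i : p ⁻¹' {x}) (s : X → Y),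
      {y | p y ∈ U ∧ y = s (p y)} = Subtype.val '' {y : p ⁻¹' U | (H y).2 = i} →
      IsOpen {y | p y ∈ U ∩ Sᶜ ∧ y = s (p y)} := by
    intro i s h
    have h1 : IsOpen {y | p y ∈ U ∧ y = s (p y)} := by
      rw [h]
      refine (hU.preimage hp.continuous).isOpenMap_subtype_val _ ?_
      exact (isOpen_discrete {i}).preimage (f := fun y => (H y).2) (by fun_prop)
    have h2 := h1.inter (hp.isClosed.isOpen_compl.preimage hp.continuous)
    convert h2 using 1
    ext y; simp only [mem_ofPred_eq, mem_inter_iff, mem_preimage]; tauto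
  obtain ⟨s, hsc, hs, hps, hso⟩ := key ⟨a, ha⟩
  obtain ⟨s', hsc', hs', hps', hso'⟩ := key ⟨b, hb⟩
  refine ⟨U ∩ Sᶜ, hV, ⟨hxU, hx⟩, inter_subset_right, s, s', hsc.mono inter_subset_left,
    hsc'.mono inter_subset_left, fun u hu => hps u hu.1, fun u hu => ?_, hopen _ _ hso,
    hopen _ _ hso'⟩
  refine hp.eq_sheetSwap_of_ne ((hps' u hu.1).trans (hps u hu.1).symm) fun h => hab ?_
  rw [hs u hu.1, hs' u hu.1] at h
  have h2 := H.symm.injective (Subtype.ext h)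
  simpa using (congrArg (fun z => (z.2 : Y)) h2).symm

/-- At a point over the branch set, a map to the total space is continuous as soon as its projection
is. This is how continuity of lifts is extended over the branch set. -/
theorem continuousAt_of_mem {g : A → Y} {a : A} (ha : p (g a) ∈ S)
    (h : ContinuousAt (p ∘ g) a) : ContinuousAt g a := by
  have h1 : Tendsto g (𝓝 a) (comap p (𝓝 (p (g a)))) := tendsto_comap_iff.2 h
  exact h1.mono_right (hp.nhds_le _ ha)

theorem continuous_sheetSwap : Continuous (sheetSwap p) := by
  rw [continuous_iff_continuousAt]
  intro y
  by_cases hy : p y ∈ S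
  · refine hp.continuousAt_of_mem (by rwa [map_sheetSwap p]) ?_
    have : p ∘ sheetSwap p = p := funext (map_sheetSwap p)
    rw [this]
    exact hp.continuous.continuousAt
  · obtain ⟨U, hU, hyU, hUS, s, s', hs, hs', hps, hss', ho, ho'⟩ := hp.exists_sections hy
    rcases hp.eq_or_eq_sheetSwap (y' := y) (hps _ hyU).symm with h | h
    · have : sheetSwap p =ᶠ[𝓝 y] s' ∘ p := by
        filter_upwards [ho.mem_nhds ⟨hyU, h⟩] with z hz
        rw [Function.comp_apply, hss' _ hz.1, ← hz.2]
      refine ContinuousAt.congr ?_ this.symm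
      exact ContinuousAt.comp (hs'.continuousAt (hU.mem_nhds hyU)) hp.continuous.continuousAt
    · have : sheetSwap p =ᶠ[𝓝 y] s ∘ p := by
        filter_upwards [ho'.mem_nhds ⟨hyU, h.trans (hss' _ hyU).symm⟩] with z hz
        rw [hz.2, hss' _ hz.1, hp.sheetSwap_sheetSwap, Function.comp_apply, map_sheetSwap p,
          hps _ hz.1]
      refine ContinuousAt.congr ?_ this.symm
      exact ContinuousAt.comp (hs.continuousAt (hU.mem_nhds hyU)) hp.continuous.continuousAt

/-- Two lifts of one map, on a connected set that avoids the branch set, are equal or differ by the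
sheet swap. -/
theorem eqOn_or_eqOn_sheetSwap {T : Set A} (hT : IsPreconnected T) {g h : A → Y}
    (hg : ContinuousOn g T) (hh : ContinuousOn h T) (hgh : ∀ a ∈ T, p (g a) = p (h a))
    (hS : ∀ a ∈ T, p (h a) ∉ S) : EqOn g h T ∨ EqOn g (sheetSwap p ∘ h) T := by
  have key : ∀ f : A → Y, ContinuousOn f T → (∀ a ∈ T, p (g a) = p (f a)) →
      (∀ a ∈ T, p (f a) ∉ S) → ∀ a ∈ T, g a = f a → EqOn g f T := by
    intro f hf hgf hfS a ha hga b hb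
    have : PreconnectedSpace T := isPreconnected_iff_preconnectedSpace.1 hT
    let g' : T → p ⁻¹' Sᶜ := fun t => ⟨g t, by
      rw [mem_preimage, hgf t t.2]; exact hfS t t.2⟩
    let f' : T → p ⁻¹' Sᶜ := fun t => ⟨f t, hfS t t.2⟩
    have h1 := hp.covering.isCoveringMap_restrictPreimage.eq_of_comp_eq (g₁ := g') (g₂ := f')
      (by
        have := continuousOn_iff_continuous_domRestrict.1 hg
        exact this.subtype_mk _)
      (by
        have := continuousOn_iff_continuous_domRestrict.1 hf
        exact this.subtype_mk _)
      (by
        ext t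
        exact hgf t t.2) ⟨a, ha⟩ (Subtype.ext hga)
    exact congrArg Subtype.val (congrFun h1 ⟨b, hb⟩)
  rcases T.eq_empty_or_nonempty with rfl | ⟨a, ha⟩
  · exact Or.inl (by simp)
  · rcases hp.eq_or_eq_sheetSwap (hgh a ha) with h1 | h1
    · exact Or.inl (key h hh hgh hS a ha h1)
    · refine Or.inr (key _ (hp.continuous_sheetSwap.comp_continuousOn hh) (fun a ha => ?_)
        (fun a ha => ?_) a ha h1)
      · rw [hgh a ha, Function.comp_apply, map_sheetSwap p]
      · rw [Function.comp_apply, map_sheetSwap p]; exact hS a ha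

end IsTameDoubleCover

end DoubleCovers

/-! ### Flat charts and square-root parametrizations -/

section FlatCharts

variable {X Y V : Type*} [TopologicalSpace X] [TopologicalSpace Y] [NormedAddCommGroup V]
  [NormedSpace ℝ V]

/-- A chart of `X` onto a product of a convex set `base` and a disc, in which `S` is the zero
section. It is a `PartialEquiv`, and not an `OpenPartialHomeomorph`, since at a boundary point of
`X` the target is not open in `V × ℂ`. -/
structure FlatChart (S : Set X) (V : Type*) [NormedAddCommGroup V] [NormedSpace ℝ V] extends
    PartialEquiv X (V × ℂ) where
  base : Set V
  radius : ℝ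
  convex_base : Convex ℝ base
  radius_pos : 0 < radius
  target_eq : target = base ×ˢ Metric.ball 0 radius
  open_source : IsOpen source
  continuousOn_toFun : ContinuousOn toFun source
  continuousOn_invFun : ContinuousOn invFun target
  mem_iff : ∀ x ∈ source, x ∈ S ↔ (toFun x).2 = 0

/-- A function of period `2πi` on a left half-plane does not see the branch of the logarithm. -/
theorem apply_log_eq {Z : Type*} {c : ℝ} {M : ℂ → Z}
    (hM : ∀ ζ : ℂ, ζ.re < c → M (ζ + 2 * Real.pi * Complex.I) = M ζ) {ζ : ℂ} (hζ : ζ.re < c) :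
    M (Complex.log (Complex.exp ζ)) = M ζ := by
  have key : ∀ (n : ℕ) (ζ : ℂ), ζ.re < c → M (ζ + n * (2 * Real.pi * Complex.I)) = M ζ := by
    intro n
    induction n with
    | zero => intro ζ _; simp
    | succ n ih =>
      intro ζ hζ
      rw [← ih ζ hζ, ← hM (ζ + n * (2 * Real.pi * Complex.I)) (by simpa using hζ)]
      congr 1; push_cast; ring
  have h0 : Complex.exp (Complex.log (Complex.exp ζ)) = Complex.exp ζ :=
    Complex.exp_log (Complex.exp_ne_zero _)
  obtain ⟨n, hn⟩ := Complex.exp_eq_exp_iff_exists_int.1 h0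
  obtain ⟨m, rfl | rfl⟩ := n.eq_nat_or_neg
  · rw [hn]; exact_mod_cast key m ζ hζ
  · rw [← key m (Complex.log (Complex.exp ζ)) (by rw [hn]; simpa using hζ)]
    congr 1; rw [hn]; push_cast; ring

/-- A function of period `2πi` descends along `exp` to a continuous function on a punctured disc.
On the cut of `Complex.log`, the function is rewritten through `log (-w) + πi`. -/
theorem continuousOn_comp_log {V : Type*} [TopologicalSpace V] {D : Set V} {c : ℝ} {M : V × ℂ → Y}
    (hM : ContinuousOn M (D ×ˢ {ζ : ℂ | ζ.re < c}))
    (hper : ∀ b ∈ D, ∀ ζ : ℂ, ζ.re < c → M (b, ζ + 2 * Real.pi * Complex.I) = M (b, ζ)) :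
    ContinuousOn (fun a : V × ℂ => M (a.1, Complex.log a.2))
      (D ×ˢ {w : ℂ | w ≠ 0 ∧ ‖w‖ < Real.exp c}) := by
  have hre : ∀ w : ℂ, w ≠ 0 → ‖w‖ < Real.exp c → (Complex.log w).re < c := by
    intro w hw h
    rw [Complex.log_re, Real.log_lt_iff_lt_exp (norm_pos_iff.2 hw)]; exact h
  rintro ⟨b, w⟩ ⟨hb, hw, hwc⟩
  by_cases hsl : w ∈ Complex.slitPlane
  · have h1 : ContinuousWithinAt (fun a : V × ℂ => (a.1, Complex.log a.2))
        (D ×ˢ {w : ℂ | w ≠ 0 ∧ ‖w‖ < Real.exp c}) (b, w) :=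
      (continuousAt_fst.prodMk (continuousAt_snd.clog hsl)).continuousWithinAt
    exact ContinuousWithinAt.comp (t := D ×ˢ {ζ : ℂ | ζ.re < c}) (hM _ ⟨hb, hre w hw hwc⟩) h1
      (fun a ha => ⟨ha.1, hre _ ha.2.1 ha.2.2⟩)
  · have hsl' : -w ∈ Complex.slitPlane := by
      rw [Complex.mem_slitPlane_iff] at hsl ⊢
      push Not at hsl
      left
      rcases lt_or_eq_of_le hsl.1 with h | h
      · simpa using h
      · exact absurd (Complex.ext h hsl.2) hw
    have h1 : ContinuousWithinAt (fun a : V × ℂ => (a.1, Complex.log (-a.2) + Real.pi * Complex.I))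
        (D ×ˢ {w : ℂ | w ≠ 0 ∧ ‖w‖ < Real.exp c}) (b, w) :=
      (continuousAt_fst.prodMk
        ((continuousAt_snd.neg.clog hsl').add continuousAt_const)).continuousWithinAt
    have hre' : ∀ w : ℂ, w ≠ 0 → ‖w‖ < Real.exp c →
        (Complex.log (-w) + Real.pi * Complex.I).re < c := by
      intro w hw h
      simpa using hre (-w) (by simpa using hw) (by simpa using h)
    have h2 := ContinuousWithinAt.comp (x := (b, w)) (g := M)
      (f := fun a : V × ℂ => (a.1, Complex.log (-a.2) + Real.pi * Complex.I))
      (t := D ×ˢ {ζ : ℂ | ζ.re < c}) (hM _ ⟨hb, hre' w hw hwc⟩) h1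
      (fun a ha => ⟨ha.1, hre' _ ha.2.1 ha.2.2⟩)
    have h3 : ∀ a ∈ D ×ˢ {w : ℂ | w ≠ 0 ∧ ‖w‖ < Real.exp c},
        M (a.1, Complex.log a.2) = M (a.1, Complex.log (-a.2) + Real.pi * Complex.I) := by
      rintro ⟨b, w⟩ ⟨hb, hw, hwc⟩
      have h4 := apply_log_eq (M := fun ζ => M (b, ζ)) (hper b hb) (hre' w hw hwc)
      rw [← h4, Complex.exp_add, Complex.exp_log (neg_ne_zero.2 hw), Complex.exp_pi_mul_I]
      simp
    exact h2.congr h3 (h3 _ ⟨hb, hw, hwc⟩)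

namespace FlatChart

variable {S : Set X} (e : FlatChart S V)

theorem mem_target {b : V} {z : ℂ} : (b, z) ∈ e.target ↔ b ∈ e.base ∧ ‖z‖ < e.radius := by
  rw [e.target_eq]; simp

theorem symm_mem_iff {a : V × ℂ} (ha : a ∈ e.target) : e.symm a ∈ S ↔ a.2 = 0 := by
  rw [e.mem_iff _ (e.map_target ha)]
  show (e.toPartialEquiv (e.symm a)).2 = 0 ↔ _
  rw [e.right_inv ha]

/-- The domain of the square-root parametrizations. -/
def rootDomain : Set (V × ℂ) := e.base ×ˢ {w | w ≠ 0 ∧ ‖w‖ ^ 2 < e.radius}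

theorem sq_mem_target {a : V × ℂ} (ha : a ∈ e.rootDomain) : (a.1, a.2 ^ 2) ∈ e.target := by
  rw [mem_target]; exact ⟨ha.1, by rw [norm_pow]; exact ha.2.2⟩

/-- A lift of `(b, w) ↦ (b, w ^ 2)` to a double cover, for which the two square roots lie on
different sheets. -/
structure IsRootParametrization (e : FlatChart S V) (p : Y → X) (G : V × ℂ → Y) : Prop where
  continuousOn : ContinuousOn G e.rootDomain
  map : ∀ a ∈ e.rootDomain, p (G a) = e.symm (a.1, a.2 ^ 2)
  neg : ∀ a ∈ e.rootDomain, G (a.1, -a.2) = sheetSwap p (G a)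

/-- With `w = exp ζ`, the map `(b, w) ↦ (b, w ^ 2)` is defined on a convex set, so it lifts. -/
theorem exists_log_lift {p : Y → X} (hp : IsTameDoubleCover p S) (hb : e.base.Nonempty) :
    ∃ M : V × ℂ → Y, ContinuousOn M (e.base ×ˢ {ζ : ℂ | ζ.re < Real.log e.radius / 2}) ∧
      ∀ a ∈ e.base ×ˢ {ζ : ℂ | ζ.re < Real.log e.radius / 2},
        p (M a) = e.symm (a.1, Complex.exp (2 * a.2)) := by
  obtain ⟨b₀, hb₀⟩ := hb
  set T : Set (V × ℂ) := e.base ×ˢ {ζ : ℂ | ζ.re < Real.log e.radius / 2} with hT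
  have hconv : Convex ℝ T := e.convex_base.prod (convex_halfSpace_re_lt _)
  have ha₀ : (b₀, ((Real.log e.radius / 2 - 1 : ℝ) : ℂ)) ∈ T := by
    refine ⟨hb₀, ?_⟩
    simp only [mem_ofPred_eq, Complex.ofReal_re]; linarith
  have : ContractibleSpace T := hconv.contractibleSpace ⟨_, ha₀⟩
  have : LocallyPathConnectedSpace T := hconv.locallyPathConnectedSpace
  have hexp : ∀ a ∈ T, (a.1, Complex.exp (2 * a.2)) ∈ e.target := by
    rintro ⟨b, ζ⟩ ⟨hb, hζ⟩
    rw [mem_target]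
    refine ⟨hb, ?_⟩
    rw [Complex.norm_exp, ← Real.lt_log_iff_exp_lt e.radius_pos]
    simp only [mem_ofPred_eq] at hζ
    simp; linarith
  let m : C(T, X) := ⟨fun a => e.symm (a.1.1, Complex.exp (2 * a.1.2)), by
    have h1 : ContinuousOn (fun a : V × ℂ => e.symm (a.1, Complex.exp (2 * a.2))) T := by
      refine ContinuousOn.comp e.continuousOn_invFun (t := e.target) ?_ hexp
      fun_prop
    exact continuousOn_iff_continuous_domRestrict.1 h1⟩
  have hmS : ∀ a, m a ∈ Sᶜ := by
    intro a
    rw [mem_compl_iff]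
    show ¬ e.symm (a.1.1, Complex.exp (2 * a.1.2)) ∈ S
    rw [e.symm_mem_iff (hexp a a.2)]
    exact Complex.exp_ne_zero _
  obtain ⟨y₀, hy₀⟩ := hp.surjective (m ⟨_, ha₀⟩)
  obtain ⟨F, ⟨-, hF⟩, -⟩ := hp.covering.existsUnique_continuousMap_lifts m hy₀ hmS
  classical
  refine ⟨fun a => if h : a ∈ T then F ⟨a, h⟩ else y₀, ?_, ?_⟩
  · rw [continuousOn_iff_continuous_domRestrict]
    convert! F.continuous using 1
    ext a
    simp [Set.domRestrict]
  · intro a ha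
    simp only [ha, dif_pos]
    exact congrFun hF ⟨a, ha⟩

/-- In the logarithmic lift `M`, the translation `ζ ↦ ζ + πi` is either trivial or the sheet swap.
In the first case `M` would descend to a section of `p` over a punctured neighbourhood of a branch
point, against the connectedness of the preimage. In the second, `M` has period `2πi` and descends
to a function of the square root. -/
theorem exists_rootParametrization {p : Y → X} (hp : IsTameDoubleCover p S)
    (hb : e.base.Nonempty) : ∃ G, e.IsRootParametrization p G := by
  obtain ⟨M, hMc, hM⟩ := e.exists_log_lift hp hb
  set c := Real.log e.radius / 2 with hc
  set T : Set (V × ℂ) := e.base ×ˢ {ζ : ℂ | ζ.re < c} with hT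
  have hconv : Convex ℝ T := e.convex_base.prod (convex_halfSpace_re_lt _)
  have hexp : ∀ a ∈ T, (a.1, Complex.exp (2 * a.2)) ∈ e.target := by
    rintro ⟨b, ζ⟩ ⟨hb, hζ⟩
    rw [mem_target]
    refine ⟨hb, ?_⟩
    rw [Complex.norm_exp, ← Real.lt_log_iff_exp_lt e.radius_pos]
    simp only [mem_ofPred_eq] at hζ
    simp; linarith
  have hMS : ∀ a ∈ T, p (M a) ∉ S := by
    intro a ha
    rw [hM a ha, e.symm_mem_iff (hexp a ha)]
    exact Complex.exp_ne_zero _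
  have hshT : ∀ a ∈ T, (a.1, a.2 + Real.pi * Complex.I) ∈ T := by
    rintro ⟨b, ζ⟩ ⟨hb, hζ⟩
    exact ⟨hb, by simpa using hζ⟩
  have hshM : ∀ a ∈ T, p (M (a.1, a.2 + Real.pi * Complex.I)) = p (M a) := by
    intro a ha
    rw [hM _ (hshT a ha), hM _ ha]
    simp only
    rw [mul_add, Complex.exp_add, ← mul_assoc, Complex.exp_two_pi_mul_I, mul_one]
  have hexpc : Real.exp c ^ 2 = e.radius := by
    rw [← Real.exp_nat_mul, hc]
    push_cast
    rw [mul_div_cancel₀ _ two_ne_zero, Real.exp_log e.radius_pos]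
  rcases hp.eqOn_or_eqOn_sheetSwap hconv.isPreconnected
    (g := fun a => M (a.1, a.2 + Real.pi * Complex.I)) (h := M)
    (hMc.comp (by fun_prop) hshT) hMc hshM hMS with h | h
  · exfalso
    -- `M` has period `πi`, so it descends to a section of `p` over the punctured chart domain
    let M' : V × ℂ → Y := fun a => M (a.1, a.2 / 2)
    have hM'T : ∀ a ∈ e.base ×ˢ {ζ : ℂ | ζ.re < Real.log e.radius}, (a.1, a.2 / 2) ∈ T := by
      rintro ⟨b, ζ⟩ ⟨hb, hζ⟩
      refine ⟨hb, ?_⟩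
      simp only [mem_ofPred_eq] at hζ
      have : (ζ / 2).re = ζ.re / 2 := by simp
      simp only [mem_ofPred_eq, this, hc]; linarith
    have hM'c : ContinuousOn M' (e.base ×ˢ {ζ : ℂ | ζ.re < Real.log e.radius}) :=
      hMc.comp (by fun_prop) hM'T
    have hN := continuousOn_comp_log hM'c (by
      intro b hb ζ hζ
      have := h (hM'T (b, ζ) ⟨hb, hζ⟩)
      simp only at this
      show M (b, (ζ + 2 * Real.pi * Complex.I) / 2) = M (b, ζ / 2)
      rw [← this]; congr 2; ring)
    rw [Real.exp_log e.radius_pos] at hN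
    obtain ⟨b₀, hb₀⟩ := hb
    have ht0 : (b₀, (0 : ℂ)) ∈ e.target := e.mem_target.2 ⟨hb₀, by simpa using e.radius_pos⟩
    have hs0 : e.symm (b₀, 0) ∈ S := (e.symm_mem_iff ht0).2 rfl
    obtain ⟨W, hW, hWe, hWc⟩ := hp.connected _ hs0 e.source
      (e.open_source.mem_nhds (e.map_target ht0))
    have hmaps : ∀ x ∈ W \ S, e.toPartialEquiv x ∈
        e.base ×ˢ {w : ℂ | w ≠ 0 ∧ ‖w‖ < e.radius} := by
      intro x hx
      have h1 := e.map_source (hWe hx.1)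
      rw [← Prod.mk.eta (p := e.toPartialEquiv x), mem_target] at h1
      exact ⟨h1.1, fun h => hx.2 ((e.mem_iff x (hWe hx.1)).2 h), h1.2⟩
    let N : X → Y := fun x =>
      M' ((e.toPartialEquiv x).1, Complex.log (e.toPartialEquiv x).2)
    have hNc : ContinuousOn N (W \ S) :=
      hN.comp (e.continuousOn_toFun.mono (sdiff_subset.trans hWe)) hmaps
    have hpN : ∀ x ∈ W \ S, p (N x) = x := by
      intro x hx
      have h1 := hmaps x hx
      have h2 : ((e.toPartialEquiv x).1, Complex.log (e.toPartialEquiv x).2 / 2) ∈ T := by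
        refine hM'T ((e.toPartialEquiv x).1, Complex.log (e.toPartialEquiv x).2) ⟨h1.1, ?_⟩
        simp only [mem_ofPred_eq]
        rw [Complex.log_re]
        exact Real.log_lt_log (norm_pos_iff.2 h1.2.1) h1.2.2
      show p (M _) = x
      rw [hM _ h2]
      simp only
      rw [mul_div_cancel₀ _ two_ne_zero, Complex.exp_log h1.2.1, Prod.mk.eta]
      exact e.left_inv (hWe hx.1)
    have := hp.neBot _ hs0
    obtain ⟨x, hx⟩ : (W ∩ Sᶜ).Nonempty := Filter.nonempty_of_mem
      (inter_mem (mem_nhdsWithin_of_mem_nhds hW) self_mem_nhdsWithin : _ ∈ 𝓝[Sᶜ] (e.symm (b₀, 0)))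
    obtain ⟨y, rfl⟩ := hp.surjective x
    have hy : y ∈ p ⁻¹' (W \ S) := hx
    have hy' : sheetSwap p y ∈ p ⁻¹' (W \ S) := by rw [mem_preimage, map_sheetSwap p]; exact hx
    have hne := hp.sheetSwap_ne hx.2
    rcases hp.eqOn_or_eqOn_sheetSwap hWc (g := id) (h := N ∘ p) continuousOn_id
      (hNc.comp hp.continuous.continuousOn fun _ h => h)
      (fun a ha => (hpN _ ha).symm) (fun a ha => by
        rw [Function.comp_apply, hpN _ ha]; exact ha.2) with h | h
    all_goals
      have h1 := h hy
      have h2 := h hy'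
      simp only [id, Function.comp_apply, map_sheetSwap p] at h1 h2
      exact hne (h2.trans h1.symm)
  · have hper : ∀ b ∈ e.base, ∀ ζ : ℂ, ζ.re < c →
        M (b, ζ + 2 * Real.pi * Complex.I) = M (b, ζ) := by
      intro b hb ζ hζ
      have h1 := h (show (b, ζ) ∈ T from ⟨hb, hζ⟩)
      have h2 := h (hshT (b, ζ) ⟨hb, hζ⟩)
      simp only [Function.comp_apply] at h1 h2
      rw [h1, hp.sheetSwap_sheetSwap] at h2
      rw [← h2]; congr 2; ring
    have hdom : e.rootDomain = e.base ×ˢ {w : ℂ | w ≠ 0 ∧ ‖w‖ < Real.exp c} := by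
      unfold rootDomain
      congr 1; ext w
      simp only [mem_ofPred_eq, ← hexpc]
      rw [pow_lt_pow_iff_left₀ (norm_nonneg _) (Real.exp_pos _).le two_ne_zero]
    have hlogT : ∀ a ∈ e.rootDomain, (a.1, Complex.log a.2) ∈ T := by
      intro a ha
      rw [hdom] at ha
      refine ⟨ha.1, ?_⟩
      simp only [mem_ofPred_eq]
      rw [Complex.log_re, Real.log_lt_iff_lt_exp (norm_pos_iff.2 ha.2.1)]
      exact ha.2.2
    refine ⟨fun a => M (a.1, Complex.log a.2), ?_, ?_, ?_⟩
    · rw [hdom]; exact continuousOn_comp_log hMc hper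
    · intro a ha
      rw [hM _ (hlogT a ha)]
      simp only
      rw [two_mul, Complex.exp_add, Complex.exp_log ha.2.1, sq]
    · intro a ha
      have h1 := h (hlogT a ha)
      simp only [Function.comp_apply] at h1
      rw [← h1]
      have h2 := apply_log_eq (M := fun ζ => M (a.1, ζ)) (hper _ ha.1)
        (show (Complex.log a.2 + Real.pi * Complex.I).re < c from (hshT _ (hlogT a ha)).2)
      rw [Complex.exp_add, Complex.exp_log ha.2.1, Complex.exp_pi_mul_I, mul_neg_one] at h2
      exact h2

namespace IsRootParametrization

variable {e} {p : Y → X} {G : V × ℂ → Y}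

theorem map_notMem (hG : e.IsRootParametrization p G) {a : V × ℂ} (ha : a ∈ e.rootDomain) :
    p (G a) ∉ S := by
  rw [hG.map a ha, e.symm_mem_iff (e.sq_mem_target ha)]
  exact pow_ne_zero 2 ha.2.1

theorem eq_of_map_eq (hG : e.IsRootParametrization p G) {a a' : V × ℂ} (ha : a ∈ e.rootDomain)
    (ha' : a' ∈ e.rootDomain) (h : p (G a) = p (G a')) : a.1 = a'.1 ∧ a.2 ^ 2 = a'.2 ^ 2 := by
  rw [hG.map a ha, hG.map a' ha'] at h
  simpa using e.symm.injOn (e.sq_mem_target ha) (e.sq_mem_target ha') h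

end IsRootParametrization

end FlatChart

end FlatCharts

/-! ### Local coordinates of a branched double cover -/

section BranchedCharts

variable {X Y V : Type*} [TopologicalSpace X] [TopologicalSpace Y] [NormedAddCommGroup V]
  [NormedSpace ℝ V]

/-- `k` and its inverse `g` identify the part of the total space over the chart `e` with
`{(b, w) | ‖w‖ ^ 2 < e.radius}`, in such a way that `p` becomes `(b, w) ↦ (b, w ^ 2)`. -/
structure FlatChart.HasRootCoordinates {S : Set X} (e : FlatChart S V) (p : Y → X)
    (k : Y → V × ℂ) (g : V × ℂ → Y) : Prop where
  continuousOn : ContinuousOn k (p ⁻¹' e.source)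
  map : ∀ y ∈ p ⁻¹' e.source, e.toPartialEquiv (p y) = ((k y).1, (k y).2 ^ 2)
  continuousOn_inv : ContinuousOn g (e.base ×ˢ {w | ‖w‖ ^ 2 < e.radius})
  mapsTo_inv : MapsTo g (e.base ×ˢ {w | ‖w‖ ^ 2 < e.radius}) (p ⁻¹' e.source)
  left_inv : ∀ y ∈ p ⁻¹' e.source, g (k y) = y
  right_inv : ∀ a ∈ e.base ×ˢ {w | ‖w‖ ^ 2 < e.radius}, k (g a) = a

/-- The charts in the definition of a branched cover can be cut down to a convex set times a disc,
once the model `B` is embedded as a convex set in a normed space. -/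
theorem IsDoubleBranchedCover.exists_flatChart {B : Type*} [TopologicalSpace B] {p : Y → X}
    {S : Set X} (hp : IsDoubleBranchedCover B p S) {ι : B → V} (hι : IsEmbedding ι)
    (hconv : Convex ℝ (range ι)) {s : X} (hs : s ∈ S) {U : Set X} (hU : U ∈ 𝓝 s) :
    ∃ (e : FlatChart S V) (k : Y → V × ℂ) (g : V × ℂ → Y),
      s ∈ e.source ∧ e.source ⊆ U ∧ e.HasRootCoordinates p k g := by
  obtain ⟨φ, ψ, hsφ, hψs, hψt, hφψ, hφS⟩ := hp.branched s hs
  have hφs0 : (φ s).2 = 0 := (hφS s hsφ).1 hs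
  have : Nonempty B := ⟨(φ s).1⟩
  let ρ : V → B := Function.invFun ι
  have hρι : ∀ b, ρ (ι b) = b := Function.leftInverse_invFun hι.injective
  have hιρ : ∀ v ∈ range ι, ι (ρ v) = v := by rintro _ ⟨b, rfl⟩; rw [hρι]
  have hρ : ContinuousOn ρ (range ι) := by
    rw [hι.isInducing.continuousOn_iff]
    exact continuousOn_id.congr hιρ
  -- a box inside the given neighbourhood
  obtain ⟨r, hr, hrU⟩ : ∃ r > 0, ∀ a : B × ℂ, dist (ι a.1) (ι (φ s).1) < r → ‖a.2‖ < r →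
      a ∈ φ.target ∧ φ.symm a ∈ U := by
    have h1 : φ.target ∩ φ.symm ⁻¹' U ∈ 𝓝 (φ s) := by
      refine inter_mem (φ.open_target.mem_nhds (φ.map_source hsφ)) ?_
      refine (φ.continuousAt_symm (φ.map_source hsφ)).preimage_mem_nhds ?_
      rwa [φ.left_inv hsφ]
    have h2 : IsInducing (Prod.map ι (id : ℂ → ℂ)) := hι.isInducing.prodMap .id
    rw [h2.nhds_eq_comap, mem_comap] at h1
    obtain ⟨t, ht, htU⟩ := h1
    obtain ⟨r, hr, hrt⟩ := Metric.mem_nhds_iff.1 ht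
    refine ⟨r, hr, fun a ha1 ha2 => ?_⟩
    have : a ∈ Prod.map ι (id : ℂ → ℂ) ⁻¹' t := by
      refine hrt ?_
      rw [Metric.mem_ball, Prod.dist_eq, max_lt_iff]
      refine ⟨ha1, ?_⟩
      simpa [hφs0] using ha2
    exact htU this
  let O : Set (B × ℂ) := {a | dist (ι a.1) (ι (φ s).1) < r ∧ ‖a.2‖ < r}
  have hO : IsOpen O := by
    have h1 : Continuous fun a : B × ℂ => dist (ι a.1) (ι (φ s).1) :=
      (hι.continuous.comp continuous_fst).dist continuous_const
    exact (isOpen_lt h1 continuous_const).inter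
      (isOpen_lt (continuous_norm.comp continuous_snd) continuous_const)
  have hOt : ∀ a ∈ O, a ∈ φ.target := fun a ha => (hrU a ha.1 ha.2).1
  have htO : ∀ a ∈ (range ι ∩ Metric.ball (ι (φ s).1) r) ×ˢ Metric.ball (0 : ℂ) r,
      (ρ a.1, a.2) ∈ O := by
    rintro a ⟨⟨h1, h2⟩, h3⟩
    refine ⟨?_, by simpa using h3⟩
    simp only [hιρ _ h1]; exact h2
  let e : FlatChart S V :=
    { toFun := fun x => (ι (φ x).1, (φ x).2)
      invFun := fun a => φ.symm (ρ a.1, a.2)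
      source := φ.source ∩ φ ⁻¹' O
      target := (range ι ∩ Metric.ball (ι (φ s).1) r) ×ˢ Metric.ball 0 r
      map_source' := fun x hx => ⟨⟨mem_range_self _, hx.2.1⟩, by simpa using hx.2.2⟩
      map_target' := fun a ha => by
        refine ⟨φ.map_target (hOt _ (htO a ha)), ?_⟩
        rw [mem_preimage, φ.right_inv (hOt _ (htO a ha))]
        exact htO a ha
      left_inv' := fun x hx => by
        simp only [hρι, Prod.mk.eta]
        exact φ.left_inv hx.1
      right_inv' := fun a ha => by
        rw [φ.right_inv (hOt _ (htO a ha))]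
        simp only [hιρ _ ha.1.1]
      base := range ι ∩ Metric.ball (ι (φ s).1) r
      radius := r
      convex_base := hconv.inter (convex_ball _ _)
      radius_pos := hr
      target_eq := rfl
      open_source := φ.isOpen_inter_preimage hO
      continuousOn_toFun := by
        have h1 := φ.continuousOn.mono (inter_subset_left (s := φ.source) (t := φ ⁻¹' O))
        exact (hι.continuous.comp_continuousOn (continuous_fst.comp_continuousOn h1)).prodMk
          (continuous_snd.comp_continuousOn h1)
      continuousOn_invFun := by
        refine φ.continuousOn_symm.comp (t := φ.target) ?_ fun a ha => hOt _ (htO a ha)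
        exact (hρ.comp continuousOn_fst fun a ha => ha.1.1).prodMk continuousOn_snd
      mem_iff := fun x hx => hφS x hx.1 }
  have hsrc : p ⁻¹' e.source ⊆ ψ.source := by
    rw [hψs]; exact preimage_mono inter_subset_left
  have hmapψ : ∀ y ∈ p ⁻¹' e.source, φ (p y) = squareModel B (ψ y) := fun y hy =>
    hφψ y (hsrc hy)
  have hdomO : ∀ a ∈ e.base ×ˢ {w : ℂ | ‖w‖ ^ 2 < e.radius},
      squareModel B (ρ a.1, a.2) ∈ O := by
    rintro a ⟨ha1, ha2⟩
    exact htO (a.1, a.2 ^ 2) ⟨ha1, by simpa using ha2⟩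
  have hdomψ : ∀ a ∈ e.base ×ˢ {w : ℂ | ‖w‖ ^ 2 < e.radius}, (ρ a.1, a.2) ∈ ψ.target := by
    intro a ha
    rw [hψt]; exact hOt _ (hdomO a ha)
  refine ⟨e, fun y => (ι (ψ y).1, (ψ y).2), fun a => ψ.symm (ρ a.1, a.2), ⟨hsφ, ?_⟩, ?_, ?_⟩
  · exact ⟨by simpa using hr, by simpa [hφs0] using hr⟩
  · intro x hx
    have := (hrU _ hx.2.1 hx.2.2).2
    rwa [φ.left_inv hx.1] at this
  · refine ⟨?_, ?_, ?_, ?_, ?_, ?_⟩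
    · have h1 := ψ.continuousOn.mono hsrc
      exact (hι.continuous.comp_continuousOn (continuous_fst.comp_continuousOn h1)).prodMk
        (continuous_snd.comp_continuousOn h1)
    · intro y hy
      show (ι (φ (p y)).1, (φ (p y)).2) = _
      rw [hmapψ y hy]; rfl
    · refine ψ.continuousOn_symm.comp (t := ψ.target) ?_ hdomψ
      exact (hρ.comp continuousOn_fst fun a ha => ha.1.1).prodMk continuousOn_snd
    · intro a ha
      have h1 := ψ.map_target (hdomψ a ha)
      have h2 := hφψ _ h1
      rw [ψ.right_inv (hdomψ a ha)] at h2
      rw [hψs] at h1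
      refine ⟨h1, ?_⟩
      rw [mem_preimage, h2]
      exact hdomO a ha
    · intro y hy
      simp only [hρι, Prod.mk.eta]
      exact ψ.left_inv (hsrc hy)
    · intro a ha
      show (ι (ψ (ψ.symm (ρ a.1, a.2))).1, (ψ (ψ.symm (ρ a.1, a.2))).2) = a
      rw [ψ.right_inv (hdomψ a ha)]
      simp only [hιρ _ ha.1.1]

namespace FlatChart.HasRootCoordinates

variable {S : Set X} {e : FlatChart S V} {p : Y → X} {k : Y → V × ℂ} {g : V × ℂ → Y}

theorem mem_dom (h : e.HasRootCoordinates p k g) {y : Y} (hy : y ∈ p ⁻¹' e.source) :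
    k y ∈ e.base ×ˢ {w : ℂ | ‖w‖ ^ 2 < e.radius} := by
  have h1 := e.map_source hy
  rw [h.map y hy, e.mem_target] at h1
  exact ⟨h1.1, by simpa using h1.2⟩

theorem map_inv (h : e.HasRootCoordinates p k g) {a : V × ℂ}
    (ha : a ∈ e.base ×ˢ {w : ℂ | ‖w‖ ^ 2 < e.radius}) : p (g a) = e.symm (a.1, a.2 ^ 2) := by
  have h1 := h.map _ (h.mapsTo_inv ha)
  rw [h.right_inv a ha] at h1
  rw [← h1]
  exact (e.left_inv (h.mapsTo_inv ha)).symm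

theorem mem_iff (h : e.HasRootCoordinates p k g) {y : Y} (hy : y ∈ p ⁻¹' e.source) :
    p y ∈ S ↔ (k y).2 = 0 := by
  rw [e.mem_iff _ hy]
  show (e.toPartialEquiv (p y)).2 = 0 ↔ _
  rw [h.map y hy]; simp

/-- The punctured domain is the image of a convex set under `(b, ζ) ↦ (b, exp ζ)`. -/
theorem isPreconnected (h : e.HasRootCoordinates p k g) :
    IsPreconnected (p ⁻¹' (e.source \ S)) := by
  have hT : IsPreconnected (e.base ×ˢ {ζ : ℂ | ζ.re < Real.log e.radius / 2}) :=
    (e.convex_base.prod (convex_halfSpace_re_lt _)).isPreconnected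
  have hlt : ∀ ζ : ℂ, ζ.re < Real.log e.radius / 2 ↔ ‖Complex.exp ζ‖ ^ 2 < e.radius := by
    intro ζ
    rw [Complex.norm_exp, ← Real.exp_nat_mul, ← Real.lt_log_iff_exp_lt e.radius_pos]
    push_cast
    constructor <;> intro h <;> linarith
  have hc : ContinuousOn (fun a : V × ℂ => g (a.1, Complex.exp a.2))
      (e.base ×ˢ {ζ : ℂ | ζ.re < Real.log e.radius / 2}) := by
    refine h.continuousOn_inv.comp (by fun_prop) ?_
    rintro a ⟨ha1, ha2⟩
    exact ⟨ha1, (hlt _).1 ha2⟩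
  convert! hT.image _ hc using 1
  ext y
  constructor
  · rintro ⟨hy, hyS⟩
    have h1 := h.mem_dom hy
    have h2 : (k y).2 ≠ 0 := fun h0 => hyS ((h.mem_iff hy).2 h0)
    refine ⟨((k y).1, Complex.log (k y).2), ⟨h1.1, ?_⟩, ?_⟩
    · simp only [mem_ofPred_eq]
      rw [hlt, Complex.exp_log h2]; exact h1.2
    · simp only
      rw [Complex.exp_log h2]
      exact h.left_inv y hy
  · rintro ⟨a, ⟨ha1, ha2⟩, rfl⟩
    have ha : (a.1, Complex.exp a.2) ∈ e.base ×ˢ {w : ℂ | ‖w‖ ^ 2 < e.radius} :=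
      ⟨ha1, (hlt _).1 ha2⟩
    refine ⟨h.mapsTo_inv ha, ?_⟩
    show ¬ p (g (a.1, Complex.exp a.2)) ∈ S
    rw [h.mem_iff (h.mapsTo_inv ha), h.right_inv _ ha]
    exact Complex.exp_ne_zero _

theorem eq_of_map_eq (h : e.HasRootCoordinates p k g) {y y' : Y} (hy : p y ∈ e.source)
    (hS : p y ∈ S) (hyy' : p y' = p y) : y' = y := by
  have hy' : p y' ∈ e.source := by rwa [hyy']
  have hS' : p y' ∈ S := by rwa [hyy']
  rw [← h.left_inv y hy, ← h.left_inv y' hy']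
  have h1 := h.map y hy
  have h2 := h.map y' hy'
  rw [hyy', h1] at h2
  congr 1
  exact Prod.ext (by simpa using (congrArg Prod.fst h2).symm)
    (by rw [(h.mem_iff hy).1 hS, (h.mem_iff hy').1 hS'])

/-- If `w ^ 2` tends to `0`, so does `w`. -/
theorem comap_nhds_le (h : e.HasRootCoordinates p k g) {y : Y} (hy : p y ∈ e.source)
    (hS : p y ∈ S) : comap p (𝓝 (p y)) ≤ 𝓝 y := by
  have hk0 : (k y).2 = 0 := (h.mem_iff hy).1 hS
  have hmem : ∀ᶠ y' in comap p (𝓝 (p y)), y' ∈ p ⁻¹' e.source :=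
    preimage_mem_comap (e.open_source.mem_nhds hy)
  have h1 : Tendsto (fun y' => e.toPartialEquiv (p y')) (comap p (𝓝 (p y)))
      (𝓝 (e.toPartialEquiv (p y))) :=
    (e.continuousOn_toFun.continuousAt (e.open_source.mem_nhds hy)).tendsto.comp tendsto_comap
  rw [h.map y hy] at h1
  have h2 : Tendsto (fun y' => ((k y').1, (k y').2 ^ 2)) (comap p (𝓝 (p y)))
      (𝓝 ((k y).1, (k y).2 ^ 2)) := by
    refine h1.congr' ?_
    filter_upwards [hmem] with y' hy'
    exact h.map y' hy'
  have h3 : Tendsto k (comap p (𝓝 (p y))) (𝓝 (k y)) := by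
    rw [← Prod.mk.eta (p := k y)]
    refine Tendsto.prodMk_nhds (mx := fun y' => (k y').1) (my := fun y' => (k y').2) ?_ ?_
    · exact h2.fst_nhds
    · have h4 := h2.snd_nhds
      rw [hk0] at h4 ⊢
      rw [tendsto_zero_iff_norm_tendsto_zero]
      have h5 := h4.norm.sqrt
      simp only [norm_pow] at h5
      simpa [Real.sqrt_sq (norm_nonneg _)] using h5
  have h4 : Tendsto k (comap p (𝓝 (p y)))
      (𝓝[e.base ×ˢ {w : ℂ | ‖w‖ ^ 2 < e.radius}] (k y)) := by
    refine tendsto_nhdsWithin_iff.2 ⟨h3, ?_⟩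
    filter_upwards [hmem] with y' hy'
    exact h.mem_dom hy'
  have h5 : Tendsto (g ∘ k) (comap p (𝓝 (p y))) (𝓝 (g (k y))) :=
    (h.continuousOn_inv _ (h.mem_dom hy)).tendsto.comp h4
  rw [h.left_inv y hy] at h5
  refine (tendsto_id'.1 (h5.congr' ?_))
  filter_upwards [hmem] with y' hy'
  exact h.left_inv y' hy'

end FlatChart.HasRootCoordinates

theorem FlatChart.neBot_nhdsWithin {S : Set X} (e : FlatChart S V) {s : X} (hs : s ∈ e.source) :
    (𝓝[Sᶜ] s).NeBot := by
  have hes := e.map_source hs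
  rw [← Prod.mk.eta (p := e.toPartialEquiv s), e.mem_target] at hes
  have h1 : Tendsto (fun z : ℂ => ((e.toPartialEquiv s).1, z)) (𝓝[≠] (e.toPartialEquiv s).2)
      (𝓝[e.target] (e.toPartialEquiv s)) := by
    refine tendsto_nhdsWithin_iff.2 ⟨?_, ?_⟩
    · have : Tendsto (fun z : ℂ => ((e.toPartialEquiv s).1, z)) (𝓝 (e.toPartialEquiv s).2)
          (𝓝 ((e.toPartialEquiv s).1, (e.toPartialEquiv s).2)) :=
        (Continuous.prodMk_right _).tendsto _
      exact this.mono_left nhdsWithin_le_nhds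
    · have : ∀ᶠ z : ℂ in 𝓝 (e.toPartialEquiv s).2, ‖z‖ < e.radius :=
        continuous_norm.continuousAt.eventually_lt continuousAt_const hes.2
      filter_upwards [nhdsWithin_le_nhds this] with z hz
      exact e.mem_target.2 ⟨hes.1, hz⟩
  by_cases hsS : s ∈ S
  · have hz0 : (e.toPartialEquiv s).2 = 0 := (e.mem_iff s hs).1 hsS
    have h2 := (e.continuousOn_invFun _ (e.map_source hs)).tendsto.comp h1
    have h3 : e.toPartialEquiv.invFun (e.toPartialEquiv s) = s := e.left_inv hs
    rw [h3] at h2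
    have h4 : Tendsto (fun z : ℂ => e.symm ((e.toPartialEquiv s).1, z))
        (𝓝[≠] (e.toPartialEquiv s).2) (𝓝[Sᶜ] s) := by
      refine tendsto_nhdsWithin_iff.2 ⟨h2, ?_⟩
      filter_upwards [self_mem_nhdsWithin, (tendsto_nhdsWithin_iff.1 h1).2] with z hz hz'
      rw [mem_compl_iff, e.symm_mem_iff hz']
      rw [hz0] at hz
      exact hz
    exact h4.neBot
  · exact mem_closure_iff_nhdsWithin_neBot.1 (subset_closure hsS)

theorem IsDoubleBranchedCover.isTameDoubleCover {B : Type*} [TopologicalSpace B] {p : Y → X}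
    {S : Set X} (hp : IsDoubleBranchedCover B p S) (hS : IsClosed S) {ι : B → V}
    (hι : IsEmbedding ι) (hconv : Convex ℝ (range ι)) : IsTameDoubleCover p S where
  continuous := hp.continuous
  isClosed := hS
  covering := hp.covering
  two_sheeted := hp.two_sheeted
  surj s hs := by
    obtain ⟨e, k, g, hse, -, h⟩ := hp.exists_flatChart hι hconv hs univ_mem
    have hes := e.map_source hse
    have hz : (e.toPartialEquiv s).2 = 0 := (e.mem_iff s hse).1 hs
    rw [← Prod.mk.eta (p := e.toPartialEquiv s), e.mem_target] at hes
    refine ⟨g ((e.toPartialEquiv s).1, 0), ?_⟩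
    rw [h.map_inv (a := ((e.toPartialEquiv s).1, 0)) ⟨hes.1, by simpa using e.radius_pos⟩]
    simp only [ne_eq, OfNat.ofNat_ne_zero, not_false_eq_true, zero_pow]
    rw [← hz, Prod.mk.eta]
    exact e.left_inv hse
  eq_of_mem y y' hy hyy' := by
    obtain ⟨e, k, g, hse, -, h⟩ := hp.exists_flatChart hι hconv hy univ_mem
    exact h.eq_of_map_eq hse hy hyy'
  nhds_le y hy := by
    obtain ⟨e, k, g, hse, -, h⟩ := hp.exists_flatChart hι hconv hy univ_mem
    exact h.comap_nhds_le hse hy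
  neBot s hs := by
    obtain ⟨e, k, g, hse, -, h⟩ := hp.exists_flatChart hι hconv hs univ_mem
    exact e.neBot_nhdsWithin hse
  connected s hs U hU := by
    obtain ⟨e, k, g, hse, heU, h⟩ := hp.exists_flatChart hι hconv hs hU
    exact ⟨e.source, e.open_source.mem_nhds hse, heU, h.isPreconnected⟩

/-- In particular `σ ∘ p` is such a double cover, if `σ` is an involution of the pair; a lift of `σ`
is an isomorphism from `p` to `σ ∘ p`. -/
theorem IsTameDoubleCover.homeomorph_comp {p : Y → X} {S : Set X} (hp : IsTameDoubleCover p S)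
    (h : X ≃ₜ X) (hS : ∀ x, h x ∈ S ↔ x ∈ S) : IsTameDoubleCover (h ∘ p) S := by
  have hpre : h ⁻¹' S = S := by ext x; exact hS x
  have hpre' : ∀ x, h.symm x ∈ S ↔ x ∈ S := fun x => by rw [← hS, h.apply_symm_apply]
  refine ⟨h.continuous.comp hp.continuous, hp.isClosed, ?_, ?_, ?_, ?_, ?_, ?_, ?_⟩
  · have := hp.covering.homeomorph_comp h
    convert this using 1
    ext x; simp [hpre']
  · intro x hx
    rw [← hp.two_sheeted (h.symm x) (by rwa [mem_compl_iff, hpre'])]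
    congr 1; ext y
    simp [h.eq_symm_apply]
  · intro x hx
    obtain ⟨y, hy⟩ := hp.surj (h.symm x) ((hpre' x).2 hx)
    exact ⟨y, by simp [hy]⟩
  · intro y y' hy hyy'
    exact hp.eq_of_mem y y' ((hS _).1 hy) (h.injective hyy')
  · intro y hy
    refine le_trans (le_of_eq ?_) (hp.nhds_le y ((hS _).1 hy))
    rw [← comap_comap, Function.comp_apply, ← h.nhds_eq_comap]
  · intro s hs
    exact hp.neBot s hs
  · intro s hs U hU
    obtain ⟨W, hW, hWU, hWc⟩ := hp.connected (h.symm s) ((hpre' s).2 hs) (h ⁻¹' U)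
      (h.continuous.continuousAt.preimage_mem_nhds (by simpa using hU))
    refine ⟨h.symm ⁻¹' W, h.symm.continuous.continuousAt.preimage_mem_nhds hW, ?_, ?_⟩
    · intro x hx
      simpa using hWU hx
    · convert hWc using 1
      ext y; simp [hS]

end BranchedCharts

/-! ### Connectedness of the complement of the branch set -/

section Preconnected

variable {X Y A : Type*} [TopologicalSpace X] [TopologicalSpace Y] [TopologicalSpace A]

theorem _root_.IsPreconnected.bool_const {W : Set X} (hW : IsPreconnected W) {c : X → Bool}
    (hc : ∀ x ∈ W, ∀ᶠ x' in 𝓝 x, c x' = c x) {x y : X} (hx : x ∈ W) (hy : y ∈ W) : c x = c y := by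
  refine hW.constant (f := c) ?_ hx hy
  intro x hx
  refine ContinuousAt.continuousWithinAt ?_
  exact (continuousAt_const (y := c x)).congr ((hc x hx).mono fun _ h => h.symm)

theorem continuousAt_bool {f : X → Bool} {x : X} (h : ContinuousAt f x) :
    ∀ᶠ x' in 𝓝 x, f x' = f x :=
  h.eventually (IsOpen.mem_nhds (isOpen_discrete {b | b = f x}) rfl)

namespace IsTameDoubleCover

variable {p : Y → X} {S : Set X} (hp : IsTameDoubleCover p S)
include hp

theorem neBot_nhdsWithin (x : X) : (𝓝[Sᶜ] x).NeBot := by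
  by_cases hx : x ∈ S
  · exact hp.neBot x hx
  · exact mem_closure_iff_nhdsWithin_neBot.1 (subset_closure hx)

/-- The branch set does not separate: a locally constant function on `W \ S` has a limit at each
point of `S`, as small punctured neighbourhoods are connected. -/
theorem isPreconnected_diff {W : Set X} (hW : IsPreconnected W) (hWo : IsOpen W) :
    IsPreconnected (W \ S) := by
  refine isPreconnected_of_forall_constant fun f hf x hx y hy => ?_
  have hWS : IsOpen (W \ S) := hWo.sdiff hp.isClosed
  -- the limit `v` of `f` exists at each point, and `c` extends `f` by it
  have hloc : ∀ x ∈ W, ∃ v, ∀ᶠ x' in 𝓝[Sᶜ] x, f x' = v := by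
    intro x hx
    by_cases hxS : x ∈ S
    · obtain ⟨V, hV, hVW, hVc⟩ := hp.connected x hxS W (hWo.mem_nhds hx)
      have h1 : IsPreconnected (V \ S) := by
        have := hVc.image p hp.continuous.continuousOn
        rwa [image_preimage_eq _ hp.surjective] at this
      by_cases hne : (V \ S).Nonempty
      · obtain ⟨z, hz⟩ := hne
        refine ⟨f z, ?_⟩
        filter_upwards [mem_nhdsWithin_of_mem_nhds hV, self_mem_nhdsWithin] with x' h2 h3
        exact h1.constant (hf.mono (sdiff_subset_sdiff_left hVW)) ⟨h2, h3⟩ hz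
      · refine ⟨true, ?_⟩
        filter_upwards [mem_nhdsWithin_of_mem_nhds hV, self_mem_nhdsWithin] with x' h2 h3
        exact absurd ⟨x', h2, h3⟩ hne
    · exact ⟨f x, nhdsWithin_le_nhds
        (continuousAt_bool (hf.continuousAt (hWS.mem_nhds ⟨hx, hxS⟩)))⟩
  classical
  let c : X → Bool := fun x => decide (∀ᶠ x' in 𝓝[Sᶜ] x, f x' = true)
  have hcv : ∀ x v, (∀ᶠ x' in 𝓝[Sᶜ] x, f x' = v) → c x = v := by
    intro x v h
    cases v
    · have := hp.neBot_nhdsWithin x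
      simp only [c, decide_eq_false_iff_not]
      intro h'
      obtain ⟨z, h1, h2⟩ := (h.and h').exists
      simp [h1] at h2
    · simpa [c] using h
  have hc : ∀ x ∈ W, ∀ᶠ x' in 𝓝 x, c x' = c x := by
    intro x hx
    obtain ⟨v, hv⟩ := hloc x hx
    rw [hcv x v hv]
    filter_upwards [eventually_nhds_nhdsWithin.2 hv] with x' h
    exact hcv x' v h
  have hcf : ∀ x ∈ W \ S, c x = f x := fun x hx => hcv x _
    (nhdsWithin_le_nhds (continuousAt_bool (hf.continuousAt (hWS.mem_nhds hx))))
  rw [← hcf x hx, ← hcf y hy]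
  exact hW.bool_const hc hx.1 hy.1

/-- A single branch point in `W` connects the two sheets over the whole of `W \ S`. -/
theorem isPreconnected_preimage_diff {W : Set X} (hW : IsPreconnected W) (hWo : IsOpen W)
    (hWS : (W ∩ S).Nonempty) : IsPreconnected (p ⁻¹' (W \ S)) := by
  have hc := hp.isPreconnected_diff hW hWo
  have hWSo : IsOpen (W \ S) := hWo.sdiff hp.isClosed
  have hWSp : IsOpen (p ⁻¹' (W \ S)) := hWSo.preimage hp.continuous
  refine isPreconnected_of_forall_constant fun f hf => ?_
  have hfa : ∀ y, p y ∈ W \ S → ContinuousAt f y := fun y hy => hf.continuousAt (hWSp.mem_nhds hy)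
  -- the two values of `f` on a fibre agree near the branch set, hence everywhere
  classical
  let D : X → Bool := fun x => decide (∀ y, p y = x → f y = f (sheetSwap p y))
  have hDs : ∀ y, D (p y) = decide (f y = f (sheetSwap p y)) := by
    intro y
    simp only [D, decide_eq_decide]
    refine ⟨fun h => h y rfl, fun h y' hy' => ?_⟩
    rcases hp.eq_or_eq_sheetSwap hy' with rfl | rfl
    · exact h
    · rw [hp.sheetSwap_sheetSwap]; exact h.symm
  have hDloc : ∀ x ∈ W \ S, ∀ᶠ x' in 𝓝 x, D x' = D x := by
    intro x hx
    obtain ⟨U, hU, hxU, hUS, s, s', hs, hs', hps, hss', -, -⟩ := hp.exists_sections hx.2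
    have h1 : ContinuousAt (fun u => f (s u)) x :=
      ContinuousAt.comp (hfa _ (by rwa [hps x hxU])) (hs.continuousAt (hU.mem_nhds hxU))
    have h2 : ContinuousAt (fun u => f (s' u)) x := by
      refine ContinuousAt.comp (hfa _ ?_) (hs'.continuousAt (hU.mem_nhds hxU))
      rw [hss' x hxU, map_sheetSwap p, hps x hxU]; exact hx
    filter_upwards [hU.mem_nhds hxU, continuousAt_bool h1, continuousAt_bool h2] with u hu h3 h4
    rw [← hps u hu, hDs, ← hss' u hu, h3, h4, hss' x hxU, ← hDs, hps x hxU]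
  have hDtrue : ∀ x ∈ W \ S, D x = true := by
    obtain ⟨s₀, hs₀W, hs₀S⟩ := hWS
    obtain ⟨V, hV, hVW, hVc⟩ := hp.connected s₀ hs₀S W (hWo.mem_nhds hs₀W)
    have := hp.neBot s₀ hs₀S
    obtain ⟨z, hzV, hzS⟩ : (V ∩ Sᶜ).Nonempty := Filter.nonempty_of_mem
      (inter_mem (mem_nhdsWithin_of_mem_nhds hV) self_mem_nhdsWithin : _ ∈ 𝓝[Sᶜ] s₀)
    intro x hx
    rw [hc.bool_const hDloc hx ⟨hVW hzV, hzS⟩]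
    obtain ⟨y, rfl⟩ := hp.surjective z
    rw [hDs, decide_eq_true_eq]
    refine hVc.constant (hf.mono (preimage_mono (sdiff_subset_sdiff_left hVW))) ⟨hzV, hzS⟩ ?_
    rw [mem_preimage, map_sheetSwap p]; exact ⟨hzV, hzS⟩
  have hfib : ∀ y y', p y ∈ W \ S → p y' = p y → f y' = f y := by
    intro y y' hy hyy'
    have h1 := hDtrue _ hy
    rw [hDs, decide_eq_true_eq] at h1
    rcases hp.eq_or_eq_sheetSwap hyy' with rfl | rfl
    · rfl
    · exact h1.symm
  let r : X → Y := Function.surjInv hp.surjective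
  have hr : ∀ x, p (r x) = x := Function.surjInv_eq hp.surjective
  have hcloc : ∀ x ∈ W \ S, ∀ᶠ x' in 𝓝 x, f (r x') = f (r x) := by
    intro x hx
    obtain ⟨U, hU, hxU, hUS, s, s', hs, hs', hps, hss', -, -⟩ := hp.exists_sections hx.2
    have h1 : ContinuousAt (fun u => f (s u)) x :=
      ContinuousAt.comp (hfa _ (by rwa [hps x hxU])) (hs.continuousAt (hU.mem_nhds hxU))
    filter_upwards [hU.mem_nhds hxU, hWSo.mem_nhds hx, continuousAt_bool h1] with u hu hu' h3
    rw [hfib (s u) (r u) (by rwa [hps u hu]) (by rw [hr, hps u hu]), h3,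
      hfib (s x) (r x) (by rwa [hps x hxU]) (by rw [hr, hps x hxU])]
  intro y hy y' hy'
  rw [← hfib y (r (p y)) hy (hr _), ← hfib y' (r (p y')) hy' (hr _)]
  exact hc.bool_const (c := fun x => f (r x)) hcloc hy hy'

/-- Two lifts of one map that agree at a point off the branch set agree near this point. -/
theorem eventually_eq_of_eq {g h : A → Y} {a : A} (hg : ContinuousAt g a)
    (hgh : ∀ᶠ a' in 𝓝 a, p (g a') = p (h a')) (hh : ContinuousAt h a) (ha : g a = h a)
    (haS : p (g a) ∉ S) : ∀ᶠ a' in 𝓝 a, g a' = h a' := by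
  obtain ⟨U, hU, hxU, hUS, s, s', hs, hs', hps, hss', ho, ho'⟩ := hp.exists_sections haS
  rcases hp.eq_or_eq_sheetSwap (y' := g a) (hps _ hxU).symm with h1 | h1
  · have h2 := ho.mem_nhds (show g a ∈ {y | p y ∈ U ∧ y = s (p y)} from ⟨hxU, h1⟩)
    filter_upwards [hgh, hg h2, hh (ha ▸ h2)] with a' h3 h4 h5
    rw [h4.2, h5.2, h3]
  · rw [← hss' _ hxU] at h1
    have h2 := ho'.mem_nhds (show g a ∈ {y | p y ∈ U ∧ y = s' (p y)} from ⟨hxU, h1⟩)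
    filter_upwards [hgh, hg h2, hh (ha ▸ h2)] with a' h3 h4 h5
    rw [h4.2, h5.2, h3]

end IsTameDoubleCover

end Preconnected

/-! ### Isomorphisms of branched double covers -/

section SheetIsos

section AgreeNear

variable {X Y₁ Y₂ : Type*} [TopologicalSpace X] {p₁ : Y₁ → X} {S : Set X} {g h : Y₁ → Y₂}

/-- Two maps on the total space of `p₁` agree over the points off `S` that are close to `x`. -/
def AgreeNear (p₁ : Y₁ → X) (S : Set X) (g h : Y₁ → Y₂) (x : X) : Prop :=
  ∀ᶠ x' in 𝓝[Sᶜ] x, ∀ y, p₁ y = x' → g y = h y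

theorem AgreeNear.eventually {x : X} (hgh : AgreeNear p₁ S g h x) :
    ∀ᶠ x' in 𝓝 x, AgreeNear p₁ S g h x' :=
  eventually_nhds_nhdsWithin.2 hgh

theorem AgreeNear.eq {y : Y₁} (hgh : AgreeNear p₁ S g h (p₁ y)) (hy : p₁ y ∉ S) : g y = h y :=
  hgh.self_of_nhdsWithin hy y rfl

theorem AgreeNear.trans {k : Y₁ → Y₂} {x : X} (h₁ : AgreeNear p₁ S g h x)
    (h₂ : AgreeNear p₁ S h k x) : AgreeNear p₁ S g k x := by
  filter_upwards [h₁, h₂] with x' h3 h4 y hy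
  rw [h3 y hy, h4 y hy]

theorem AgreeNear.symm {x : X} (h₁ : AgreeNear p₁ S g h x) : AgreeNear p₁ S h g x := by
  filter_upwards [h₁] with x' h3 y hy
  rw [h3 y hy]

theorem AgreeNear.comp {Z : Type*} (k : Y₂ → Z) {x : X} (h₁ : AgreeNear p₁ S g h x) :
    AgreeNear p₁ S (k ∘ g) (k ∘ h) x := by
  filter_upwards [h₁] with x' h3 y hy
  rw [Function.comp_apply, h3 y hy, Function.comp_apply]

end AgreeNear

variable {X Y₁ Y₂ V : Type*} [TopologicalSpace X] [TopologicalSpace Y₁]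
  [TopologicalSpace Y₂] [NormedAddCommGroup V] [NormedSpace ℝ V]

/-- `g` restricts to an isomorphism from `p₁` to `p₂` over `U`. Bijectivity is encoded by
commutation with the sheet swaps; the values of `g` outside `p₁ ⁻¹' U` are irrelevant. -/
structure IsSheetIso (p₁ : Y₁ → X) (p₂ : Y₂ → X) (U : Set X) (g : Y₁ → Y₂) : Prop where
  continuousOn : ContinuousOn g (p₁ ⁻¹' U)
  map : ∀ y ∈ p₁ ⁻¹' U, p₂ (g y) = p₁ y
  swap : ∀ y ∈ p₁ ⁻¹' U, g (sheetSwap p₁ y) = sheetSwap p₂ (g y)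

variable {p₁ : Y₁ → X} {p₂ : Y₂ → X} {S U U' : Set X} {g h : Y₁ → Y₂}

theorem IsSheetIso.mono {X Y₁ Y₂ : Type*} [TopologicalSpace Y₁] [TopologicalSpace Y₂]
    {p₁ : Y₁ → X} {p₂ : Y₂ → X} {U U' : Set X} {g : Y₁ → Y₂} (hg : IsSheetIso p₁ p₂ U g)
    (hU : U' ⊆ U) : IsSheetIso p₁ p₂ U' g :=
  ⟨hg.continuousOn.mono (preimage_mono hU), fun y hy => hg.map y (hU hy),
    fun y hy => hg.swap y (hU hy)⟩

theorem IsSheetIso.swap_comp (hp₂ : IsTameDoubleCover p₂ S) (hg : IsSheetIso p₁ p₂ U g) :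
    IsSheetIso p₁ p₂ U (sheetSwap p₂ ∘ g) :=
  ⟨hp₂.continuous_sheetSwap.comp_continuousOn hg.continuousOn,
    fun y hy => by rw [Function.comp_apply, map_sheetSwap p₂, hg.map y hy],
    fun y hy => by rw [Function.comp_apply, hg.swap y hy]; rfl⟩

/-- Off the branch set, match the two local sections of `p₁` with those of `p₂`. -/
theorem exists_sheetIso_of_notMem (hp₁ : IsTameDoubleCover p₁ S) (hp₂ : IsTameDoubleCover p₂ S)
    {x : X} (hx : x ∉ S) : ∃ U g, IsOpen U ∧ x ∈ U ∧ IsSheetIso p₁ p₂ U g := by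
  obtain ⟨U, hU, hxU, hUS, s, s', hs, hs', hps, hss', ho, ho'⟩ := hp₁.exists_sections hx
  obtain ⟨W, hW, hxW, hWS, t, t', ht, ht', hpt, htt', -, -⟩ := hp₂.exists_sections hx
  classical
  have hcase : ∀ y, p₁ y ∈ U → y = s (p₁ y) ∨ y = s' (p₁ y) := by
    intro y hy
    rw [hss' _ hy]
    exact hp₁.eq_or_eq_sheetSwap (hps _ hy).symm
  have hne : ∀ u ∈ U, s' u ≠ s u := by
    intro u hu
    rw [hss' u hu]
    exact hp₁.sheetSwap_ne (by rw [hps u hu]; exact hUS hu)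
  refine ⟨U ∩ W, fun y => if y = s (p₁ y) then t (p₁ y) else t' (p₁ y), hU.inter hW,
    ⟨hxU, hxW⟩, ?_, ?_, ?_⟩
  · intro y hy
    refine ContinuousAt.continuousWithinAt ?_
    rcases hcase y hy.1 with h | h
    · refine ContinuousAt.congr (f := t ∘ p₁) ?_ ?_
      · exact ContinuousAt.comp (ht.continuousAt (hW.mem_nhds hy.2)) hp₁.continuous.continuousAt
      · filter_upwards [ho.mem_nhds ⟨hy.1, h⟩] with y' hy'
        rw [if_pos hy'.2]; rfl
    · refine ContinuousAt.congr (f := t' ∘ p₁) ?_ ?_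
      · exact ContinuousAt.comp (ht'.continuousAt (hW.mem_nhds hy.2)) hp₁.continuous.continuousAt
      · filter_upwards [ho'.mem_nhds ⟨hy.1, h⟩] with y' hy'
        rw [if_neg]
        · rfl
        · rw [hy'.2, ← hy'.2]
          intro h'
          exact hne _ hy'.1 (hy'.2.symm.trans h')
  · intro y hy
    split_ifs
    · exact hpt _ hy.2
    · rw [htt' _ hy.2, map_sheetSwap p₂, hpt _ hy.2]
  · intro y hy
    simp only [map_sheetSwap p₁]
    rcases hcase y hy.1 with h | h
    · rw [if_pos h, if_neg, htt' _ hy.2]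
      rw [← h]
      exact hp₁.sheetSwap_ne (hUS hy.1)
    · have h1 : sheetSwap p₁ y = s (p₁ y) := by
        rw [hss' _ hy.1] at h
        conv_lhs => rw [h]
        exact hp₁.sheetSwap_sheetSwap _
      have h2 : y ≠ s (p₁ y) := by
        intro h'
        exact hne _ hy.1 (h.symm.trans h')
      rw [if_pos h1, if_neg h2, htt' _ hy.2, hp₂.sheetSwap_sheetSwap]

/-- At a branch point, square-root coordinates of `p₁` followed by a square-root parametrization of
`p₂` give an isomorphism off `S`, which extends over `S` by the only possible values. The
coordinates are needed for `p₁` only. -/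
theorem exists_sheetIso_of_mem {B : Type*} [TopologicalSpace B]
    (hp : IsDoubleBranchedCover B p₁ S) (hp₁ : IsTameDoubleCover p₁ S)
    (hp₂ : IsTameDoubleCover p₂ S) {ι : B → V} (hι : IsEmbedding ι) (hconv : Convex ℝ (range ι))
    {x : X} (hx : x ∈ S) : ∃ U g, IsOpen U ∧ x ∈ U ∧ IsSheetIso p₁ p₂ U g := by
  obtain ⟨e, k, g₀, hxe, -, h⟩ := hp.exists_flatChart hι hconv hx univ_mem
  have hb : e.base.Nonempty := by
    have h1 := e.map_source hxe
    rw [← Prod.mk.eta (p := e.toPartialEquiv x), e.mem_target] at h1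
    exact ⟨_, h1.1⟩
  obtain ⟨G, hG⟩ := e.exists_rootParametrization hp₂ hb
  classical
  let r : X → Y₂ := Function.surjInv hp₂.surjective
  have hr : ∀ x, p₂ (r x) = x := Function.surjInv_eq hp₂.surjective
  let f : Y₁ → Y₂ := fun y => if p₁ y ∈ S then r (p₁ y) else G (k y)
  have hkdom : ∀ y, p₁ y ∈ e.source → p₁ y ∉ S → k y ∈ e.rootDomain := by
    intro y hy hyS
    have h1 := h.mem_dom hy
    exact ⟨h1.1, fun h0 => hyS ((h.mem_iff hy).2 h0), h1.2⟩
  have hf : ∀ y, p₁ y ∈ e.source → p₂ (f y) = p₁ y := by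
    intro y hy
    by_cases hyS : p₁ y ∈ S
    · simp only [f, if_pos hyS, hr]
    · simp only [f, if_neg hyS]
      rw [hG.map _ (hkdom y hy hyS), ← h.map y hy]
      exact e.left_inv hy
  refine ⟨e.source, f, e.open_source, hxe, ?_, hf, ?_⟩
  · intro y hy
    refine ContinuousAt.continuousWithinAt ?_
    have hnhds : p₁ ⁻¹' e.source ∈ 𝓝 y :=
      (e.open_source.preimage hp₁.continuous).mem_nhds hy
    by_cases hyS : p₁ y ∈ S
    · refine hp₂.continuousAt_of_mem (by rwa [hf y hy]) ?_
      refine hp₁.continuous.continuousAt.congr ?_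
      filter_upwards [hnhds] with y' hy'
      exact (hf y' hy').symm
    · have hS' : p₁ ⁻¹' Sᶜ ∈ 𝓝 y :=
        (hp₁.isClosed.isOpen_compl.preimage hp₁.continuous).mem_nhds hyS
      have h1 : ContinuousOn (G ∘ k) (p₁ ⁻¹' e.source ∩ p₁ ⁻¹' Sᶜ) :=
        hG.continuousOn.comp (h.continuousOn.mono inter_subset_left)
          fun y hy => hkdom y hy.1 hy.2
      refine (h1.continuousAt (inter_mem hnhds hS')).congr ?_
      filter_upwards [hS'] with y' hy'
      exact (if_neg hy').symm
  · intro y hy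
    have hy' : sheetSwap p₁ y ∈ p₁ ⁻¹' e.source := by rw [mem_preimage, map_sheetSwap p₁]; exact hy
    by_cases hyS : p₁ y ∈ S
    · rw [hp₁.sheetSwap_of_mem hyS, hp₂.sheetSwap_of_mem (by rwa [hf y hy])]
    · simp only [f, map_sheetSwap p₁, if_neg hyS]
      rw [← hG.neg _ (hkdom y hy hyS)]
      congr 1
      have h1 := h.map _ hy'
      rw [map_sheetSwap p₁, h.map y hy, Prod.mk.injEq] at h1
      refine Prod.ext h1.1.symm ?_
      rcases sq_eq_sq_iff_eq_or_eq_neg.1 h1.2 with h2 | h2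
      · refine absurd ?_ (hp₁.sheetSwap_ne hyS)
        have h3 : k (sheetSwap p₁ y) = k y := Prod.ext h1.1.symm h2.symm
        have h4 := congrArg g₀ h3
        rwa [h.left_inv _ hy', h.left_inv y hy] at h4
      · rw [h2, neg_neg]

/-- The two germs of isomorphisms at a point are distinct, as the complement of `S` is dense. -/
theorem AgreeNear.not_swap (hp₁ : IsTameDoubleCover p₁ S) (hp₂ : IsTameDoubleCover p₂ S)
    (hU : IsOpen U) (hh : IsSheetIso p₁ p₂ U h) {x : X} (hx : x ∈ U)
    (hgh : AgreeNear p₁ S g h x) : ¬ AgreeNear p₁ S g (sheetSwap p₂ ∘ h) x := by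
  intro hgh'
  have := hp₁.neBot_nhdsWithin x
  obtain ⟨x', h1, h2, h3, h4⟩ := (hgh.and (hgh'.and ((eventually_mem_nhdsWithin).and
    (mem_nhdsWithin_of_mem_nhds (hU.mem_nhds hx))))).exists
  obtain ⟨y, rfl⟩ := hp₁.surjective x'
  refine hp₂.sheetSwap_ne (y := h y) (by rw [hh.map y h4]; exact h3) ?_
  exact (h2 y rfl).symm.trans (h1 y rfl)

/-- At each point, two isomorphisms have the same germ, or germs that differ by the sheet swap. -/
theorem IsSheetIso.agreeNear_or (hp₁ : IsTameDoubleCover p₁ S) (hp₂ : IsTameDoubleCover p₂ S)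
    (hU : IsOpen U) (hU' : IsOpen U') (hg : IsSheetIso p₁ p₂ U g) (hh : IsSheetIso p₁ p₂ U' h)
    {x : X} (hx : x ∈ U ∩ U') :
    AgreeNear p₁ S g h x ∨ AgreeNear p₁ S g (sheetSwap p₂ ∘ h) x := by
  have hO : IsOpen (U ∩ U') := hU.inter hU'
  by_cases hxS : x ∈ S
  · obtain ⟨W, hW, hWU, hWc⟩ := hp₁.connected x hxS (U ∩ U') (hO.mem_nhds hx)
    have hev : ∀ k : Y₁ → Y₂, EqOn g k (p₁ ⁻¹' (W \ S)) → AgreeNear p₁ S g k x := by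
      intro k hk
      filter_upwards [mem_nhdsWithin_of_mem_nhds hW, self_mem_nhdsWithin] with x' h1 h2 y hy
      exact hk (show p₁ y ∈ W \ S from hy ▸ ⟨h1, h2⟩)
    refine (hp₂.eqOn_or_eqOn_sheetSwap hWc (g := g) (h := h)
      (hg.continuousOn.mono fun y hy => (hWU hy.1).1)
      (hh.continuousOn.mono fun y hy => (hWU hy.1).2) (fun y hy => ?_) (fun y hy => ?_)).imp
      (hev _) (hev _)
    · rw [hg.map y (hWU hy.1).1, hh.map y (hWU hy.1).2]
    · rw [hh.map y (hWU hy.1).2]; exact hy.2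
  · obtain ⟨W, hW, hxW, hWS, s, s', hs, hs', hps, hss', ho, ho'⟩ := hp₁.exists_sections hxS
    have key : ∀ k : Y₁ → Y₂, IsSheetIso p₁ p₂ U' k → g (s x) = k (s x) →
        AgreeNear p₁ S g k x := by
      intro k hk hgk
      have hsx : ContinuousAt s x := hs.continuousAt (hW.mem_nhds hxW)
      have hsU : p₁ (s x) ∈ U ∩ U' := by rwa [hps x hxW]
      have h1 := hp₂.eventually_eq_of_eq (g := g ∘ s) (h := k ∘ s) (a := x)
        (ContinuousAt.comp (hg.continuousOn.continuousAt
          ((hU.preimage hp₁.continuous).mem_nhds hsU.1)) hsx)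
        (by
          filter_upwards [hO.mem_nhds hx, hW.mem_nhds hxW] with u hu huW
          have : p₁ (s u) ∈ U ∩ U' := by rwa [hps u huW]
          rw [Function.comp_apply, Function.comp_apply, hg.map _ this.1, hk.map _ this.2])
        (ContinuousAt.comp (hk.continuousOn.continuousAt
          ((hU'.preimage hp₁.continuous).mem_nhds hsU.2)) hsx) hgk
        (by rw [Function.comp_apply, hg.map _ hsU.1, hps x hxW]; exact hxS)
      refine mem_nhdsWithin_of_mem_nhds ?_
      filter_upwards [h1, hO.mem_nhds hx, hW.mem_nhds hxW] with u hu huO huW y hy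
      subst hy
      have hsu : p₁ (s (p₁ y)) ∈ U ∩ U' := by rwa [hps _ huW]
      rcases hp₁.eq_or_eq_sheetSwap (y' := y) (hps _ huW).symm with h2 | h2
      · rw [h2]; exact hu
      · rw [h2, hg.swap _ hsu.1, hk.swap _ hsu.2]
        exact congrArg _ hu
    have hsU : p₁ (s x) ∈ U ∩ U' := by rwa [hps x hxW]
    rcases hp₂.eq_or_eq_sheetSwap (y := h (s x)) (y' := g (s x))
      (by rw [hg.map _ hsU.1, hh.map _ hsU.2]) with h1 | h1
    · exact Or.inl (key h hh h1)
    · exact Or.inr (key _ (hh.swap_comp hp₂) h1)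

theorem eq_over_branchSet (hp₂ : IsTameDoubleCover p₂ S) (hg : IsSheetIso p₁ p₂ U g)
    (hh : IsSheetIso p₁ p₂ U' h) {y : Y₁} (hy : p₁ y ∈ U ∩ U') (hyS : p₁ y ∈ S) : g y = h y :=
  hp₂.eq_of_mem _ _ (by rwa [hh.map y hy.2]) (by rw [hg.map y hy.1, hh.map y hy.2])

end SheetIsos

/-! ### Gluing local isomorphisms -/

section Gluing

variable {X Y₁ Y₂ : Type*} [TopologicalSpace X] [TopologicalSpace Y₁] [TopologicalSpace Y₂]
  {p₁ : Y₁ → X} {p₂ : Y₂ → X} {S U U₁ U₂ : Set X} {g g₁ g₂ : Y₁ → Y₂}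

open Classical in
/-- The double cover of `T` whose two points over `x` are the two germs at `j x` of isomorphisms
from `p₁` to `p₂`, given by the gluing functions of a family `g` of local isomorphisms. In the
trivialization with index `t`, `true` stands for the germ of `g t`, and `false` for that of
`sheetSwap p₂ ∘ g t`. -/
noncomputable def germBundle {T : Type*} [TopologicalSpace T] (j : T → X) (hj : Continuous j)
    (hp₁ : IsTameDoubleCover p₁ S) (hp₂ : IsTameDoubleCover p₂ S) (W : T → Set X)
    (g : T → Y₁ → Y₂) (hW : ∀ t, IsOpen (W t)) (hmem : ∀ t, j t ∈ W t)
    (hg : ∀ t, IsSheetIso p₁ p₂ (W t) (g t)) : FiberBundleCore T T Bool where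
  baseSet t := j ⁻¹' W t
  isOpen_baseSet t := (hW t).preimage hj
  indexAt t := t
  mem_baseSet_at t := hmem t
  coordChange s t x v := if AgreeNear p₁ S (g s) (g t) (j x) then v else !v
  coordChange_self t x _ v := by
    have : AgreeNear p₁ S (g t) (g t) (j x) := Eventually.of_forall fun _ _ _ => rfl
    rw [if_pos this]
  continuousOn_coordChange s t := by
    rintro ⟨x, v⟩ ⟨hx, -⟩
    refine ContinuousAt.continuousWithinAt ?_
    rcases (hg s).agreeNear_or hp₁ hp₂ (hW s) (hW t) (hg t) hx with h | h
    · have h1 : ∀ᶠ a : T × Bool in 𝓝 (x, v), AgreeNear p₁ S (g s) (g t) (j a.1) :=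
        (hj.comp continuous_fst).continuousAt.eventually h.eventually
      refine (continuousAt_snd (p := (x, v))).congr ?_
      filter_upwards [h1] with a ha
      exact (if_pos ha).symm
    · refine (ContinuousAt.comp (x := (x, v)) (f := Prod.snd) (g := fun b : Bool => !b)
        continuous_of_discreteTopology.continuousAt continuousAt_snd).congr ?_
      have h1 : ∀ᶠ a : T × Bool in 𝓝 (x, v),
          AgreeNear p₁ S (g s) (sheetSwap p₂ ∘ g t) (j a.1) :=
        (hj.comp continuous_fst).continuousAt.eventually h.eventually
      have h2 : ∀ᶠ a : T × Bool in 𝓝 (x, v), j a.1 ∈ W t :=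
        (hj.comp continuous_fst).continuousAt.eventually ((hW t).mem_nhds hx.2)
      filter_upwards [h1, h2] with a ha ha'
      exact (if_neg fun h' => h'.not_swap hp₁ hp₂ (hW t) (hg t) ha' ha).symm
  coordChange_comp s t u x hx v := by
    have hst := (hg s).agreeNear_or hp₁ hp₂ (hW s) (hW t) (hg t) ⟨hx.1.1, hx.1.2⟩
    have htu := (hg t).agreeNear_or hp₁ hp₂ (hW t) (hW u) (hg u) ⟨hx.1.2, hx.2⟩
    have hn : ∀ r, AgreeNear p₁ S (g r) (sheetSwap p₂ ∘ g u) (j x) →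
        ¬ AgreeNear p₁ S (g r) (g u) (j x) := fun r h1 h2 =>
      h2.not_swap hp₁ hp₂ (hW u) (hg u) hx.2 h1
    have hn' : AgreeNear p₁ S (g s) (sheetSwap p₂ ∘ g t) (j x) →
        ¬ AgreeNear p₁ S (g s) (g t) (j x) := fun h1 h2 =>
      h2.not_swap hp₁ hp₂ (hW t) (hg t) hx.1.2 h1
    rcases hst with h1 | h1 <;> rcases htu with h2 | h2
    · rw [if_pos h1, if_pos h2, if_pos (h1.trans h2)]
    · rw [if_pos h1, if_neg (hn _ h2), if_neg (hn _ (h1.trans h2))]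
    · rw [if_neg (hn' h1), if_pos h2, if_neg (hn _ (h1.trans (h2.comp _)))]
    · have h3 := h1.trans (h2.comp (sheetSwap p₂))
      have h4 : sheetSwap p₂ ∘ sheetSwap p₂ ∘ g u = g u :=
        funext fun y => hp₂.sheetSwap_sheetSwap _
      rw [h4] at h3
      rw [if_neg (hn' h1), if_neg (hn _ h2), if_pos h3, Bool.not_not]

/-- Over a simply connected open set, the double cover of germs has a section, which selects at each
point one germ of an isomorphism, in a locally consistent way. -/
theorem exists_sheetIso_of_simplyConnected (hp₁ : IsTameDoubleCover p₁ S)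
    (hp₂ : IsTameDoubleCover p₂ S) (hU : IsOpen U) [SimplyConnectedSpace U]
    [LocallyPathConnectedSpace U]
    (hloc : ∀ x ∈ U, ∃ W g, IsOpen W ∧ x ∈ W ∧ IsSheetIso p₁ p₂ W g) :
    ∃ g, IsSheetIso p₁ p₂ U g := by
  classical
  choose W g hW hmem hg using fun x : U => hloc x x.2
  let Z := germBundle (Subtype.val : U → X) continuous_subtype_val hp₁ hp₂ W g hW hmem hg
  have hcov : IsCoveringMap (Bundle.TotalSpace.proj : Bundle.TotalSpace Bool Z.Fiber → U) :=
    FiberBundle.isCoveringMap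
  obtain ⟨x₀⟩ : Nonempty U := inferInstance
  obtain ⟨F, ⟨-, hF⟩, -⟩ := hcov.existsUnique_continuousMap_lifts (ContinuousMap.id U) x₀
    (⟨x₀, true⟩ : Bundle.TotalSpace Bool Z.Fiber) rfl
  have hFp : ∀ x : U, (F x).proj = x := fun x => congrFun hF x
  -- the coordinate of the section in the trivialization with index `t`
  let v : U → U → Bool := fun t x => (Z.localTriv t (F x)).2
  have hv : ∀ t x : U, (x : X) ∈ W t → ∀ᶠ x' in 𝓝 x, v t x' = v t x := by
    intro t x hx
    have h1 : ContinuousAt (v t) x := by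
      refine continuousAt_snd.comp ?_
      refine ContinuousAt.comp ?_ F.continuous.continuousAt
      refine (Z.localTriv t).continuousOn.continuousAt
        ((Z.localTriv t).open_source.mem_nhds ?_)
      rw [Z.mem_localTriv_source]
      show ((F x).proj : X) ∈ W t
      rw [hFp]; exact hx
    exact continuousAt_bool h1
  have hvv : ∀ t x : U, v t x = if AgreeNear p₁ S (g x) (g t) x then v x x else !(v x x) := by
    intro t x
    obtain ⟨w, hw⟩ : ∃ w : Bool, ∀ t, v t x = if AgreeNear p₁ S (g x) (g t) x then w else !w := by
      refine ⟨(F x).snd, fun t => if_congr (iff_of_eq ?_) rfl rfl⟩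
      exact congrArg (fun z : U => AgreeNear p₁ S (g z) (g t) z) (hFp x)
    have : AgreeNear p₁ S (g x) (g x) x := Eventually.of_forall fun _ _ _ => rfl
    rw [hw x, hw t, if_pos this]
  -- the germ at `x` selected by the section, read off from the local isomorphism with index `t`
  let pick : U → U → Y₁ → Y₂ := fun t x y => if v t x = true then g t y else sheetSwap p₂ (g t y)
  have hpick : ∀ (t x : U) (y : Y₁), p₁ y = x → p₁ y ∈ W t → pick x x y = pick t x y := by
    intro t x y hy hyt
    have hyx : p₁ y ∈ W x := by rw [hy]; exact hmem x
    by_cases hyS : p₁ y ∈ S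
    · have h1 : g x y = g t y := eq_over_branchSet hp₂ (hg x) (hg t) ⟨hyx, hyt⟩ hyS
      have h2 : sheetSwap p₂ (g t y) = g t y :=
        hp₂.sheetSwap_of_mem (by rwa [(hg t).map y hyt])
      simp only [pick, h1, h2, ite_self]
    · simp only [pick, hvv t x]
      rcases (hg x).agreeNear_or hp₁ hp₂ (hW x) (hW t) (hg t) ⟨hyx, hyt⟩ with h | h
      · have h1 := h.eq hyS
        rw [hy] at h
        rw [if_pos h, h1]
      · have h1 : g x y = sheetSwap p₂ (g t y) := h.eq hyS
        have h2 := fun h' => h.not_swap (h := sheetSwap p₂ ∘ g t) hp₁ hp₂ (hW t)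
          ((hg t).swap_comp hp₂) hyt h'
        have h3 : sheetSwap p₂ ∘ sheetSwap p₂ ∘ g t = g t :=
          funext fun y => hp₂.sheetSwap_sheetSwap _
        rw [h3, hy] at h2
        rw [if_neg h2, h1, hp₂.sheetSwap_sheetSwap]
        cases v x x <;> simp
  refine ⟨fun y => if hy : p₁ y ∈ U then pick ⟨p₁ y, hy⟩ ⟨p₁ y, hy⟩ y else g x₀ y, ?_, ?_, ?_⟩
  · intro y hy
    refine ContinuousAt.continuousWithinAt ?_
    set t : U := ⟨p₁ y, hy⟩
    have hgt : ContinuousAt (g t) y := (hg t).continuousOn.continuousAt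
      (((hW t).preimage hp₁.continuous).mem_nhds (hmem t))
    have h1 : ContinuousAt
        (fun y' => if v t t = true then g t y' else sheetSwap p₂ (g t y')) y := by
      split_ifs
      · exact hgt
      · exact hp₂.continuous_sheetSwap.continuousAt.comp hgt
    refine h1.congr ?_
    have h2 := hv t t (hmem t)
    rw [nhds_subtype_eq_comap, eventually_comap] at h2
    filter_upwards [(hU.preimage hp₁.continuous).mem_nhds hy,
      ((hW t).preimage hp₁.continuous).mem_nhds (hmem t),
      hp₁.continuous.continuousAt.eventually h2] with y' hy' hy't h3
    have hy'' : p₁ y' ∈ U := hy'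
    rw [dif_pos hy'', hpick t ⟨p₁ y', hy''⟩ y' rfl hy't]
    simp only [pick, h3 ⟨p₁ y', hy''⟩ rfl]
  · intro y hy
    have hy' : p₁ y ∈ U := hy
    have h1 := (hg ⟨p₁ y, hy'⟩).map y (hmem ⟨p₁ y, hy'⟩)
    rw [dif_pos hy']
    simp only [pick]
    split_ifs
    · exact h1
    · rw [map_sheetSwap p₂, h1]
  · intro y hy
    have hy' : p₁ y ∈ U := hy
    have h1 := (hg ⟨p₁ y, hy'⟩).swap y (hmem ⟨p₁ y, hy'⟩)
    simp only [map_sheetSwap p₁, dif_pos hy', pick, h1]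
    split_ifs <;> rfl

/-- Isomorphisms over two open sets with connected intersection can be glued. -/
theorem IsSheetIso.exists_union (hp₁ : IsTameDoubleCover p₁ S) (hp₂ : IsTameDoubleCover p₂ S)
    (hU₁ : IsOpen U₁) (hU₂ : IsOpen U₂) (hU : IsPreconnected (U₁ ∩ U₂))
    (hg₁ : IsSheetIso p₁ p₂ U₁ g₁) (hg₂ : IsSheetIso p₁ p₂ U₂ g₂) :
    ∃ g, IsSheetIso p₁ p₂ (U₁ ∪ U₂) g := by
  classical
  -- after a possible change of the sheet, the two isomorphisms agree over `U₁ ∩ U₂`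
  obtain ⟨g₂, hg₂, hagree⟩ : ∃ g₂, IsSheetIso p₁ p₂ U₂ g₂ ∧
      ∀ x ∈ U₁ ∩ U₂, AgreeNear p₁ S g₁ g₂ x := by
    let c : X → Bool := fun x => decide (AgreeNear p₁ S g₁ g₂ x)
    have hc : ∀ x ∈ U₁ ∩ U₂, ∀ᶠ x' in 𝓝 x, c x' = c x := by
      intro x hx
      rcases hg₁.agreeNear_or hp₁ hp₂ hU₁ hU₂ hg₂ hx with h | h
      · filter_upwards [h.eventually] with x' hx'
        simp only [c, hx', h]
      · filter_upwards [h.eventually, hU₂.mem_nhds hx.2] with x' hx' hx'₂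
        have h1 : ¬ AgreeNear p₁ S g₁ g₂ x := fun h' => h'.not_swap hp₁ hp₂ hU₂ hg₂ hx.2 h
        have h2 : ¬ AgreeNear p₁ S g₁ g₂ x' := fun h' => h'.not_swap hp₁ hp₂ hU₂ hg₂ hx'₂ hx'
        simp only [c, h1, h2]
    by_cases hall : ∀ x ∈ U₁ ∩ U₂, AgreeNear p₁ S g₁ g₂ x
    · exact ⟨g₂, hg₂, hall⟩
    · push Not at hall
      obtain ⟨x₀, hx₀, hn⟩ := hall
      refine ⟨_, hg₂.swap_comp hp₂, fun x hx => ?_⟩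
      refine (hg₁.agreeNear_or hp₁ hp₂ hU₁ hU₂ hg₂ hx).resolve_left fun h => hn ?_
      have h1 := hU.bool_const hc hx hx₀
      simp only [c, h, decide_true] at h1
      exact of_decide_eq_true h1.symm
  have heq : ∀ y, p₁ y ∈ U₁ ∩ U₂ → g₁ y = g₂ y := by
    intro y hy
    by_cases hyS : p₁ y ∈ S
    · exact eq_over_branchSet hp₂ hg₁ hg₂ hy hyS
    · exact (hagree _ hy).eq hyS
  let f : Y₁ → Y₂ := fun y => if p₁ y ∈ U₁ then g₁ y else g₂ y
  have hf₁ : ∀ y, p₁ y ∈ U₁ → f y = g₁ y := fun y hy => if_pos hy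
  have hf₂ : ∀ y, p₁ y ∈ U₂ → f y = g₂ y := by
    intro y hy
    by_cases h : p₁ y ∈ U₁
    · rw [hf₁ y h, heq y ⟨h, hy⟩]
    · exact if_neg h
  refine ⟨f, ?_, ?_, ?_⟩
  · rw [preimage_union]
    exact (hg₁.continuousOn.congr hf₁).union_of_isOpen (hg₂.continuousOn.congr hf₂)
      (hU₁.preimage hp₁.continuous) (hU₂.preimage hp₁.continuous)
  · rintro y (hy | hy)
    · rw [hf₁ y hy, hg₁.map y hy]
    · rw [hf₂ y hy, hg₂.map y hy]
  · rintro y (hy | hy)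
    · rw [hf₁ y hy, hf₁ _ (by rwa [map_sheetSwap p₁]), hg₁.swap y hy]
    · rw [hf₂ y hy, hf₂ _ (by rwa [map_sheetSwap p₁]), hg₂.swap y hy]

end Gluing

/-! ### Lifts of an involution -/

section OrderFour

variable {X Y : Type*} [TopologicalSpace X] [TopologicalSpace Y]

namespace IsTameDoubleCover

variable {p : Y → X} {S : Set X} (hp : IsTameDoubleCover p S)
include hp

/-- A homeomorphism `σ` of the pair has at most two lifts, which differ by the sheet swap. For
`σ = id` these are the deck transformations. -/
theorem eq_or_eq_sheetSwap_comp [PreconnectedSpace X] (hS : S.Nonempty) {σ : X → X}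
    (hσ : ∀ x, σ x ∈ S ↔ x ∈ S) {f g : Y → Y} (hf : Continuous f) (hg : Continuous g)
    (hpf : ∀ y, p (f y) = σ (p y)) (hpg : ∀ y, p (g y) = σ (p y)) :
    f = g ∨ f = sheetSwap p ∘ g := by
  have hT : IsPreconnected (p ⁻¹' (univ \ S)) :=
    hp.isPreconnected_preimage_diff isPreconnected_univ isOpen_univ (by simpa using hS)
  have hfS : ∀ y, p y ∈ S → ∀ h : Y → Y, (∀ y, p (h y) = σ (p y)) → f y = h y := by
    intro y hy h hh
    exact hp.eq_of_mem _ _ (by rwa [hh, hσ]) (by rw [hpf, hh])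
  refine (hp.eqOn_or_eqOn_sheetSwap hT hf.continuousOn hg.continuousOn
    (fun a _ => by rw [hpf, hpg]) (fun a ha => by rw [hpg, hσ]; exact ha.2)).imp ?_ ?_
  all_goals
    intro h
    funext y
    by_cases hy : p y ∈ S
    · exact hfS y hy _ fun y => by simp only [Function.comp_apply, map_sheetSwap p, hpg]
    · exact h ⟨mem_univ _, hy⟩

/-- The nontrivial deck transformation, which exchanges the two sheets. -/
noncomputable def swapHomeomorph : Y ≃ₜ Y where
  toFun := sheetSwap p
  invFun := sheetSwap p
  left_inv := hp.sheetSwap_sheetSwap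
  right_inv := hp.sheetSwap_sheetSwap
  continuous_toFun := hp.continuous_sheetSwap
  continuous_invFun := hp.continuous_sheetSwap

theorem isNontrivialDeck_iff [PreconnectedSpace X] (hS : S.Nonempty) (τ : Y ≃ₜ Y) :
    IsNontrivialDeck p τ ↔ τ = hp.swapHomeomorph := by
  constructor
  · rintro ⟨h1, h2⟩
    rcases hp.eq_or_eq_sheetSwap_comp hS (σ := id) (fun _ => Iff.rfl) τ.continuous continuous_id
      (fun y => congrFun h1 y) (fun _ => rfl) with h | h
    · exact absurd (Homeomorph.ext fun y => congrFun h y) h2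
    · exact Homeomorph.ext fun y => congrFun h y
  · rintro rfl
    refine ⟨funext (map_sheetSwap p), fun h => ?_⟩
    obtain ⟨s, hs⟩ := hS
    have := hp.neBot s hs
    obtain ⟨x, hx⟩ : (Sᶜ).Nonempty := Filter.nonempty_of_mem
      (self_mem_nhdsWithin : _ ∈ 𝓝[Sᶜ] s)
    obtain ⟨y, rfl⟩ := hp.surjective x
    exact hp.sheetSwap_ne hx (DFunLike.congr_fun h y)

/-- Given one lift `g`, the square `g ∘ g` is a lift of the identity, hence the identity or the
sheet swap. One point `y₀` that it moves settles which, and everything else follows. -/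
theorem hasExactlyTwoLiftsOfOrderFour [PreconnectedSpace X] (hS : S.Nonempty) {σ : X → X}
    (hinv : Function.Involutive σ) (hσ : ∀ x, σ x ∈ S ↔ x ∈ S) {g : Y → Y} (hg : Continuous g)
    (hpg : ∀ y, p (g y) = σ (p y)) (hswap : ∀ y, g (sheetSwap p y) = sheetSwap p (g y))
    {y₀ : Y} (hy₀ : g (g y₀) ≠ y₀) : HasExactlyTwoLiftsOfOrderFour p σ := by
  have hgg : ∀ y, g (g y) = sheetSwap p y := by
    rcases hp.eq_or_eq_sheetSwap_comp hS (σ := id) (fun _ => Iff.rfl) (hg.comp hg) continuous_id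
      (fun y => by rw [Function.comp_apply, hpg, hpg, hinv]; rfl) (fun _ => rfl) with h | h
    · exact absurd (congrFun h y₀) hy₀
    · exact congrFun h
  let σ' : Y ≃ₜ Y :=
    { toFun := g
      invFun := sheetSwap p ∘ g
      left_inv := fun y => by rw [Function.comp_apply, hgg, hp.sheetSwap_sheetSwap]
      right_inv := fun y => by rw [Function.comp_apply, hswap, hgg, hp.sheetSwap_sheetSwap]
      continuous_toFun := hg
      continuous_invFun := hp.continuous_sheetSwap.comp hg }
  have hsq : σ' ^ 2 = hp.swapHomeomorph := by
    rw [sq]; exact Homeomorph.ext hgg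
  have hsq1 : hp.swapHomeomorph ^ 2 = 1 := by
    rw [sq]; exact Homeomorph.ext hp.sheetSwap_sheetSwap
  have hne : hp.swapHomeomorph ≠ 1 := ((hp.isNontrivialDeck_iff hS _).2 rfl).2
  have h4 : σ' ^ 4 = 1 := by rw [show 4 = 2 * 2 from rfl, pow_mul, hsq, hsq1]
  have h3inv : σ' ^ 3 = σ'⁻¹ := by
    rw [eq_inv_iff_mul_eq_one, ← pow_succ]; exact h4
  have hord : orderOf σ' = 4 := by
    have := orderOf_eq_prime_pow (p := 2) (n := 1) (x := σ') (by simpa [hsq] using hne)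
      (by simpa using h4)
    simpa using this
  refine ⟨⟨hp.swapHomeomorph, (hp.isNontrivialDeck_iff hS _).2 rfl,
    fun τ hτ => (hp.isNontrivialDeck_iff hS τ).1 hτ⟩, fun τ hτ => ?_⟩
  rw [hp.isNontrivialDeck_iff hS] at hτ
  subst hτ
  have h3 : ⇑(σ' ^ 3) = sheetSwap p ∘ g := by rw [h3inv]; rfl
  refine ⟨σ', ?_, ?_, hsq, ?_, hord, ?_⟩
  · rw [h3]
    ext f
    constructor
    · rintro ⟨hf, hpf⟩
      exact hp.eq_or_eq_sheetSwap_comp hS hσ hf hg (fun y => congrFun hpf y) hpg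
    · rintro (rfl | rfl)
      · exact ⟨hg, funext hpg⟩
      · exact ⟨hp.continuous_sheetSwap.comp hg,
          funext fun y => by simp only [Function.comp_apply, map_sheetSwap p, hpg]⟩
  · intro h
    rw [h3inv, eq_inv_iff_mul_eq_one, ← sq, hsq] at h
    exact hne h
  · rw [← pow_mul, show 3 * 2 = 4 + 2 from rfl, pow_add, h4, one_mul, hsq]
  · rw [h3inv, orderOf_inv, hord]

end IsTameDoubleCover

end OrderFour

/-! ### The square of a lift near a fixed point -/

section SquareOfLift

variable {X Y V : Type*} [TopologicalSpace X] [TopologicalSpace Y] [NormedAddCommGroup V]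
  [NormedSpace ℝ V]

theorem isPreconnected_puncturedBall (ρ : ℝ) : IsPreconnected {w : ℂ | w ≠ 0 ∧ ‖w‖ < ρ} := by
  rcases le_or_gt ρ 0 with hρ | hρ
  · convert! isPreconnected_empty (α := ℂ) using 1
    ext w
    simp only [mem_ofPred_eq, mem_empty_iff_false, iff_false, not_and, not_lt]
    intro _
    exact hρ.trans (norm_nonneg w)
  · convert! ((convex_halfSpace_re_lt (Real.log ρ)).isPreconnected.image Complex.exp
      Complex.continuous_exp.continuousOn) using 1
    ext w
    constructor
    · rintro ⟨h1, h2⟩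
      refine ⟨Complex.log w, ?_, Complex.exp_log h1⟩
      simp only [mem_ofPred_eq]
      rw [Complex.log_re]
      exact Real.log_lt_log (norm_pos_iff.2 h1) h2
    · rintro ⟨ζ, hζ, rfl⟩
      refine ⟨Complex.exp_ne_zero _, ?_⟩
      rwa [Complex.norm_exp, ← Real.lt_log_iff_exp_lt hρ]

/-- A connected region around the punctured disc `{b₀} × {w | 0 < ‖w‖ < ρ}`, which stays away from
the branch locus `w = 0`. On it, `b - b₀` is of the order of `z = w ^ 2`, so that an error which is
small in comparison with `(b - b₀, z)` is small in comparison with `z`. -/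
def cone (D : Set V) (b₀ : V) (c ρ : ℝ) : Set (V × ℂ) :=
  {a | a.1 ∈ D ∧ ‖a.1 - b₀‖ ≤ c * ‖a.2‖ ^ 2 ∧ a.2 ≠ 0 ∧ ‖a.2‖ < ρ}

/-- Segments in the direction of `b` retract the cone to the punctured disc. -/
theorem isPreconnected_cone {D : Set V} (hD : Convex ℝ D) {b₀ : V} (hb₀ : b₀ ∈ D) {c : ℝ}
    (hc : 0 ≤ c) (ρ : ℝ) : IsPreconnected (cone D b₀ c ρ) := by
  have hcore : IsPreconnected (({b₀} : Set V) ×ˢ {w : ℂ | w ≠ 0 ∧ ‖w‖ < ρ}) :=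
    isPreconnected_singleton.prod (isPreconnected_puncturedBall ρ)
  have hcoreC : ({b₀} : Set V) ×ˢ {w : ℂ | w ≠ 0 ∧ ‖w‖ < ρ} ⊆ cone D b₀ c ρ := by
    rintro ⟨b, w⟩ ⟨rfl, hw, hwρ⟩
    refine ⟨hb₀, ?_, hw, hwρ⟩
    simp only [sub_self, norm_zero]; positivity
  rcases (cone D b₀ c ρ).eq_empty_or_nonempty with he | ⟨⟨b₁, w₁⟩, h₁⟩
  · rw [he]; exact isPreconnected_empty
  refine isPreconnected_of_forall (b₀, w₁) ?_
  rintro ⟨b, w⟩ h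
  refine ⟨({b₀} : Set V) ×ˢ {w : ℂ | w ≠ 0 ∧ ‖w‖ < ρ} ∪ segment ℝ b₀ b ×ˢ {w}, ?_, ?_, ?_, ?_⟩
  · refine union_subset hcoreC ?_
    rintro ⟨b', w'⟩ ⟨hb', rfl⟩
    refine ⟨hD.segment_subset hb₀ h.1 hb', le_trans ?_ h.2.1, h.2.2⟩
    have := norm_sub_le_of_mem_segment hb'
    simpa [norm_sub_rev] using this
  · exact Or.inl ⟨rfl, h₁.2.2⟩
  · exact Or.inr ⟨right_mem_segment ℝ b₀ b, rfl⟩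
  · refine hcore.union (b₀, w) ⟨rfl, h.2.2⟩ ⟨left_mem_segment ℝ b₀ b, rfl⟩ ?_
    exact (convex_segment b₀ b).isPreconnected.prod isPreconnected_singleton

theorem re_exp_log_pos {q q' : ℂ} (hq : 0 < q.re) (hq' : 0 < q'.re) :
    0 < (Complex.exp (Complex.log q / 2) * Complex.exp (Complex.log q' / 2)).re := by
  rw [← Complex.exp_add, Complex.exp_re]
  refine mul_pos (Real.exp_pos _) (Real.cos_pos_of_mem_Ioo ?_)
  have h1 := abs_lt.1 (Complex.abs_arg_lt_pi_div_two_iff.2 (Or.inl hq))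
  have h2 := abs_lt.1 (Complex.abs_arg_lt_pi_div_two_iff.2 (Or.inl hq'))
  have h3 : (Complex.log q / 2 + Complex.log q' / 2).im = (q.arg + q'.arg) / 2 := by
    simp [Complex.log_im]; ring
  rw [h3]
  constructor <;> linarith [h1.1, h1.2, h2.1, h2.2]

/-- A root of `-z` in the direction of `i w`, when `z` is close to `w ^ 2`. -/
noncomputable def turnedRoot (w z : ℂ) : ℂ :=
  Complex.I * w * Complex.exp (Complex.log (-z / w ^ 2) / 2)

theorem turnedRoot_sq {w z : ℂ} (hw : w ≠ 0) (hz : z ≠ 0) : turnedRoot w z ^ 2 = z := by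
  have h1 : -z / w ^ 2 ≠ 0 := div_ne_zero (neg_ne_zero.2 hz) (pow_ne_zero 2 hw)
  rw [turnedRoot, mul_pow, ← Complex.exp_nat_mul, mul_pow, Complex.I_sq]
  push_cast
  rw [mul_div_cancel₀ _ two_ne_zero, Complex.exp_log h1]
  field_simp

theorem re_neg_div_sq_pos {w z : ℂ} (hw : w ≠ 0) (h : ‖z + w ^ 2‖ ≤ ‖w‖ ^ 2 / 2) :
    0 < (-z / w ^ 2).re := by
  have hw2 : (0 : ℝ) < ‖w‖ ^ 2 := by positivity
  have h1 : ‖1 - -z / w ^ 2‖ ≤ 1 / 2 := by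
    have : 1 - -z / w ^ 2 = (z + w ^ 2) / w ^ 2 := by field_simp; ring
    rw [this, norm_div, norm_pow, div_le_iff₀ hw2]; linarith
  have h2 := (Complex.abs_re_le_norm _).trans h1
  have h3 := (abs_le.1 h2).2
  simp only [Complex.sub_re, Complex.one_re] at h3
  linarith

/-- Suppose that the derivative of `σ` at a fixed branch point is `-1` in the normal direction `z`.
Then, on the cone, `σ` maps `z = w ^ 2` to a number close to `-w ^ 2`, which has a square root
close to `i * w`; so `σ` has there a lift `Φ` to square-root coordinates that turns by nearly a
right angle. Up to the sheet swap, `g` is `Φ`, and `Φ ∘ Φ` reverses `w`. -/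
theorem IsTameDoubleCover.exists_lift_lift_ne {p : Y → X} {S : Set X}
    (hp : IsTameDoubleCover p S) (e : FlatChart S V) {b₀ : V} (hb₀ : b₀ ∈ e.base) {σ : X → X}
    (hσc : Continuous σ) (hinv : Function.Involutive σ) (hσx : σ (e.symm (b₀, 0)) = e.symm (b₀, 0))
    {A : V × ℂ →L[ℝ] V × ℂ}
    (hA : HasFDerivWithinAt (fun a => e.toPartialEquiv (σ (e.symm a))) A e.target (b₀, 0))
    (hA2 : ∀ v, (A v).2 = -v.2) {g : Y → Y} (hg : Continuous g)
    (hpg : ∀ y, p (g y) = σ (p y)) (hswap : ∀ y, g (sheetSwap p y) = sheetSwap p (g y)) :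
    ∃ y, g (g y) ≠ y := by
  obtain ⟨G, hG⟩ := e.exists_rootParametrization hp ⟨b₀, hb₀⟩
  set s : V × ℂ → V × ℂ := fun a => e.toPartialEquiv (σ (e.symm a)) with hs
  have ha₀ : (b₀, (0 : ℂ)) ∈ e.target := e.mem_target.2 ⟨hb₀, by simpa using e.radius_pos⟩
  have hs₀ : s (b₀, 0) = (b₀, 0) := by
    simp only [hs, hσx]; exact e.right_inv ha₀
  set L : ℝ := ‖A‖ + 1 with hL
  have hL1 : 1 ≤ L := by have := norm_nonneg A; linarith
  set c : ℝ := 2 * L with hc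
  have hc1 : 1 ≤ c := by linarith
  -- close to the fixed point, `s` is controlled by its derivative
  obtain ⟨δ, hδ, hδs⟩ : ∃ δ > 0, ∀ a ∈ e.target, ‖a - (b₀, 0)‖ < δ →
      σ (e.symm a) ∈ e.source ∧ ‖s a - (b₀, 0)‖ ≤ L * ‖a - (b₀, 0)‖ ∧
        ‖(s a).2 + a.2‖ ≤ 1 / (2 * c) * ‖a - (b₀, 0)‖ := by
    have h1 := hA.isLittleO.bound (show (0 : ℝ) < 1 / (2 * c) by positivity)
    have h2 : ∀ᶠ a in 𝓝[e.target] (b₀, (0 : ℂ)), σ (e.symm a) ∈ e.source := by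
      have h3 : ContinuousWithinAt (fun a => σ (e.symm a)) e.target (b₀, 0) :=
        hσc.continuousAt.comp_continuousWithinAt (e.continuousOn_invFun _ ha₀)
      refine h3.eventually (e.open_source.mem_nhds ?_)
      show σ (e.symm (b₀, 0)) ∈ e.source
      rw [hσx]; exact e.map_target ha₀
    obtain ⟨δ, hδ, h4⟩ := Metric.mem_nhdsWithin_iff.1 (h1.and h2)
    refine ⟨δ, hδ, fun a ha haδ => ?_⟩
    obtain ⟨h5, h6⟩ := h4 ⟨by rwa [Metric.mem_ball, dist_eq_norm], ha⟩
    change ‖s a - s (b₀, 0) - A (a - (b₀, 0))‖ ≤ _ at h5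
    rw [hs₀] at h5
    refine ⟨h6, ?_, ?_⟩
    · have h7 : s a - (b₀, 0) = (s a - (b₀, 0) - A (a - (b₀, 0))) + A (a - (b₀, 0)) := by abel
      rw [h7]
      refine (norm_add_le _ _).trans ?_
      have h8 := A.le_opNorm (a - (b₀, 0))
      have h9 : 1 / (2 * c) ≤ 1 := by rw [div_le_one (by positivity)]; linarith
      have h10 := mul_le_mul_of_nonneg_right h9 (norm_nonneg (a - (b₀, 0)))
      rw [hL, add_mul]; linarith
    · refine le_trans ?_ h5
      have h7 : (s a).2 + a.2 = (s a - (b₀, 0) - A (a - (b₀, 0))).2 := by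
        simp [hA2]
      rw [h7]; exact norm_snd_le _
  obtain ⟨ρ, hρ, hρδ, hρR⟩ : ∃ ρ > 0, c * ρ ^ 2 < δ ∧ ρ ^ 2 < e.radius := by
    have h1 : Tendsto (fun ρ : ℝ => c * ρ ^ 2) (𝓝[>] 0) (𝓝 0) := by
      have : Tendsto (fun ρ : ℝ => c * ρ ^ 2) (𝓝 0) (𝓝 (c * 0 ^ 2)) := by
        apply Continuous.tendsto; fun_prop
      simpa using this.mono_left nhdsWithin_le_nhds
    have h2 : Tendsto (fun ρ : ℝ => ρ ^ 2) (𝓝[>] 0) (𝓝 0) := by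
      have : Tendsto (fun ρ : ℝ => ρ ^ 2) (𝓝 0) (𝓝 (0 ^ 2)) := by
        apply Continuous.tendsto; fun_prop
      simpa using this.mono_left nhdsWithin_le_nhds
    obtain ⟨ρ, h3, h4, h5⟩ := ((eventually_mem_nhdsWithin (a := (0 : ℝ)) (s := Ioi 0)).and
      ((h1.eventually (gt_mem_nhds hδ)).and (h2.eventually (gt_mem_nhds e.radius_pos)))).exists
    exact ⟨ρ, h3, h4, h5⟩
  set C := cone e.base b₀ c ρ with hC
  have hCsq : ∀ a ∈ C, ‖((a.1, a.2 ^ 2) : V × ℂ) - (b₀, 0)‖ ≤ c * ‖a.2‖ ^ 2 := by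
    rintro a ⟨-, h2, -, -⟩
    rw [Prod.norm_def]
    refine max_le h2 ?_
    simp only [Prod.snd_sub, sub_zero, norm_pow]
    exact le_mul_of_one_le_left (by positivity) hc1
  have hCroot : C ⊆ e.rootDomain := by
    rintro a ⟨h1, -, h3, h4⟩
    refine ⟨h1, h3, lt_trans ?_ hρR⟩
    exact pow_lt_pow_left₀ h4 (norm_nonneg _) two_ne_zero
  have hCt : ∀ a ∈ C, (a.1, a.2 ^ 2) ∈ e.target := fun a ha => e.sq_mem_target (hCroot ha)
  have hCδ : ∀ a ∈ C, ‖((a.1, a.2 ^ 2) : V × ℂ) - (b₀, 0)‖ < δ := by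
    intro a ha
    refine (hCsq a ha).trans_lt (lt_of_le_of_lt ?_ hρδ)
    exact mul_le_mul_of_nonneg_left (pow_le_pow_left₀ (norm_nonneg _) ha.2.2.2.le 2) (by linarith)
  have hCz : ∀ a ∈ C, ‖(s (a.1, a.2 ^ 2)).2 + a.2 ^ 2‖ ≤ ‖a.2‖ ^ 2 / 2 := by
    intro a ha
    refine ((hδs _ (hCt a ha) (hCδ a ha)).2.2).trans ?_
    refine (mul_le_mul_of_nonneg_left (hCsq a ha) (by positivity)).trans (le_of_eq ?_)
    field_simp
  have hCre : ∀ a ∈ C, 0 < (-(s (a.1, a.2 ^ 2)).2 / a.2 ^ 2).re := fun a ha =>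
    re_neg_div_sq_pos ha.2.2.1 (hCz a ha)
  have hCz0 : ∀ a ∈ C, (s (a.1, a.2 ^ 2)).2 ≠ 0 := by
    intro a ha h0
    have := hCre a ha
    rw [h0] at this
    simp at this
  -- the lift of `s` to the square-root coordinates which turns by a right angle
  let Φ : V × ℂ → V × ℂ := fun a => ((s (a.1, a.2 ^ 2)).1, turnedRoot a.2 (s (a.1, a.2 ^ 2)).2)
  have hΦsq : ∀ a ∈ C, ((Φ a).1, (Φ a).2 ^ 2) = s (a.1, a.2 ^ 2) := by
    intro a ha
    simp only [Φ, turnedRoot_sq ha.2.2.1 (hCz0 a ha)]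
  have hst : ∀ a ∈ C, s (a.1, a.2 ^ 2) ∈ e.target := fun a ha =>
    e.map_source (hδs _ (hCt a ha) (hCδ a ha)).1
  have hΦroot : ∀ a ∈ C, Φ a ∈ e.rootDomain := by
    intro a ha
    have h1 := hst a ha
    rw [← hΦsq a ha, e.mem_target] at h1
    refine ⟨h1.1, fun h0 => hCz0 a ha ?_, by simpa using h1.2⟩
    rw [← hΦsq a ha]; simp only [h0]; ring
  have hsc : ContinuousOn (fun a : V × ℂ => s (a.1, a.2 ^ 2)) C := by
    have h1 : ContinuousOn (fun a : V × ℂ => e.symm (a.1, a.2 ^ 2)) C :=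
      ContinuousOn.comp e.continuousOn_invFun (by fun_prop) hCt
    exact e.continuousOn_toFun.comp (hσc.comp_continuousOn h1)
      fun a ha => (hδs _ (hCt a ha) (hCδ a ha)).1
  have hΦc : ContinuousOn Φ C := by
    have h1 : ContinuousOn (fun a : V × ℂ => -(s (a.1, a.2 ^ 2)).2 / a.2 ^ 2) C :=
      (continuous_snd.comp_continuousOn hsc).neg.div (by fun_prop)
        fun a ha => pow_ne_zero 2 ha.2.2.1
    have h2 := h1.clog fun a ha => Or.inl (hCre a ha)
    refine (continuous_fst.comp_continuousOn hsc).prodMk ?_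
    exact (continuousOn_const.mul continuousOn_snd).mul
      (Complex.continuous_exp.comp_continuousOn (h2.div_const 2))
  have hpGΦ : ∀ a ∈ C, p (G (Φ a)) = σ (p (G a)) := by
    intro a ha
    rw [hG.map _ (hΦroot a ha), hΦsq a ha, hG.map a (hCroot ha)]
    exact e.left_inv (hδs _ (hCt a ha) (hCδ a ha)).1
  have hlift := hp.eqOn_or_eqOn_sheetSwap
    (isPreconnected_cone e.convex_base hb₀ (by linarith) ρ : IsPreconnected C)
    (g := g ∘ G) (h := G ∘ Φ) (hg.comp_continuousOn (hG.continuousOn.mono hCroot))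
    (hG.continuousOn.comp hΦc hΦroot)
    (fun a ha => by rw [Function.comp_apply, hpg]; exact (hpGΦ a ha).symm)
    (fun a ha => hG.map_notMem (hΦroot a ha))
  -- a point of the cone whose image under `Φ` is in the cone: as `Φ` stretches `‖w‖ ^ 2` by a
  -- factor of at most `L`, `‖w‖ = ρ / (2 * L)` is small enough
  set ε : ℝ := ρ / (2 * L) with hε
  have hε0 : 0 < ε := by positivity
  have hερ : ε < ρ := by rw [hε, div_lt_iff₀ (by positivity)]; nlinarith
  have hLε : L * ε ^ 2 < ρ ^ 2 := by
    have h1 : L * ε = ρ / 2 := by rw [hε]; field_simp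
    nlinarith
  set a₁ : V × ℂ := (b₀, (ε : ℂ)) with ha₁
  have hnε : ‖(ε : ℂ)‖ = ε := by rw [Complex.norm_real, Real.norm_of_nonneg hε0.le]
  have h₁C : a₁ ∈ C := by
    refine ⟨hb₀, ?_, ?_, ?_⟩
    · simp only [ha₁, sub_self, norm_zero]; positivity
    · simpa [ha₁] using hε0.ne'
    · simpa only [ha₁, hnε] using hερ
  have h₁norm : ‖((a₁.1, a₁.2 ^ 2) : V × ℂ) - (b₀, 0)‖ = ε ^ 2 := by
    rw [Prod.norm_def]
    simp only [ha₁, Prod.fst_sub, Prod.snd_sub, sub_self, norm_zero, sub_zero, norm_pow, hnε]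
    exact max_eq_right (by positivity)
  have h₁b := (hδs _ (hCt _ h₁C) (hCδ _ h₁C)).2.1
  rw [h₁norm, Prod.norm_def, max_le_iff] at h₁b
  simp only [Prod.fst_sub, Prod.snd_sub, sub_zero] at h₁b
  have h₁Φ : ‖(Φ a₁).2‖ ^ 2 = ‖(s (a₁.1, a₁.2 ^ 2)).2‖ := by
    rw [← norm_pow, ← hΦsq a₁ h₁C]
  have h₂C : Φ a₁ ∈ C := by
    refine ⟨(hΦroot a₁ h₁C).1, ?_, (hΦroot a₁ h₁C).2.1, ?_⟩
    · rw [h₁Φ]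
      refine h₁b.1.trans ?_
      have h1 := hCz a₁ h₁C
      have h2 : ‖a₁.2 ^ 2‖ ≤ ‖(s (a₁.1, a₁.2 ^ 2)).2 + a₁.2 ^ 2‖ + ‖(s (a₁.1, a₁.2 ^ 2)).2‖ := by
        have := norm_sub_le ((s (a₁.1, a₁.2 ^ 2)).2 + a₁.2 ^ 2) (s (a₁.1, a₁.2 ^ 2)).2
        simpa using this
      rw [norm_pow] at h2
      have h3 : ‖a₁.2‖ = ε := hnε
      rw [h3] at h1 h2
      rw [hc]
      nlinarith
    · refine lt_of_pow_lt_pow_left₀ 2 hρ.le ?_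
      rw [h₁Φ]
      exact h₁b.2.trans_lt hLε
  refine ⟨G a₁, ?_⟩
  have hgg : g (g (G a₁)) = G (Φ (Φ a₁)) := by
    rcases hlift with h | h
    · have h1 := h h₁C
      have h2 := h h₂C
      simp only [Function.comp_apply] at h1 h2
      rw [h1, h2]
    · have h1 := h h₁C
      have h2 := h h₂C
      simp only [Function.comp_apply] at h1 h2
      rw [h1, hswap, h2, hp.sheetSwap_sheetSwap]
  have hpp : p (G (Φ (Φ a₁))) = p (G a₁) := by rw [hpGΦ _ h₂C, hpGΦ _ h₁C, hinv]
  obtain ⟨hb, hw⟩ := hG.eq_of_map_eq (hΦroot _ h₂C) (hCroot h₁C) hpp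
  -- of the two square roots of `w ^ 2`, two turns by nearly a right angle lead to `-w`
  have hre : (Φ (Φ a₁)).2.re < 0 := by
    have h1 := re_exp_log_pos (hCre _ h₁C) (hCre _ h₂C)
    set r := Complex.exp (Complex.log (-(s (a₁.1, a₁.2 ^ 2)).2 / a₁.2 ^ 2) / 2)
    set r' := Complex.exp (Complex.log (-(s ((Φ a₁).1, (Φ a₁).2 ^ 2)).2 / (Φ a₁).2 ^ 2) / 2)
    have h2 : (Φ (Φ a₁)).2 = -((ε : ℝ) * (r * r')) := by
      show Complex.I * (Complex.I * (ε : ℂ) * r) * r' = _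
      linear_combination (ε : ℂ) * r * r' * Complex.I_mul_I
    rw [h2, Complex.neg_re, Complex.re_ofReal_mul]
    have := mul_pos hε0 h1
    linarith
  have hΦΦ : Φ (Φ a₁) = (a₁.1, -a₁.2) := by
    refine Prod.ext hb ?_
    refine (sq_eq_sq_iff_eq_or_eq_neg.1 hw).resolve_left fun h => ?_
    rw [h] at hre
    simp only [ha₁, Complex.ofReal_re] at hre
    linarith
  rw [hgg, hΦΦ, hG.neg _ (hCroot h₁C)]
  exact hp.sheetSwap_ne (hG.map_notMem (hCroot h₁C))

end SquareOfLift

/-! ### The derivative of an involution at a fixed point -/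

section Derivatives

section Linearization

variable {E F : Type*} [NormedAddCommGroup E] [NormedSpace ℝ E]
  [NormedAddCommGroup F] [NormedSpace ℝ F]

theorem fderiv_involution_sq {s : E → E} {A : E →L[ℝ] E} {a : E} (hs : HasFDerivAt s A a)
    (ha : s a = a) (hinv : ∀ᶠ y in 𝓝 a, s (s y) = y) (v : E) : A (A v) = v := by
  have h1 : HasFDerivAt (s ∘ s) (A.comp A) a := by
    refine HasFDerivAt.comp a ?_ hs
    rwa [ha]
  have h2 : HasFDerivAt (s ∘ s) (ContinuousLinearMap.id ℝ E) a :=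
    (hasFDerivAt_id a).congr_of_eventuallyEq hinv
  exact DFunLike.congr_fun (h1.unique h2) v

/-- If the fixed points of an involution `s` near `a` lie on the level set of `ℓ` through `a`, then
the derivative `A` of `s` at `a` acts by `-1` on the quotient by `ker ℓ`. Indeed `s` is conjugate
to `A`, so that fixed vectors of `A`, such as `v + A v`, are tangent to curves of fixed points, and
`ℓ` vanishes on them. -/
theorem fderiv_involution_normal [CompleteSpace E] {s : E → E} {A : E →L[ℝ] E} {a : E}
    (hs : HasStrictFDerivAt s A a) (ha : s a = a) (hinv : ∀ᶠ y in 𝓝 a, s (s y) = y)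
    {ℓ : E →L[ℝ] F} (hfix : ∀ᶠ y in 𝓝 a, s y = y → ℓ y = ℓ a) (v : E) : ℓ (A v) = -ℓ v := by
  have hAA := fderiv_involution_sq hs.hasFDerivAt ha hinv
  -- the average `L` of `id` and `A ∘ s` conjugates `s` to `A`
  let L : E → E := fun y => (1 / 2 : ℝ) • (y + A (s y))
  have hL : HasStrictFDerivAt L ((ContinuousLinearEquiv.refl ℝ E : E ≃L[ℝ] E) : E →L[ℝ] E) a := by
    have h1 := ((hasStrictFDerivAt_id a).add (A.hasStrictFDerivAt.comp a hs)).const_smul (1 / 2 : ℝ)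
    refine h1.congr_fderiv ?_
    ext w
    simp only [smul_apply, add_apply,
      ContinuousLinearMap.comp_apply, hAA, ContinuousLinearMap.id_apply,
      ContinuousLinearEquiv.coe_coe, ContinuousLinearEquiv.refl_apply]
    rw [← two_smul ℝ w, smul_smul]; norm_num
  have hLs : ∀ᶠ y in 𝓝 a, L (s y) = A (L y) := by
    filter_upwards [hinv] with y hy
    simp only [L, hy, map_smul, map_add, hAA]
    rw [add_comm]
  set Φ := hL.toOpenPartialHomeomorph L with hΦ
  have hΦL : ∀ y, Φ y = L y := fun y => by rw [hΦ, hL.toOpenPartialHomeomorph_coe]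
  have haΦ : a ∈ Φ.source := hL.mem_toOpenPartialHomeomorph_source
  have hinvL : HasStrictFDerivAt (hL.localInverse L _ a)
      ((ContinuousLinearEquiv.refl ℝ E : E ≃L[ℝ] E) : E →L[ℝ] E) (L a) := hL.to_localInverse
  have hloc : ∀ y, hL.localInverse L _ a y = Φ.symm y := fun y => by
    rw [hL.localInverse_def]
  -- fixed vectors of `A` are tangent to fixed points of `s`
  have key : ∀ w : E, A w = w → ℓ w = 0 := by
    intro w hw
    let y : ℝ → E := fun t => Φ.symm (L a + t • w)
    have hline : HasDerivAt (fun t : ℝ => L a + t • w) w 0 := by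
      simpa using ((hasDerivAt_id (0 : ℝ)).smul_const w).const_add (L a)
    have hy : HasDerivAt y w 0 := by
      have h1 : HasFDerivAt Φ.symm ((ContinuousLinearEquiv.refl ℝ E : E ≃L[ℝ] E) : E →L[ℝ] E)
          (L a + (0 : ℝ) • w) := by
        rw [zero_smul, add_zero]
        exact hinvL.hasFDerivAt.congr_of_eventuallyEq (Eventually.of_forall fun y => (hloc y).symm)
      exact h1.comp_hasDerivAt (0 : ℝ) hline
    have hy0 : y 0 = a := by
      simp only [y, zero_smul, add_zero]
      rw [← hΦL]; exact Φ.left_inv haΦ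
    have hyt : Tendsto y (𝓝 0) (𝓝 a) := by
      have := hy.continuousAt.tendsto
      rwa [hy0] at this
    have hst : Tendsto s (𝓝 a) (𝓝 a) := by
      have := hs.continuousAt.tendsto
      rwa [ha] at this
    have htgt : ∀ᶠ t : ℝ in 𝓝 0, L a + t • w ∈ Φ.target := by
      refine hline.continuousAt.eventually (Φ.open_target.mem_nhds ?_)
      simp only [zero_smul, add_zero]
      rw [← hΦL]; exact Φ.map_source haΦ
    have hALa : A (L a) = L a := by
      have := hLs.self_of_nhds
      rw [ha] at this
      exact this.symm
    have hzero : ∀ᶠ t in 𝓝 (0 : ℝ), ℓ (y t) = ℓ a := by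
      filter_upwards [htgt, hyt.eventually hLs, hyt.eventually hfix,
        hyt.eventually (hst.eventually (Φ.open_source.mem_nhds haΦ))] with t h1 h2 h3 h4
      refine h3 (Φ.injOn h4 (Φ.map_target h1) ?_)
      have h5 : L (y t) = L a + t • w := by rw [← hΦL]; exact Φ.right_inv h1
      rw [hΦL, hΦL, h2, h5, A.map_add (L a) (t • w), hALa, A.map_smul, hw]
    have h1 : HasDerivAt (fun t => ℓ (y t)) (ℓ w) 0 := ℓ.hasFDerivAt.comp_hasDerivAt 0 hy
    have h2 : HasDerivAt (fun t => ℓ (y t)) 0 0 :=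
      (hasDerivAt_const (0 : ℝ) (ℓ a)).congr_of_eventuallyEq hzero
    exact h1.unique h2
  have h1 := key (v + A v) (by rw [map_add, hAA, add_comm])
  rw [map_add] at h1
  exact eq_neg_of_add_eq_zero_right h1

end Linearization

/-- An involution of the closed ball with a differentiable extension maps interior points to
interior points, since its derivative there is invertible. -/
theorem norm_map_lt_one {E : Type*} [NormedAddCommGroup E] [NormedSpace ℝ E]
    [FiniteDimensional ℝ E] {g : E → E} (hg : Differentiable ℝ g)
    (hmaps : ∀ x, ‖x‖ ≤ 1 → ‖g x‖ ≤ 1) (hinv : ∀ x, ‖x‖ ≤ 1 → g (g x) = x) {x : E}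
    (hx : ‖x‖ < 1) : ‖g x‖ < 1 := by
  have hnhds : Metric.closedBall (0 : E) 1 ∈ 𝓝 x := by
    refine mem_of_superset (Metric.isOpen_ball.mem_nhds ?_) Metric.ball_subset_closedBall
    simpa using hx
  have h1 : HasFDerivAt (g ∘ g) ((fderiv ℝ g (g x)).comp (fderiv ℝ g x)) x :=
    (hg _).hasFDerivAt.comp x (hg x).hasFDerivAt
  have h2 : HasFDerivAt (g ∘ g) (ContinuousLinearMap.id ℝ E) x := by
    refine (hasFDerivAt_id x).congr_of_eventuallyEq ?_
    filter_upwards [hnhds] with y hy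
    exact hinv y (by simpa using hy)
  have h3 : ∀ v, fderiv ℝ g (g x) (fderiv ℝ g x v) = v := DFunLike.congr_fun (h1.unique h2)
  have hinj : Function.Injective (fderiv ℝ g x) := Function.LeftInverse.injective h3
  have hsurj : Function.Surjective (fderiv ℝ g x) :=
    LinearMap.injective_iff_surjective (f := (fderiv ℝ g x : E →ₗ[ℝ] E)) |>.1 hinj
  have h4 := (hg x).mem_interior_convex_of_surjective_fderiv hnhds
    (convex_closedBall (0 : E) 1) Metric.isClosed_closedBall
    ⟨0, by rw [interior_closedBall _ one_ne_zero]; simp⟩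
    (fun y hy => by simpa using hmaps y (by simpa using hy)) hsurj
  rw [interior_closedBall _ one_ne_zero] at h4
  simpa using h4

/-! ### Coordinates at the boundary -/

/-- If `ρ = 1` defines the boundary, in coordinates `((u₀, u₁), z)` in which the half-plane
`0 ≤ u₀`, `z = 0` meets the boundary transversely along `u₀ = 0`, then `((1 - ρ, u₁), z)` are
coordinates in which both are flat. The last conclusion says that the surface is still given by
`z = 0` within `ρ ≤ 1`, without the condition `0 ≤ u₀`: along `z = 0`, `ρ` decreases in `u₀`. -/
theorem exists_boundary_straightening {ρ : (ℝ × ℝ) × ℂ → ℝ} {c : ℝ}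
    (hρ : ContDiffAt ℝ ∞ ρ ((0, c), 0)) (hρ0 : ∀ᶠ u : ℝ in 𝓝 c, ρ ((0, u), 0) = 1)
    (hρ1 : ∀ᶠ t : ℝ in 𝓝[>] 0, ρ ((t, c), 0) ≤ 1)
    (hd : fderiv ℝ ρ ((0, c), 0) ((1, 0), 0) ≠ 0) :
    ∃ κ : OpenPartialHomeomorph ((ℝ × ℝ) × ℂ) ((ℝ × ℝ) × ℂ),
      ((0, c), 0) ∈ κ.source ∧ (∀ y, κ y = ((1 - ρ y, y.1.2), y.2)) ∧
      ContDiffAt ℝ ∞ κ ((0, c), 0) ∧ ContDiffAt ℝ ∞ κ.symm (κ ((0, c), 0)) ∧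
      ∀ y ∈ κ.source, y.2 = 0 → ρ y ≤ 1 → 0 ≤ y.1.1 := by
  set a : (ℝ × ℝ) × ℂ := ((0, c), 0) with ha
  set D := fderiv ℝ ρ a with hD
  have hρd : HasFDerivAt ρ D a := (hρ.differentiableAt (by simp)).hasFDerivAt
  have hρa : ρ a = 1 := hρ0.self_of_nhds
  -- the sign of the normal derivative
  have hDneg : D ((1, 0), 0) < 0 := by
    refine lt_of_le_of_ne ?_ hd
    have h1 : HasDerivAt (fun t : ℝ => ρ ((t, c), 0)) (D ((1, 0), 0)) 0 := by
      have h2 : HasDerivAt (fun t : ℝ => (((t, c), 0) : (ℝ × ℝ) × ℂ)) ((1, 0), 0) 0 :=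
        ((hasDerivAt_id (0 : ℝ)).prodMk (hasDerivAt_const _ _)).prodMk (hasDerivAt_const _ _)
      exact HasFDerivAt.comp_hasDerivAt (0 : ℝ) hρd h2
    have h2 := h1.hasDerivWithinAt (s := Ioi 0)
    rw [hasDerivWithinAt_iff_tendsto_slope' (by simp)] at h2
    refine le_of_tendsto h2 ?_
    filter_upwards [hρ1, self_mem_nhdsWithin] with t ht ht0
    rw [slope_def_field]
    have ht0' : (0 : ℝ) < t := ht0
    refine div_nonpos_of_nonpos_of_nonneg ?_ (by linarith)
    have : ρ ((0, c), 0) = 1 := hρa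
    linarith
  let k : (ℝ × ℝ) × ℂ → (ℝ × ℝ) × ℂ := fun y => ((1 - ρ y, y.1.2), y.2)
  let K : (ℝ × ℝ) × ℂ →L[ℝ] (ℝ × ℝ) × ℂ :=
    ((-D).prod ((ContinuousLinearMap.snd ℝ ℝ ℝ).comp (ContinuousLinearMap.fst ℝ (ℝ × ℝ) ℂ))).prod
      (ContinuousLinearMap.snd ℝ (ℝ × ℝ) ℂ)
  have hkd : HasFDerivAt k K a := by
    have h1 : HasFDerivAt (fun y => 1 - ρ y) (-D) a := hρd.const_sub 1
    have h2 : HasFDerivAt (fun y : (ℝ × ℝ) × ℂ => y.1.2) ((ContinuousLinearMap.snd ℝ ℝ ℝ).comp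
      (ContinuousLinearMap.fst ℝ (ℝ × ℝ) ℂ)) a :=
      ((ContinuousLinearMap.snd ℝ ℝ ℝ).comp (ContinuousLinearMap.fst ℝ (ℝ × ℝ) ℂ)).hasFDerivAt
    exact (h1.prodMk h2).prodMk (ContinuousLinearMap.snd ℝ (ℝ × ℝ) ℂ).hasFDerivAt
  have hKinj : Function.Injective K := by
    rw [injective_iff_map_eq_zero]
    rintro ⟨⟨v₀, v₁⟩, w⟩ hv
    have h1 : -D ((v₀, v₁), w) = 0 := congrArg (fun z => z.1.1) hv
    have h2 : v₁ = 0 := congrArg (fun z => z.1.2) hv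
    have h3 : w = 0 := congrArg (fun z => z.2) hv
    subst h2 h3
    have h4 : (((v₀, 0), 0) : (ℝ × ℝ) × ℂ) = v₀ • ((1, 0), 0) := by simp
    rw [h4, map_smul, smul_eq_mul, neg_eq_zero, mul_eq_zero] at h1
    rcases h1 with rfl | h1
    · rfl
    · exact absurd h1 hDneg.ne
  let Ke : ((ℝ × ℝ) × ℂ) ≃L[ℝ] (ℝ × ℝ) × ℂ :=
    (LinearEquiv.ofInjectiveEndo (K : (ℝ × ℝ) × ℂ →ₗ[ℝ] (ℝ × ℝ) × ℂ)
      hKinj).toContinuousLinearEquiv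
  have hkd' : HasFDerivAt k (Ke : (ℝ × ℝ) × ℂ →L[ℝ] (ℝ × ℝ) × ℂ) a := by
    have hKe : (Ke : (ℝ × ℝ) × ℂ →L[ℝ] (ℝ × ℝ) × ℂ) = K := ContinuousLinearMap.ext fun _ => rfl
    rw [hKe]; exact hkd
  have hk : ContDiffAt ℝ ∞ k a :=
    ((contDiffAt_const.sub hρ).prodMk (contDiffAt_snd.comp a contDiffAt_fst)).prodMk contDiffAt_snd
  let κ₀ := hk.toOpenPartialHomeomorph k hkd' (by simp)
  have hκ₀ : ∀ y, κ₀ y = k y := fun y => by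
    rw [ContDiffAt.toOpenPartialHomeomorph_coe]
  have haκ₀ : a ∈ κ₀.source := hk.mem_toOpenPartialHomeomorph_source hkd' (by simp)
  -- a box on which the normal derivative is negative
  obtain ⟨r, hr, hrd, hru⟩ : ∃ r > 0,
      (∀ y ∈ Metric.ball a r, ∃ D' : (ℝ × ℝ) × ℂ →L[ℝ] ℝ, HasFDerivAt ρ D' y ∧
        D' ((1, 0), 0) < 0) ∧ ∀ u : ℝ, |u - c| < r → ρ ((0, u), 0) = 1 := by
    have h1 : ∀ᶠ y in 𝓝 a, fderiv ℝ ρ y ((1, 0), 0) < 0 := by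
      have h2 : ContinuousAt (fun y => fderiv ℝ ρ y ((1, 0), 0)) a :=
        (hρ.continuousAt_fderiv (by simp)).clm_apply continuousAt_const
      exact h2.eventually (gt_mem_nhds hDneg)
    have h3 : ∀ᶠ y in 𝓝 a, HasFDerivAt ρ (fderiv ℝ ρ y) y := by
      have h4 : ContDiffAt ℝ 1 ρ a := hρ.of_le (by simp)
      filter_upwards [h4.eventually (by simp)] with y hy
      exact (hy.differentiableAt (by simp)).hasFDerivAt
    obtain ⟨r₁, hr₁, h5⟩ := Metric.eventually_nhds_iff_ball.1 (h1.and h3)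
    obtain ⟨r₂, hr₂, h6⟩ := Metric.eventually_nhds_iff_ball.1 hρ0
    refine ⟨min r₁ r₂, lt_min hr₁ hr₂, fun y hy => ?_, fun u hu => ?_⟩
    · have := h5 y (Metric.ball_subset_ball (min_le_left _ _) hy)
      exact ⟨_, this.2, this.1⟩
    · exact h6 u (by rw [Metric.mem_ball, Real.dist_eq]; exact hu.trans_le (min_le_right _ _))
  let κ := κ₀.restr (Metric.ball a r)
  have hκs : κ.source = κ₀.source ∩ Metric.ball a r := by
    rw [OpenPartialHomeomorph.restr_source, Metric.isOpen_ball.interior_eq]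
  refine ⟨κ, ?_, fun y => hκ₀ y, ?_, ?_, ?_⟩
  · rw [hκs]; exact ⟨haκ₀, Metric.mem_ball_self hr⟩
  · exact hk
  · exact hk.to_localInverse hkd' (by simp)
  · rintro ⟨⟨u₀, u₁⟩, z⟩ hy hz hρy
    obtain rfl : z = 0 := hz
    rw [hκs] at hy
    have hy2 := hy.2
    simp only [ha, Metric.mem_ball, Prod.dist_eq, Real.dist_eq, sub_zero, dist_self, max_lt_iff]
      at hy2
    by_contra hneg
    simp only [not_le] at hneg
    have hmem : ∀ t ∈ Icc u₀ 0, (((t, u₁), 0) : (ℝ × ℝ) × ℂ) ∈ Metric.ball a r := by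
      intro t ht
      simp only [ha, Metric.mem_ball, Prod.dist_eq, Real.dist_eq, sub_zero, dist_self, max_lt_iff]
      refine ⟨⟨?_, hy2.1.2⟩, hr⟩
      have := hy2.1.1
      rw [abs_of_neg hneg] at this
      rw [abs_of_nonpos ht.2]; linarith [ht.1]
    have hder : ∀ t ∈ Icc u₀ 0, ∃ d < 0, HasDerivAt (fun t : ℝ => ρ ((t, u₁), 0)) d t := by
      intro t ht
      obtain ⟨D', h1, h2⟩ := hrd _ (hmem t ht)
      have h3 : HasDerivAt (fun t : ℝ => (((t, u₁), 0) : (ℝ × ℝ) × ℂ)) ((1, 0), 0) t :=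
        ((hasDerivAt_id t).prodMk (hasDerivAt_const _ _)).prodMk (hasDerivAt_const _ _)
      exact ⟨_, h2, HasFDerivAt.comp_hasDerivAt t h1 h3⟩
    have hanti : StrictAntiOn (fun t : ℝ => ρ ((t, u₁), 0)) (Icc u₀ 0) := by
      refine strictAntiOn_of_deriv_neg (convex_Icc _ _) ?_ ?_
      · intro t ht
        obtain ⟨d, -, hd⟩ := hder t ht
        exact hd.continuousAt.continuousWithinAt
      · intro t ht
        obtain ⟨d, hd0, hd⟩ := hder t (interior_subset ht)
        rw [hd.deriv]; exact hd0
    have h1 := hanti (left_mem_Icc.2 hneg.le) (right_mem_Icc.2 hneg.le) hneg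
    simp only [hru u₁ hy2.1.2] at h1
    linarith

/-- The derivative of an involution of a half-space, with flat coordinates for the boundary `t = 0`
and for the surface `z = 0`, at a fixed point on the boundary, if its fixed points on the boundary
lie on the surface. Along the boundary, this is `fderiv_involution_normal`; and the inward vector
in the surface is mapped to a vector tangent to the surface. -/
theorem fderiv_boundary_involution {s : (ℝ × ℝ) × ℂ → (ℝ × ℝ) × ℂ}
    {A : (ℝ × ℝ) × ℂ →L[ℝ] (ℝ × ℝ) × ℂ} {c : ℝ} (hs : HasStrictFDerivAt s A ((0, c), 0))
    (ha : s ((0, c), 0) = ((0, c), 0))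
    (hbd : ∀ᶠ y in 𝓝 (((0, c), 0) : (ℝ × ℝ) × ℂ), y.1.1 = 0 → (s y).1.1 = 0 ∧ s (s y) = y)
    (hfix : ∀ᶠ y in 𝓝 (((0, c), 0) : (ℝ × ℝ) × ℂ), y.1.1 = 0 → s y = y → y.2 = 0)
    (hsurf : ∀ᶠ y in 𝓝 (((0, c), 0) : (ℝ × ℝ) × ℂ), 0 ≤ y.1.1 → y.2 = 0 → (s y).2 = 0)
    (v : (ℝ × ℝ) × ℂ) : (A v).2 = -v.2 := by
  let J : ℝ × ℂ →L[ℝ] (ℝ × ℝ) × ℂ :=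
    ((0 : ℝ × ℂ →L[ℝ] ℝ).prod (ContinuousLinearMap.fst ℝ ℝ ℂ)).prod
      (ContinuousLinearMap.snd ℝ ℝ ℂ)
  let P : (ℝ × ℝ) × ℂ →L[ℝ] ℝ × ℂ :=
    ((ContinuousLinearMap.snd ℝ ℝ ℝ).comp (ContinuousLinearMap.fst ℝ (ℝ × ℝ) ℂ)).prod
      (ContinuousLinearMap.snd ℝ (ℝ × ℝ) ℂ)
  have hJ : ∀ w, J w = ((0, w.1), w.2) := fun w => rfl
  have hP : ∀ y, P y = (y.1.2, y.2) := fun y => rfl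
  have hJP : ∀ y, y.1.1 = 0 → J (P y) = y := by
    rintro ⟨⟨t, u⟩, z⟩ (rfl : t = 0); rfl
  have hJt : Tendsto J (𝓝 (c, 0)) (𝓝 ((0, c), 0)) := J.continuous.tendsto _
  -- on the boundary
  have h1 : ∀ w, (ContinuousLinearMap.snd ℝ ℝ ℂ) ((P.comp (A.comp J)) w) =
      -(ContinuousLinearMap.snd ℝ ℝ ℂ) w := by
    refine fderiv_involution_normal (s := P ∘ s ∘ J) (a := (c, 0)) ?_ ?_ ?_ ?_
    · exact P.hasStrictFDerivAt.comp _ (HasStrictFDerivAt.comp (c, (0 : ℂ)) hs J.hasStrictFDerivAt)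
    · simp only [Function.comp_apply, hJ, ha, hP]
    · filter_upwards [hJt.eventually hbd] with w hw
      obtain ⟨h1, h2⟩ := hw rfl
      simp only [Function.comp_apply]
      rw [hJP _ h1, h2]; rfl
    · filter_upwards [hJt.eventually hbd, hJt.eventually hfix] with w hw hw' hfw
      obtain ⟨h1, -⟩ := hw rfl
      simp only [Function.comp_apply] at hfw
      refine hw' rfl ?_
      conv_rhs => rw [← hfw]
      exact (hJP _ h1).symm
  -- in the inward direction
  have h2 : (A ((1, 0), 0)).2 = 0 := by
    have h3 : HasDerivAt (fun t : ℝ => (((t, c), 0) : (ℝ × ℝ) × ℂ)) ((1, 0), 0) 0 :=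
      ((hasDerivAt_id (0 : ℝ)).prodMk (hasDerivAt_const _ _)).prodMk (hasDerivAt_const _ _)
    have h4 : HasDerivAt (fun t : ℝ => s ((t, c), 0)) (A ((1, 0), 0)) 0 :=
      HasFDerivAt.comp_hasDerivAt (0 : ℝ) hs.hasFDerivAt h3
    have h5 : HasDerivAt (fun t : ℝ => (s ((t, c), 0)).2) (A ((1, 0), 0)).2 0 :=
      (ContinuousLinearMap.snd ℝ (ℝ × ℝ) ℂ).hasFDerivAt.comp_hasDerivAt (0 : ℝ) h4
    have h6 : HasDerivWithinAt (fun t : ℝ => (s ((t, c), 0)).2) 0 (Ici 0) 0 := by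
      refine (hasDerivWithinAt_const (0 : ℝ) (Ici 0) (0 : ℂ)).congr_of_eventuallyEq ?_ ?_
      · have h7 : Tendsto (fun t : ℝ => (((t, c), 0) : (ℝ × ℝ) × ℂ)) (𝓝[≥] 0)
            (𝓝 ((0, c), 0)) := h3.continuousAt.tendsto.mono_left nhdsWithin_le_nhds
        filter_upwards [h7.eventually hsurf, self_mem_nhdsWithin] with t ht ht0
        exact ht ht0 rfl
      · exact congrArg Prod.snd ha
    exact (uniqueDiffOn_Ici (0 : ℝ) 0 self_mem_Ici).eq_deriv _ h5.hasDerivWithinAt h6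
  obtain ⟨⟨t, u⟩, z⟩ := v
  have h3 : (((t, u), z) : (ℝ × ℝ) × ℂ) = t • ((1, 0), 0) + J (u, z) := by
    rw [hJ]; simp
  have h4 : (A (J (u, z))).2 = -z := h1 (u, z)
  rw [h3, map_add, map_smul, Prod.snd_add, Prod.smul_snd, h2, h4, hJ]
  simp

end Derivatives

/-! ### Adapted charts of the ambient manifold -/

section Charts

section Ambient

variable {X Y M V : Type*} [TopologicalSpace X] [TopologicalSpace Y] [TopologicalSpace M]
  [NormedAddCommGroup V] [NormedSpace ℝ V]

/-- A chart `Θ` of an ambient space `M ⊇ X` in which `X` is `K × ℂ`, with `K` convex, and `S` is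
`K × 0`, restricts to a flat chart of `X`. -/
theorem exists_flatChart_of_ambient {S : Set X} {i : X → M} (hi : IsEmbedding i)
    (Θ : OpenPartialHomeomorph M (V × ℂ)) {K : Set V} (hK : Convex ℝ K)
    (hr : ∀ m ∈ Θ.source, m ∈ range i ↔ (Θ m).1 ∈ K)
    (hS : ∀ x, i x ∈ Θ.source → (x ∈ S ↔ (Θ (i x)).2 = 0)) {x : X} (hx : i x ∈ Θ.source)
    (hxS : x ∈ S) :
    ∃ e : FlatChart S V, x ∈ e.source ∧ (∀ x', e.toPartialEquiv x' = Θ (i x')) ∧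
      (∀ a ∈ e.target, i (e.symm a) = Θ.symm a) ∧ e.target ⊆ Θ.target := by
  have hx2 : (Θ (i x)).2 = 0 := (hS x hx).1 hxS
  obtain ⟨r, hr0, hball⟩ := Metric.isOpen_iff.1 Θ.open_target _ (Θ.map_source hx)
  set b := (Θ (i x)).1 with hb
  have hΘx : Θ (i x) = (b, 0) := Prod.ext rfl hx2
  set T : Set (V × ℂ) := (K ∩ Metric.ball b r) ×ˢ Metric.ball 0 r with hT
  have hTt : T ⊆ Θ.target := by
    rintro ⟨v, z⟩ ⟨hv, hz⟩
    refine hball ?_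
    rw [hΘx, ← ball_prod_same]
    exact ⟨hv.2, hz⟩
  have : Nonempty X := ⟨x⟩
  have hTr : ∀ a ∈ T, i (Function.invFun i (Θ.symm a)) = Θ.symm a := by
    intro a ha
    refine Function.invFun_eq ?_
    have := (hr _ (Θ.map_target (hTt ha))).2 (by rw [Θ.right_inv (hTt ha)]; exact ha.1.1)
    exact this
  let B : Set (V × ℂ) := Metric.ball b r ×ˢ Metric.ball 0 r
  have hBo : IsOpen (Θ.source ∩ Θ ⁻¹' B) :=
    Θ.isOpen_inter_preimage (Metric.isOpen_ball.prod Metric.isOpen_ball)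
  refine ⟨{ toFun := fun x' => Θ (i x')
            invFun := fun a => Function.invFun i (Θ.symm a)
            source := i ⁻¹' (Θ.source ∩ Θ ⁻¹' B)
            target := T
            map_source' := fun x' hx' =>
              ⟨⟨(hr _ hx'.1).1 (mem_range_self x'), hx'.2.1⟩, hx'.2.2⟩
            map_target' := fun a ha => by
              rw [mem_preimage, hTr a ha]
              refine ⟨Θ.map_target (hTt ha), ?_⟩
              rw [mem_preimage, Θ.right_inv (hTt ha)]
              exact ⟨ha.1.2, ha.2⟩
            left_inv' := fun x' hx' => by
              rw [Θ.left_inv hx'.1]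
              exact Function.leftInverse_invFun hi.injective x'
            right_inv' := fun a ha => by
              rw [hTr a ha, Θ.right_inv (hTt ha)]
            base := K ∩ Metric.ball b r
            radius := r
            convex_base := hK.inter (convex_ball b r)
            radius_pos := hr0
            target_eq := rfl
            open_source := hBo.preimage hi.continuous
            continuousOn_toFun :=
              Θ.continuousOn.comp hi.continuous.continuousOn fun x' hx' => hx'.1
            continuousOn_invFun := by
              refine hi.isInducing.continuousOn_iff.2 ?_
              exact (Θ.continuousOn_symm.mono hTt).congr hTr
            mem_iff := fun x' hx' => hS x' hx'.1 }, ⟨hx, ?_⟩, fun _ => rfl, hTr, hTt⟩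
  rw [mem_preimage, hΘx]
  exact ⟨Metric.mem_ball_self hr0, Metric.mem_ball_self hr0⟩

theorem IsTameDoubleCover.exists_lift_lift_ne_of_ambient {p : Y → X} {S : Set X}
    (hp : IsTameDoubleCover p S) {i : X → M} (hi : IsEmbedding i)
    (Θ : OpenPartialHomeomorph M (V × ℂ)) {K : Set V} (hK : Convex ℝ K)
    (hr : ∀ m ∈ Θ.source, m ∈ range i ↔ (Θ m).1 ∈ K)
    (hS : ∀ x, i x ∈ Θ.source → (x ∈ S ↔ (Θ (i x)).2 = 0)) {x : X} (hx : i x ∈ Θ.source)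
    (hxS : x ∈ S) {σ : X → X} (hσc : Continuous σ) (hinv : Function.Involutive σ) (hσx : σ x = x)
    {s : M → M} (hs : ∀ x, i (σ x) = s (i x)) {A : V × ℂ →L[ℝ] V × ℂ}
    (hA : HasFDerivAt (fun a => Θ (s (Θ.symm a))) A (Θ (i x))) (hA2 : ∀ v, (A v).2 = -v.2)
    {g : Y → Y} (hg : Continuous g) (hpg : ∀ y, p (g y) = σ (p y))
    (hswap : ∀ y, g (sheetSwap p y) = sheetSwap p (g y)) : ∃ y, g (g y) ≠ y := by
  obtain ⟨e, hxe, heΘ, hes, het⟩ := exists_flatChart_of_ambient hi Θ hK hr hS hx hxS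
  have hex : e.toPartialEquiv x = ((Θ (i x)).1, 0) := by
    rw [heΘ]; exact Prod.ext rfl ((hS x hx).1 hxS)
  have hsx : e.symm ((Θ (i x)).1, 0) = x := by rw [← hex]; exact e.left_inv hxe
  have hmem := e.map_source hxe
  rw [hex] at hmem
  refine hp.exists_lift_lift_ne e (e.mem_target.1 hmem).1 hσc hinv (by rw [hsx, hσx])
    (A := A) ?_ hA2 hg hpg hswap
  rw [← hex, heΘ]
  refine (hA.hasFDerivWithinAt (s := e.target)).congr' (fun a ha => ?_) ?_
  · rw [heΘ, hs, hes a ha]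
  · rw [← heΘ, hex]; exact hmem

end Ambient

/-! ### Submanifold charts -/

section Submanifold

variable {E₁ H F E M : Type*} [NormedAddCommGroup E₁] [NormedSpace ℝ E₁] [TopologicalSpace H]
  {J : ModelWithCorners ℝ E₁ H} [TopologicalSpace F] [ChartedSpace H F]
  [NormedAddCommGroup E] [NormedSpace ℝ E] [TopologicalSpace M] [ChartedSpace E M]

/-- Being an interior point can be tested in any chart of the maximal atlas, and not only in the
preferred one. -/
theorem isInteriorPoint_iff_of_mem_maximalAtlas [FiniteDimensional ℝ E₁] [IsManifold J ∞ F]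
    {φ : OpenPartialHomeomorph F H}
    (hφ : φ ∈ IsManifold.maximalAtlas J ∞ F) {q : F} (hq : q ∈ φ.source) :
    J.IsInteriorPoint q ↔ φ.extend J q ∈ interior (range J) := by
  let Φ : PartialDiffeomorph J J F H ∞ :=
    { toPartialEquiv := φ.toPartialEquiv
      open_source := φ.open_source
      open_target := φ.open_target
      contMDiffOn_toFun := contMDiffOn_of_mem_maximalAtlas hφ
      contMDiffOn_invFun := contMDiffOn_symm_of_mem_maximalAtlas hφ }
  have h : IsLocalDiffeomorphAt J J ∞ φ q := ⟨Φ, hq, fun _ _ => rfl⟩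
  rw [h.isInteriorPoint_iff (by simp), ModelWithCorners.IsInteriorPoint, extChartAt_self_eq]
  rfl

/-- Around a point of an embedded submanifold `f : F → M` of codimension two, there is a chart of
`M` with values in `E₁ × ℂ`, in which `f` is `u ↦ (u, 0)`, and its image is defined by `z = 0` and
by the inequalities that define the range of the model with corners. -/
theorem exists_submanifold_chart [FiniteDimensional ℝ E₁] [FiniteDimensional ℝ E]
    (hdim : Module.finrank ℝ E = Module.finrank ℝ E₁ + 2) {f : F → M}
    (hf : Manifold.IsSmoothEmbedding J 𝓘(ℝ, E) ∞ f) (q : F) :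
    ∃ (φ : OpenPartialHomeomorph F H) (Θ : OpenPartialHomeomorph M (E₁ × ℂ)),
      φ ∈ IsManifold.maximalAtlas J ∞ F ∧ q ∈ φ.source ∧
      (∀ q', f q' ∈ Θ.source ↔ q' ∈ φ.source) ∧
      (∀ q' ∈ φ.source, Θ (f q') = (φ.extend J q', 0)) ∧
      (∀ m ∈ Θ.source, m ∈ range f ↔ (Θ m).2 = 0 ∧ (Θ m).1 ∈ range J) ∧
      ContMDiffOn 𝓘(ℝ, E) 𝓘(ℝ, E₁ × ℂ) ∞ Θ Θ.source ∧
      ContMDiffOn 𝓘(ℝ, E₁ × ℂ) 𝓘(ℝ, E) ∞ Θ.symm Θ.target := by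
  have h := hf.isImmersion.isImmersionAt q
  set φ := h.domChart with hφ
  have hfin : FiniteDimensional ℝ (E₁ × h.complement) :=
    LinearEquiv.finiteDimensional h.equiv.symm.toLinearEquiv
  have hfin' : FiniteDimensional ℝ h.complement :=
    Module.Finite.of_surjective (LinearMap.snd ℝ E₁ h.complement) LinearMap.snd_surjective
  have hrank : Module.finrank ℝ h.complement = Module.finrank ℝ ℂ := by
    have h1 := h.equiv.toLinearEquiv.finrank_eq
    rw [Module.finrank_prod] at h1
    rw [Complex.finrank_real_complex]; omega
  let c : h.complement ≃L[ℝ] ℂ := ContinuousLinearEquiv.ofFinrankEq hrank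
  let L : E ≃L[ℝ] E₁ × ℂ := h.equiv.symm.trans ((ContinuousLinearEquiv.refl ℝ E₁).prodCongr c)
  let Θ₀ : OpenPartialHomeomorph M (E₁ × ℂ) := h.codChart.transHomeomorph L.toHomeomorph
  have hΘ₀ : ∀ m, Θ₀ m = L (h.codChart m) := fun _ => rfl
  have hΘ₀f : ∀ q' ∈ φ.source, Θ₀ (f q') = (φ.extend J q', 0) := by
    intro q' hq'
    have h1 := h.writtenInCharts ((φ.extend J).map_source (by rwa [φ.extend_source]))
    simp only [Function.comp_apply] at h1
    rw [← hφ, φ.extend_left_inv hq'] at h1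
    have h2 : h.codChart (f q') = h.equiv (φ.extend J q', 0) := h1
    rw [hΘ₀, h2]
    simp [L]
  obtain ⟨O, hO, hOφ⟩ := hf.isEmbedding.isInducing.isOpen_iff.1 φ.open_source
  -- shrink the chart: it should meet the image of `f` only in the image of `φ.source`
  set W : Set M := Θ₀.source ∩ Θ₀ ⁻¹' ((fun a => J.symm a.1) ⁻¹' φ.target) with hW
  have hWo : IsOpen W := Θ₀.isOpen_inter_preimage
    (φ.open_target.preimage (J.continuous_symm.comp continuous_fst))
  let Θ := Θ₀.restr (O ∩ W)
  have hΘs : Θ.source = Θ₀.source ∩ (O ∩ W) := by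
    rw [OpenPartialHomeomorph.restr_source, (hO.inter hWo).interior_eq]
  have hsub : Θ.source ⊆ h.codChart.source := by
    rw [hΘs]; exact inter_subset_left
  have hfs : ∀ q', f q' ∈ Θ.source ↔ q' ∈ φ.source := by
    intro q'
    rw [hΘs]
    refine ⟨fun hq' => by rw [← hOφ]; exact hq'.2.1, fun hq' => ?_⟩
    have h1 : f q' ∈ Θ₀.source := h.source_subset_preimage_source hq'
    refine ⟨h1, by rw [← hOφ] at hq'; exact hq', h1, ?_⟩
    simp only [mem_preimage, hΘ₀f q' hq', OpenPartialHomeomorph.extend_coe, Function.comp_apply,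
      J.left_inv]
    exact φ.map_source hq'
  refine ⟨φ, Θ, h.domChart_mem_maximalAtlas, h.mem_domChart_source, hfs, hΘ₀f, ?_, ?_, ?_⟩
  · intro m hm
    constructor
    · rintro ⟨q', rfl⟩
      have h1 : Θ (f q') = (φ.extend J q', 0) := hΘ₀f q' ((hfs q').1 hm)
      rw [h1]
      exact ⟨rfl, mem_range_self _⟩
    · rintro ⟨h1, h2⟩
      have hm' : J.symm (Θ m).1 ∈ φ.target := by rw [hΘs] at hm; exact hm.2.2.2
      have h3 : φ.symm (J.symm (Θ m).1) ∈ φ.source := φ.map_target hm'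
      refine ⟨φ.symm (J.symm (Θ m).1), Θ.injOn ((hfs _).2 h3) hm ?_⟩
      have h4 : Θ (f (φ.symm (J.symm (Θ m).1))) = (φ.extend J _, 0) := hΘ₀f _ h3
      rw [h4, OpenPartialHomeomorph.extend_coe, Function.comp_apply, φ.right_inv hm',
        J.right_inv h2]
      exact Prod.ext rfl h1.symm
  · have h1 := (contMDiffOn_of_mem_maximalAtlas h.codChart_mem_maximalAtlas).mono hsub
    exact (L.contDiff.contMDiff (n := ∞)).comp_contMDiffOn h1
  · have h1 := contMDiffOn_symm_of_mem_maximalAtlas h.codChart_mem_maximalAtlas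
    refine h1.comp (L.symm.contDiff.contMDiff (n := ∞)).contMDiffOn fun a ha => ?_
    have h2 : a ∈ Θ₀.target := ha.1
    exact h2

end Submanifold

end Charts

/-! ### Lifts near an interior fixed point -/

section FixedPoints

section Interior

variable {E₁ H F E M X Y : Type*} [NormedAddCommGroup E₁] [NormedSpace ℝ E₁] [TopologicalSpace H]
  {J : ModelWithCorners ℝ E₁ H} [TopologicalSpace F] [ChartedSpace H F]
  [NormedAddCommGroup E] [NormedSpace ℝ E] [TopologicalSpace M] [ChartedSpace E M]
  [TopologicalSpace X] [TopologicalSpace Y]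

/-- A lift of `σ` has no trivial square, if `σ` fixes an interior point of the submanifold `f` of
codimension two, and has no fixed points off it. The space `X` may have a boundary elsewhere: it is
a subspace of the manifold `M`, to which `σ` extends smoothly as `s`. -/
theorem IsTameDoubleCover.exists_lift_lift_ne_of_interior [FiniteDimensional ℝ E₁]
    [FiniteDimensional ℝ E] [IsManifold J ∞ F]
    (hdim : Module.finrank ℝ E = Module.finrank ℝ E₁ + 2) {f : F → M}
    (hf : Manifold.IsSmoothEmbedding J 𝓘(ℝ, E) ∞ f) {p : Y → X} {S : Set X}
    (hp : IsTameDoubleCover p S) {i : X → M} (hi : IsEmbedding i)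
    (hfS : ∀ x, i x ∈ range f ↔ x ∈ S) {x : X} (hix : range i ∈ 𝓝 (i x)) {q : F}
    (hq : f q = i x) (hqi : J.IsInteriorPoint q) {σ : X → X} (hσc : Continuous σ)
    (hinv : Function.Involutive σ) (hσx : σ x = x) (hfix : ∀ x, σ x = x → x ∈ S)
    {s : M → M} (hsm : ContMDiff 𝓘(ℝ, E) 𝓘(ℝ, E) ∞ s) (hs : ∀ x, i (σ x) = s (i x))
    {g : Y → Y} (hg : Continuous g) (hpg : ∀ y, p (g y) = σ (p y))
    (hswap : ∀ y, g (sheetSwap p y) = sheetSwap p (g y)) : ∃ y, g (g y) ≠ y := by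
  have : CompleteSpace E₁ := FiniteDimensional.complete ℝ E₁
  obtain ⟨φ, Θ₀, hφ, hqφ, hfs, hΘ₀f, hΘ₀r, hΘ₀s, hΘ₀t⟩ := exists_submanifold_chart hdim hf q
  set W : Set M := (Θ₀.source ∩ Θ₀ ⁻¹' (Prod.fst ⁻¹' interior (range J))) ∩ interior (range i)
    with hW
  have hWo : IsOpen W :=
    (Θ₀.isOpen_inter_preimage (isOpen_interior.preimage continuous_fst)).inter isOpen_interior
  let Θ := Θ₀.restr W
  have hΘs : Θ.source = W := by
    rw [OpenPartialHomeomorph.restr_source, hWo.interior_eq]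
    exact inter_eq_right.2 fun m hm => hm.1.1
  have hΘt : Θ.target ⊆ Θ₀.target := fun a ha => ha.1
  have hxΘ : i x ∈ Θ.source := by
    rw [hΘs, ← hq]
    refine ⟨⟨(hfs q).2 hqφ, ?_⟩, ?_⟩
    · rw [mem_preimage, hΘ₀f q hqφ]
      exact (isInteriorPoint_iff_of_mem_maximalAtlas hφ hqφ).1 hqi
    · rw [hq]; exact mem_interior_iff_mem_nhds.2 hix
  have hri : ∀ m ∈ Θ.source, ∃ x', i x' = m := fun m hm => by
    rw [hΘs] at hm
    have h1 : m ∈ range i := interior_subset hm.2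
    exact h1
  have hΘS : ∀ x', i x' ∈ Θ.source → (x' ∈ S ↔ (Θ (i x')).2 = 0) := by
    intro x' hx'
    rw [hΘs] at hx'
    rw [← hfS, hΘ₀r _ hx'.1.1]
    exact ⟨fun h => h.1, fun h => ⟨h, interior_subset hx'.1.2⟩⟩
  have hxS : x ∈ S := hfix x hσx
  set a₀ := Θ (i x) with ha₀
  have ha₀t : a₀ ∈ Θ.target := Θ.map_source hxΘ
  have hsx : s (i x) = i x := by rw [← hs, hσx]
  have hsymm : Θ.symm a₀ = i x := Θ.left_inv hxΘ
  have hstrict : ContDiffAt ℝ ∞ (fun a => Θ (s (Θ.symm a))) a₀ := by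
    rw [← contMDiffAt_iff_contDiffAt]
    have h1 : ContMDiffAt 𝓘(ℝ, E₁ × ℂ) 𝓘(ℝ, E) ∞ Θ.symm a₀ :=
      (hΘ₀t.mono hΘt).contMDiffAt (Θ.open_target.mem_nhds ha₀t)
    have h2 : ContMDiffAt 𝓘(ℝ, E₁ × ℂ) 𝓘(ℝ, E) ∞ (s ∘ Θ.symm) a₀ :=
      (hsm _).comp a₀ h1
    have h3 : ContMDiffAt 𝓘(ℝ, E) 𝓘(ℝ, E₁ × ℂ) ∞ Θ ((s ∘ Θ.symm) a₀) := by
      rw [Function.comp_apply, hsymm, hsx]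
      refine hΘ₀s.contMDiffAt (Θ₀.open_source.mem_nhds ?_)
      rw [hΘs] at hxΘ; exact hxΘ.1.1
    exact h3.comp a₀ h2
  have hstr := hstrict.hasStrictFDerivAt (by simp)
  have hnear : ∀ᶠ a in 𝓝 a₀, a ∈ Θ.target ∧ s (Θ.symm a) ∈ Θ.source := by
    refine (Θ.open_target.eventually_mem ha₀t).and ?_
    have h1 : ContinuousAt (fun a => s (Θ.symm a)) a₀ :=
      hsm.continuous.continuousAt.comp (Θ.symm.continuousAt ha₀t)
    refine h1.eventually (Θ.open_source.mem_nhds ?_)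
    beta_reduce; rw [hsymm, hsx]; exact hxΘ
  have hA2 := fderiv_involution_normal (ℓ := ContinuousLinearMap.snd ℝ E₁ ℂ) hstr
    (by rw [hsymm, hsx]) ?_ ?_
  · exact hp.exists_lift_lift_ne_of_ambient hi Θ convex_univ
      (fun m hm => ⟨fun _ => mem_univ _, fun _ => hri m hm⟩) hΘS hxΘ hxS hσc hinv hσx hs
      hstr.hasFDerivAt hA2 hg hpg hswap
  · filter_upwards [hnear] with a ha
    obtain ⟨x', hx'⟩ := hri _ (Θ.map_target ha.1)
    rw [Θ.left_inv ha.2, ← hx', ← hs, ← hs, hinv, hx', Θ.right_inv ha.1]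
  · filter_upwards [hnear] with a ha hsa
    obtain ⟨x', hx'⟩ := hri _ (Θ.map_target ha.1)
    have h1 : s (Θ.symm a) = Θ.symm a := by
      rw [← Θ.left_inv ha.2, hsa]
    rw [← hx', ← hs] at h1
    have h2 := (hΘS x' (by rw [hx']; exact Θ.map_target ha.1)).1 (hfix x' (hi.injective h1))
    rw [hx', Θ.right_inv ha.1] at h2
    exact h2.trans ((hΘS x hxΘ).1 hxS).symm

end Interior

/-! ### Lifts near a fixed point on the boundary of the ball -/

noncomputable def planeCoordinates : EuclideanSpace ℝ (Fin 2) ≃L[ℝ] ℝ × ℝ :=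
  (EuclideanSpace.equiv (Fin 2) ℝ).trans (ContinuousLinearEquiv.finTwoArrow ℝ ℝ)

theorem planeCoordinates_apply (u : EuclideanSpace ℝ (Fin 2)) :
    planeCoordinates u = (u 0, u 1) := rfl

section Boundary

variable {F : Type*} [TopologicalSpace F] [ChartedSpace (EuclideanHalfSpace 2) F]
  [IsManifold (𝓡∂ 2) ∞ F] {f : F → B4} {K : Set S3}

/-- At a boundary point of a properly embedded surface in `B⁴`, there are coordinates `((t, u), z)`
of `ℝ⁴` in which the ball is `0 ≤ t` and the surface is `z = 0` in the ball. -/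
theorem IsProperSmoothEmbedding.exists_boundary_chart (hf : IsProperSmoothEmbedding f K) {q : F}
    (hq : (𝓡∂ 2).IsBoundaryPoint q) :
    ∃ (Θ : OpenPartialHomeomorph (EuclideanSpace ℝ (Fin 4)) ((ℝ × ℝ) × ℂ)) (c : ℝ),
      (f q : EuclideanSpace ℝ (Fin 4)) ∈ Θ.source ∧
      Θ (f q : EuclideanSpace ℝ (Fin 4)) = ((0, c), 0) ∧
      (∀ m ∈ Θ.source, (Θ m).1.1 = 1 - ‖m‖ ^ 2) ∧
      (∀ x : B4, (x : EuclideanSpace ℝ (Fin 4)) ∈ Θ.source →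
        (x ∈ range f ↔ (Θ (x : EuclideanSpace ℝ (Fin 4))).2 = 0)) ∧
      ContDiffAt ℝ ∞ Θ (f q : EuclideanSpace ℝ (Fin 4)) ∧
      ContDiffAt ℝ ∞ Θ.symm ((0, c), 0) := by
  obtain ⟨φ, Θ₀, hφ, hqφ, hfs, hΘ₀f, hΘ₀r, hΘ₀s, hΘ₀t⟩ :=
    exists_submanifold_chart (by simp) hf.embedding q
  let P : (EuclideanSpace ℝ (Fin 2) × ℂ) ≃L[ℝ] (ℝ × ℝ) × ℂ :=
    planeCoordinates.prodCongr (ContinuousLinearEquiv.refl ℝ ℂ)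
  let Φ : OpenPartialHomeomorph (EuclideanSpace ℝ (Fin 4)) ((ℝ × ℝ) × ℂ) :=
    Θ₀.transHomeomorph P.toHomeomorph
  have hΦ : ∀ m, Φ m = (((Θ₀ m).1 0, (Θ₀ m).1 1), (Θ₀ m).2) := fun m => rfl
  -- boundary points in coordinates
  have hbd : ∀ q' ∈ φ.source, 0 ≤ (φ.extend (𝓡∂ 2) q') 0 ∧
      (‖(f q' : EuclideanSpace ℝ (Fin 4))‖ = 1 ↔ (φ.extend (𝓡∂ 2) q') 0 = 0) := by
    intro q' hq'
    have h0 : φ.extend (𝓡∂ 2) q' ∈ range (𝓡∂ 2) := mem_range_self _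
    rw [range_modelWithCornersEuclideanHalfSpace] at h0
    have h1 := isInteriorPoint_iff_of_mem_maximalAtlas hφ hq'
    rw [interior_range_modelWithCornersEuclideanHalfSpace] at h1
    have h0' : 0 ≤ (φ.extend (𝓡∂ 2) q') 0 := h0
    refine ⟨h0', ?_⟩
    rw [hf.proper]
    show (𝓡∂ 2).IsBoundaryPoint q' ↔ _
    rw [ModelWithCorners.isBoundaryPoint_iff_not_isInteriorPoint, h1]
    show ¬ (0 < (φ.extend (𝓡∂ 2) q') 0) ↔ _
    exact ⟨fun h => le_antisymm (not_lt.1 h) h0', fun h => by rw [h]; exact lt_irrefl _⟩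
  set c := (φ.extend (𝓡∂ 2) q) 1 with hc
  have hΦf : ∀ q' ∈ φ.source, Φ (f q' : EuclideanSpace ℝ (Fin 4)) =
      (planeCoordinates (φ.extend (𝓡∂ 2) q'), 0) := by
    intro q' hq'
    rw [hΦ]
    rw [show Θ₀ (f q' : EuclideanSpace ℝ (Fin 4)) = _ from hΘ₀f q' hq']
    rfl
  have hΦq : Φ (f q : EuclideanSpace ℝ (Fin 4)) = ((0, c), 0) := by
    rw [hΦf q hqφ, planeCoordinates_apply, (hbd q hqφ).2.1 ((hf.proper q).2 hq)]
  set a : (ℝ × ℝ) × ℂ := ((0, c), 0) with ha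
  have hqΦ : (f q : EuclideanSpace ℝ (Fin 4)) ∈ Φ.source := (hfs q).2 hqφ
  have haΦ : a ∈ Φ.target := by rw [← hΦq]; exact Φ.map_source hqΦ
  have hΦsmooth : ContDiffAt ℝ ∞ Φ (f q : EuclideanSpace ℝ (Fin 4)) := by
    have h1 := contMDiffAt_iff_contDiffAt.1 (hΘ₀s.contMDiffAt (Θ₀.open_source.mem_nhds hqΦ))
    exact P.contDiff.contDiffAt.comp _ h1
  have hΦsymm : ContDiffAt ℝ ∞ Φ.symm a := by
    have h1 := contMDiffAt_iff_contDiffAt.1 (hΘ₀t.contMDiffAt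
      (Θ₀.open_target.mem_nhds (show P.symm a ∈ Θ₀.target from haΦ)))
    exact h1.comp a P.symm.contDiff.contDiffAt
  -- the surface in coordinates
  have hsurf : ∀ t u : ℝ, ((t, u), 0) ∈ Φ.target → 0 ≤ t →
      ∃ q' ∈ φ.source, (f q' : EuclideanSpace ℝ (Fin 4)) = Φ.symm ((t, u), 0) ∧
        (φ.extend (𝓡∂ 2) q') 0 = t := by
    intro t u htu ht
    have h1 := Φ.map_target htu
    have h2 := Φ.right_inv htu
    obtain ⟨q', hq'⟩ := (hΘ₀r _ h1).2 (by
      rw [hΦ] at h2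
      refine ⟨congrArg Prod.snd h2, ?_⟩
      rw [range_modelWithCornersEuclideanHalfSpace]
      show 0 ≤ (Θ₀ _).1 0
      rw [show (Θ₀ (Φ.symm ((t, u), 0))).1 0 = t from congrArg (fun z => z.1.1) h2]
      exact ht)
    have hq'' : (f q' : EuclideanSpace ℝ (Fin 4)) = Φ.symm ((t, u), 0) := hq'
    have hq's : q' ∈ φ.source := (hfs q').1 (by rw [hq'']; exact h1)
    refine ⟨q', hq's, hq', ?_⟩
    have h3 := hΦf q' hq's
    rw [hq'', h2] at h3
    exact (congrArg (fun z => z.1.1) h3).symm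
  let ρ : (ℝ × ℝ) × ℂ → ℝ := fun y => ‖Φ.symm y‖ ^ 2
  have hρ : ContDiffAt ℝ ∞ ρ a := hΦsymm.norm_sq ℝ
  have hline : ContinuousAt (fun u : ℝ => (((0, u), 0) : (ℝ × ℝ) × ℂ)) c := by fun_prop
  have hline' : ContinuousAt (fun t : ℝ => (((t, c), 0) : (ℝ × ℝ) × ℂ)) 0 := by fun_prop
  have hρ0 : ∀ᶠ u : ℝ in 𝓝 c, ρ ((0, u), 0) = 1 := by
    filter_upwards [hline.eventually (Φ.open_target.mem_nhds haΦ)] with u hu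
    obtain ⟨q', hq', h1, h2⟩ := hsurf 0 u hu le_rfl
    show ‖Φ.symm ((0, u), 0)‖ ^ 2 = 1
    rw [← h1, (hbd q' hq').2.2 h2, one_pow]
  have hρ1 : ∀ᶠ t : ℝ in 𝓝[>] 0, ρ ((t, c), 0) ≤ 1 := by
    filter_upwards [(hline'.eventually (Φ.open_target.mem_nhds haΦ)).filter_mono
      nhdsWithin_le_nhds, self_mem_nhdsWithin] with t ht ht0
    obtain ⟨q', hq', h1, h2⟩ := hsurf t c ht (le_of_lt ht0)
    show ‖Φ.symm ((t, c), 0)‖ ^ 2 ≤ 1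
    rw [← h1]
    have h3 : ‖(f q' : EuclideanSpace ℝ (Fin 4))‖ ≤ 1 :=
      mem_closedBall_zero_iff.1 (f q').2
    exact pow_le_one₀ (norm_nonneg _) h3
  have hρd : HasFDerivAt ρ (fderiv ℝ ρ a) a := (hρ.differentiableAt (by simp)).hasFDerivAt
  have hd : fderiv ℝ ρ a ((1, 0), 0) ≠ 0 := by
    intro hd0
    -- `ρ` is constant along the boundary curve, so its derivative would vanish along the surface
    have hd1 : fderiv ℝ ρ a ((0, 1), 0) = 0 := by
      have h1 : HasDerivAt (fun u : ℝ => (((0, u), 0) : (ℝ × ℝ) × ℂ)) ((0, 1), 0) c :=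
        ((hasDerivAt_const c (0 : ℝ)).prodMk (hasDerivAt_id c)).prodMk (hasDerivAt_const _ _)
      have h2 : HasDerivAt (fun u : ℝ => ρ ((0, u), 0)) (fderiv ℝ ρ a ((0, 1), 0)) c :=
        HasFDerivAt.comp_hasDerivAt (f := fun u : ℝ => (((0, u), 0) : (ℝ × ℝ) × ℂ)) c hρd h1
      exact h2.unique ((hasDerivAt_const c (1 : ℝ)).congr_of_eventuallyEq hρ0)
    refine hf.transverse q hq ?_
    let j : EuclideanSpace ℝ (Fin 2) →L[ℝ] (ℝ × ℝ) × ℂ :=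
      (planeCoordinates : EuclideanSpace ℝ (Fin 2) →L[ℝ] ℝ × ℝ).prod 0
    have hja : j (φ.extend (𝓡∂ 2) q) = a := by
      rw [← hΦq, hΦf q hqφ]; rfl
    have h1 : HasFDerivAt (ρ ∘ j) (0 : EuclideanSpace ℝ (Fin 2) →L[ℝ] ℝ)
        (φ.extend (𝓡∂ 2) q) := by
      have h2 : HasFDerivAt (ρ ∘ j) ((fderiv ℝ ρ a).comp j) (φ.extend (𝓡∂ 2) q) :=
        HasFDerivAt.comp _ (by rw [hja]; exact hρd) j.hasFDerivAt
      refine h2.congr_fderiv (ContinuousLinearMap.ext fun w => ?_)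
      have h3 : j w = (w 0) • (((1, 0), 0) : (ℝ × ℝ) × ℂ) + (w 1) • ((0, 1), 0) := by
        show (((w 0, w 1), 0) : (ℝ × ℝ) × ℂ) = _
        simp
      rw [ContinuousLinearMap.comp_apply, h3, map_add, map_smul, map_smul, hd0, hd1]
      simp
    have h2 : MDifferentiableAt (𝓡∂ 2) 𝓘(ℝ, EuclideanSpace ℝ (Fin 2)) (φ.extend (𝓡∂ 2)) q :=
      (OpenPartialHomeomorph.contMDiffAt_extend hφ hqφ).mdifferentiableAt (by simp)
    have h3 := HasMFDerivAt.comp q h1.hasMFDerivAt h2.hasMFDerivAt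
    have h4 : HasMFDerivAt (𝓡∂ 2) 𝓘(ℝ, ℝ) (fun y => ‖(f y : EuclideanSpace ℝ (Fin 4))‖ ^ 2) q
        _ := h3.congr_of_eventuallyEq (by
      filter_upwards [φ.open_source.mem_nhds hqφ] with q' hq'
      show _ = ‖Φ.symm (j (φ.extend (𝓡∂ 2) q'))‖ ^ 2
      rw [show j (φ.extend (𝓡∂ 2) q') = Φ (f q' : EuclideanSpace ℝ (Fin 4)) from (hΦf q' hq').symm,
        Φ.left_inv ((hfs q').2 hq')])
    rw [h4.mfderiv]
    exact ContinuousLinearMap.zero_comp _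
  obtain ⟨κ, haκ, hκ, hκsm, hκsymm, hκpos⟩ :=
    exists_boundary_straightening hρ hρ0 hρ1 hd
  have hρΦ : ∀ m ∈ Φ.source, ρ (Φ m) = ‖m‖ ^ 2 := fun m hm => by
    show ‖Φ.symm (Φ m)‖ ^ 2 = _
    rw [Φ.left_inv hm]
  have hκa : κ a = a := by
    rw [hκ, show ρ a = 1 from hρ0.self_of_nhds]
    simp [ha]
  have hs : ∀ m, m ∈ (Φ.trans κ).source ↔ m ∈ Φ.source ∧ Φ m ∈ κ.source := fun m => by
    rw [OpenPartialHomeomorph.trans_source]; rfl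
  have hcoe : ∀ m, (Φ.trans κ) m = κ (Φ m) := fun m => rfl
  refine ⟨Φ.trans κ, c, ?_, ?_, ?_, ?_, ?_, ?_⟩
  · rw [hs, hΦq]; exact ⟨hqΦ, haκ⟩
  · rw [hcoe, hΦq, hκa]
  · intro m hm
    rw [hcoe, hκ, hρΦ m ((hs m).1 hm).1]
  · intro x hx
    have hxΦ := ((hs _).1 hx).1
    have h1 : x ∈ range f ↔ (x : EuclideanSpace ℝ (Fin 4)) ∈
        range (fun q' => (f q' : EuclideanSpace ℝ (Fin 4))) := by
      simp only [mem_range, Subtype.coe_inj]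
    rw [h1, hΘ₀r _ hxΦ, hcoe, hκ]
    refine ⟨fun h => h.1, fun h => ⟨h, ?_⟩⟩
    rw [range_modelWithCornersEuclideanHalfSpace]
    refine hκpos _ ((hs _).1 hx).2 h ?_
    rw [hρΦ _ hxΦ]
    have h3 : ‖(x : EuclideanSpace ℝ (Fin 4))‖ ≤ 1 := mem_closedBall_zero_iff.1 x.2
    exact pow_le_one₀ (norm_nonneg _) h3
  · refine ContDiffAt.comp (g := κ) (f := Φ) _ ?_ hΦsmooth
    rw [hΦq]; exact hκsm
  · have h1 : ContDiffAt ℝ ∞ κ.symm a := by rw [hκa] at hκsymm; exact hκsymm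
    refine ContDiffAt.comp (g := Φ.symm) (f := κ.symm) a ?_ h1
    have h2 : κ.symm a = a := by
      conv_lhs => rw [← hκa]
      exact κ.left_inv haκ
    rw [h2]; exact hΦsymm

/-- The case of a fixed point on the boundary of the ball. Only the fixed points on the boundary
sphere are required to lie on the surface. -/
theorem IsProperSmoothEmbedding.exists_lift_lift_ne_of_boundary
    (hf : IsProperSmoothEmbedding f K) {Y : Type*} [TopologicalSpace Y] {p : Y → B4}
    (hp : IsTameDoubleCover p (range f)) {σ : B4 → B4} (hσ : Continuous σ)
    (hinv : Function.Involutive σ) (hrange : ∀ x, σ x ∈ range f ↔ x ∈ range f)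
    {s : EuclideanSpace ℝ (Fin 4) → EuclideanSpace ℝ (Fin 4)} (hsm : ContDiff ℝ ∞ s)
    (hs : ∀ x : B4, (σ x : EuclideanSpace ℝ (Fin 4)) = s x)
    (hσbd : ∀ x : B4, ‖(x : EuclideanSpace ℝ (Fin 4))‖ = 1 →
      ‖(σ x : EuclideanSpace ℝ (Fin 4))‖ = 1)
    (hfix : ∀ x : B4, ‖(x : EuclideanSpace ℝ (Fin 4))‖ = 1 → σ x = x → x ∈ range f)
    {q : F} (hq : ‖(f q : EuclideanSpace ℝ (Fin 4))‖ = 1) (hσq : σ (f q) = f q)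
    {g : Y → Y} (hg : Continuous g) (hpg : ∀ y, p (g y) = σ (p y))
    (hswap : ∀ y, g (sheetSwap p y) = sheetSwap p (g y)) : ∃ y, g (g y) ≠ y := by
  obtain ⟨Θ, c, hqΘ, hΘq, hΘb, hΘr, hΘsm, hΘsymm⟩ :=
    hf.exists_boundary_chart (q := q) ((hf.proper q).1 hq)
  set a : (ℝ × ℝ) × ℂ := ((0, c), 0) with ha
  have haΘ : a ∈ Θ.target := by rw [← hΘq]; exact Θ.map_source hqΘ
  have hsa : Θ.symm a = (f q : EuclideanSpace ℝ (Fin 4)) := by rw [← hΘq]; exact Θ.left_inv hqΘ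
  have hsq : s (f q : EuclideanSpace ℝ (Fin 4)) = f q := by rw [← hs, hσq]
  have hstrict : ContDiffAt ℝ ∞ (fun y => Θ (s (Θ.symm y))) a := by
    refine ContDiffAt.comp a (g := Θ) (f := fun y => s (Θ.symm y)) ?_
      (hsm.contDiffAt.comp a hΘsymm)
    rw [hsa, hsq]; exact hΘsm
  have hstr := hstrict.hasStrictFDerivAt (by simp)
  have hnear : ∀ᶠ y in 𝓝 a, y ∈ Θ.target ∧ s (Θ.symm y) ∈ Θ.source := by
    refine (Θ.open_target.eventually_mem haΘ).and ?_
    have h1 : ContinuousAt (fun y => s (Θ.symm y)) a :=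
      hsm.continuous.continuousAt.comp (Θ.symm.continuousAt haΘ)
    refine h1.eventually (Θ.open_source.mem_nhds ?_)
    beta_reduce; rw [hsa, hsq]; exact hqΘ
  -- points of the half-space are points of the ball
  have hball : ∀ y ∈ Θ.target, 0 ≤ y.1.1 → ∃ x : B4, (x : EuclideanSpace ℝ (Fin 4)) = Θ.symm y ∧
      (y.1.1 = 0 → ‖(x : EuclideanSpace ℝ (Fin 4))‖ = 1) := by
    intro y hy hy0
    have h1 := hΘb _ (Θ.map_target hy)
    rw [Θ.right_inv hy] at h1
    have h2 := norm_nonneg (Θ.symm y)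
    refine ⟨⟨Θ.symm y, by rw [mem_closedBall_zero_iff]; nlinarith⟩, rfl, fun h => ?_⟩
    show ‖Θ.symm y‖ = 1
    nlinarith
  have hA2 := fderiv_boundary_involution hstr (by rw [hsa, hsq, hΘq]) ?_ ?_ ?_
  · have hrK : ∀ m ∈ Θ.source, m ∈ range (Subtype.val : B4 → EuclideanSpace ℝ (Fin 4)) ↔
        (Θ m).1 ∈ {t : ℝ × ℝ | 0 ≤ t.1} := by
      intro m hm
      rw [Subtype.range_coe, mem_closedBall_zero_iff]
      show _ ↔ 0 ≤ (Θ m).1.1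
      rw [hΘb m hm, sub_nonneg, sq_le_one_iff₀ (norm_nonneg m)]
    have hconv : Convex ℝ {t : ℝ × ℝ | 0 ≤ t.1} :=
      convex_halfSpace_ge (LinearMap.fst ℝ ℝ ℝ).isLinear 0
    exact hp.exists_lift_lift_ne_of_ambient IsEmbedding.subtypeVal Θ hconv hrK hΘr hqΘ
      (mem_range_self q) hσ hinv hσq hs (by rw [hΘq]; exact hstr.hasFDerivAt) hA2 hg hpg hswap
  · filter_upwards [hnear] with y hy hy0
    obtain ⟨x, hx, hx1⟩ := hball y hy.1 hy0.ge
    refine ⟨?_, ?_⟩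
    · rw [hΘb _ hy.2, ← hx, ← hs, hσbd x (hx1 hy0)]; norm_num
    · rw [Θ.left_inv hy.2, ← hx, ← hs, ← hs, hinv, hx, Θ.right_inv hy.1]
  · filter_upwards [hnear] with y hy hy0 hsy
    obtain ⟨x, hx, hx1⟩ := hball y hy.1 hy0.ge
    have h1 : s (Θ.symm y) = Θ.symm y := by
      rw [← Θ.left_inv hy.2, hsy]
    rw [← hx, ← hs] at h1
    have h2 := (hΘr x (by rw [hx]; exact Θ.map_target hy.1)).1
      (hfix x (hx1 hy0) (Subtype.val_injective h1))
    rwa [hx, Θ.right_inv hy.1] at h2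
  · filter_upwards [hnear] with y hy hy0 hyz
    obtain ⟨x, hx, -⟩ := hball y hy.1 hy0
    have h1 : x ∈ range f := by
      rw [hΘr x (by rw [hx]; exact Θ.map_target hy.1), hx, Θ.right_inv hy.1]; exact hyz
    have h2 := hy.2
    rw [← hx, ← hs] at h2 ⊢
    exact (hΘr _ h2).1 ((hrange x).2 h1)

end Boundary

end FixedPoints

/-! ### From local to global isomorphisms -/

section Assembly

section Global

variable {X Y Y₁ Y₂ V : Type*} [TopologicalSpace X] [TopologicalSpace Y] [TopologicalSpace Y₁]
  [TopologicalSpace Y₂] [NormedAddCommGroup V] [NormedSpace ℝ V]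

theorem IsInvolutionOfPair.mem_iff {X : Type*} {σ : X → X} {S : Set X}
    (hσ : IsInvolutionOfPair σ S) (x : X) : σ x ∈ S ↔ x ∈ S := by
  constructor
  · intro h
    rw [← hσ.involutive x, ← hσ.preserves]
    exact mem_image_of_mem σ h
  · intro h
    rw [← hσ.preserves]
    exact mem_image_of_mem σ h

theorem IsTameDoubleCover.sheetSwap_homeomorph_comp {p : Y → X} {S : Set X}
    (hp : IsTameDoubleCover p S) (h : X ≃ₜ X) (hS : ∀ x, h x ∈ S ↔ x ∈ S) (y : Y) :
    sheetSwap (h ∘ p) y = sheetSwap p y := by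
  have hhp := hp.homeomorph_comp h hS
  by_cases hy : p y ∈ S
  · rw [hp.sheetSwap_of_mem hy, hhp.sheetSwap_of_mem ((hS _).2 hy)]
  · refine (hp.eq_or_eq_sheetSwap (h.injective (map_sheetSwap (h ∘ p) y))).resolve_left ?_
    exact hhp.sheetSwap_ne (fun h' => hy ((hS _).1 h'))

theorem exists_sheetIso_of_homeomorph {p₁ : Y₁ → X} {p₂ : Y₂ → X} {S U : Set X}
    (hp₁ : IsTameDoubleCover p₁ S) (hp₂ : IsTameDoubleCover p₂ S) (hU : IsOpen U) {Z : Type*}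
    [TopologicalSpace Z] [ContractibleSpace Z] [LocallyPathConnectedSpace Z] (h : U ≃ₜ Z)
    (hloc : ∀ x, ∃ W g, IsOpen W ∧ x ∈ W ∧ IsSheetIso p₁ p₂ W g) :
    ∃ g, IsSheetIso p₁ p₂ U g := by
  have : SimplyConnectedSpace U := h.toHomotopyEquiv.simplyConnectedSpace
  have : LocallyPathConnectedSpace U := h.isOpenEmbedding.locallyPathConnectedSpace
  exact exists_sheetIso_of_simplyConnected hp₁ hp₂ hU fun x _ => hloc x

/-- A sphere of dimension at least two is the union of two contractible sets, the complements of
antipodal points, whose intersection is connected. -/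
theorem exists_sheetIso_sphere {E : Type*} [NormedAddCommGroup E] [InnerProductSpace ℝ E] {n : ℕ}
    [Fact (Module.finrank ℝ E = n + 1)] (hn : 2 ≤ n) {p₁ : Y₁ → Metric.sphere (0 : E) 1}
    {p₂ : Y₂ → Metric.sphere (0 : E) 1} {S : Set (Metric.sphere (0 : E) 1)}
    (hp₁ : IsTameDoubleCover p₁ S) (hp₂ : IsTameDoubleCover p₂ S)
    (hloc : ∀ x, ∃ W g, IsOpen W ∧ x ∈ W ∧ IsSheetIso p₁ p₂ W g) :
    ∃ g, IsSheetIso p₁ p₂ univ g := by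
  by_cases hne : Nonempty (Metric.sphere (0 : E) 1)
  · obtain ⟨v⟩ := hne
    have key : ∀ w : Metric.sphere (0 : E) 1, ∃ g, IsSheetIso p₁ p₂ {w}ᶜ g := by
      intro w
      have h := (stereographic' n w).toHomeomorphSourceTarget
      rw [stereographic'_source, stereographic'_target] at h
      exact exists_sheetIso_of_homeomorph hp₁ hp₂ isOpen_compl_singleton
        (h.trans (Homeomorph.Set.univ _)) hloc
    obtain ⟨g₁, hg₁⟩ := key v
    obtain ⟨g₂, hg₂⟩ := key (-v)
    have hv : v ≠ -v := ne_neg_of_mem_unit_sphere ℝ v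
    have hinter : IsPreconnected (({v}ᶜ : Set (Metric.sphere (0 : E) 1)) ∩ {-v}ᶜ) := by
      set e := stereographic' n v with he
      have hes : e.source = {v}ᶜ := stereographic'_source v
      have het : e.target = univ := stereographic'_target v
      have hvs : -v ∈ e.source := by rw [hes]; exact hv.symm
      have h1 : ({v}ᶜ : Set (Metric.sphere (0 : E) 1)) ∩ {-v}ᶜ = e.symm '' {e (-v)}ᶜ := by
        ext x
        constructor
        · rintro ⟨hx, hx'⟩
          rw [← hes] at hx
          exact ⟨e x, fun h => hx' (e.injOn hx hvs h), e.left_inv hx⟩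
        · rintro ⟨z, hz, rfl⟩
          have hzt : z ∈ e.target := by rw [het]; exact mem_univ z
          refine ⟨by rw [← hes]; exact e.map_target hzt, fun h => hz ?_⟩
          rw [mem_singleton_iff] at h ⊢
          rw [← h, e.right_inv hzt]
      rw [h1]
      refine IsPreconnected.image ?_ _ (e.continuousOn_symm.mono (by rw [het]; exact subset_univ _))
      refine (isConnected_compl_singleton_of_one_lt_rank ?_ _).isPreconnected
      rw [← Module.finrank_eq_rank, finrank_euclideanSpace_fin]
      exact_mod_cast hn
    obtain ⟨g, hg⟩ := IsSheetIso.exists_union hp₁ hp₂ isOpen_compl_singleton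
      isOpen_compl_singleton hinter hg₁ hg₂
    refine ⟨g, hg.mono fun x _ => ?_⟩
    by_cases hx : x = v
    · exact Or.inr (by rw [hx]; exact hv)
    · exact Or.inl hx
  · have hU : (univ : Set (Metric.sphere (0 : E) 1)) = ∅ := by
      rw [univ_eq_empty_iff]; exact not_nonempty_iff.1 hne
    have : IsEmpty Y₁ := ⟨fun y => hne ⟨p₁ y⟩⟩
    exact ⟨fun y => isEmptyElim y, fun y => isEmptyElim y, fun y => isEmptyElim y,
      fun y => isEmptyElim y⟩

/-- The purely topological part of the theorem. The lifts are isomorphisms from `p` to the double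
cover `σ ∘ p`, so that they exist if local isomorphisms can be glued; they have order four as soon
as no lift is an involution. -/
theorem IsDoubleBranchedCover.hasExactlyTwoLiftsOfOrderFour [PreconnectedSpace X] {B : Type*}
    [TopologicalSpace B] {p : Y → X} {S : Set X} (hp : IsDoubleBranchedCover B p S)
    (hS : IsClosed S) (hne : S.Nonempty) {ι : B → V} (hι : IsEmbedding ι)
    (hconv : Convex ℝ (range ι)) {σ : X → X} (hσc : Continuous σ) (hσ : IsInvolutionOfPair σ S)
    (hglue : IsTameDoubleCover p S → IsTameDoubleCover (σ ∘ p) S →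
      (∀ x, ∃ W g, IsOpen W ∧ x ∈ W ∧ IsSheetIso p (σ ∘ p) W g) →
      ∃ g, IsSheetIso p (σ ∘ p) univ g)
    (hsq : IsTameDoubleCover p S → ∀ g : Y → Y, Continuous g → (∀ y, p (g y) = σ (p y)) →
      (∀ y, g (sheetSwap p y) = sheetSwap p (g y)) → ∃ y, g (g y) ≠ y) :
    HasExactlyTwoLiftsOfOrderFour p σ := by
  have hp₁ := hp.isTameDoubleCover hS hι hconv
  let h : X ≃ₜ X := ⟨hσ.involutive.toPerm, hσc, hσc⟩
  have hp₂ : IsTameDoubleCover (σ ∘ p) S := hp₁.homeomorph_comp h hσ.mem_iff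
  obtain ⟨g, hg⟩ := hglue hp₁ hp₂ fun x => by
    by_cases hx : x ∈ S
    · exact exists_sheetIso_of_mem hp hp₁ hp₂ hι hconv hx
    · exact exists_sheetIso_of_notMem hp₁ hp₂ hx
  have hgc : Continuous g := by
    have := hg.continuousOn
    rwa [preimage_univ, continuousOn_univ] at this
  have hpg : ∀ y, p (g y) = σ (p y) := fun y => by
    have := hg.map y (mem_univ _)
    rw [← this]; exact (hσ.involutive _).symm
  have hswap : ∀ y, g (sheetSwap p y) = sheetSwap p (g y) := fun y =>
    (hg.swap y (mem_univ _)).trans (hp₁.sheetSwap_homeomorph_comp h hσ.mem_iff (g y))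
  obtain ⟨y₀, hy₀⟩ := hsq hp₁ g hgc hpg hswap
  exact hp₁.hasExactlyTwoLiftsOfOrderFour hne hσ.involutive hσ.mem_iff hgc hpg hswap hy₀

end Global

/-! ### Spheres and the ball -/

theorem hasExactlyTwoLiftsOfOrderFour_sphere {E : Type*} [NormedAddCommGroup E]
    [InnerProductSpace ℝ E] {n k : ℕ} [Fact (Module.finrank ℝ E = n + 1)] (hnk : n = k + 2)
    {F : Type*} [TopologicalSpace F] [ChartedSpace (EuclideanSpace ℝ (Fin k)) F]
    [IsManifold (𝓡 k) ∞ F] [CompactSpace F] {f : F → Metric.sphere (0 : E) 1}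
    {σ : Metric.sphere (0 : E) 1 → Metric.sphere (0 : E) 1} {Y : Type*} [TopologicalSpace Y]
    {p : Y → Metric.sphere (0 : E) 1} (hf : Manifold.IsSmoothEmbedding (𝓡 k) (𝓡 n) ∞ f)
    (hsm : ContMDiff (𝓡 n) (𝓡 n) ∞ σ) (hσ : IsInvolutionOfPair σ (range f))
    (hfix : FixedSetIn σ (range f))
    (hp : IsDoubleBranchedCover (EuclideanSpace ℝ (Fin k)) p (range f)) :
    HasExactlyTwoLiftsOfOrderFour p σ := by
  have hE : FiniteDimensional ℝ E := FiniteDimensional.of_fact_finrank_eq_succ n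
  have hconn : PreconnectedSpace (Metric.sphere (0 : E) 1) := by
    rw [← isPreconnected_iff_preconnectedSpace]
    refine isPreconnected_sphere ?_ _ _
    rw [← Module.finrank_eq_rank, Fact.out (p := Module.finrank ℝ E = n + 1)]
    exact_mod_cast (by omega : 1 < n + 1)
  obtain ⟨x, hx⟩ := hfix.nonempty
  obtain ⟨q, hq⟩ := hfix.subset hx
  refine hp.hasExactlyTwoLiftsOfOrderFour
    (isCompact_range hf.isEmbedding.continuous).isClosed ⟨x, q, hq⟩ IsEmbedding.id
    (by rw [range_id]; exact convex_univ) hsm.continuous hσ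
    (fun hp₁ hp₂ hloc => exists_sheetIso_sphere (n := n) (by omega) hp₁ hp₂ hloc) ?_
  intro hp₁ g hg hpg hswap
  exact hp₁.exists_lift_lift_ne_of_interior (by simp [hnk]) hf IsEmbedding.id (fun _ => Iff.rfl)
    (by rw [range_id]; exact univ_mem) (x := x) hq
    BoundarylessManifold.isInteriorPoint hsm.continuous hσ.involutive hx
    (fun x hx => hfix.subset hx) hsm (fun _ => rfl) hg hpg hswap

theorem IsStronglyNegativeAmphichiral.fixedSetIn {k : Circle → S3} {σ : S3 → S3}
    (h : IsStronglyNegativeAmphichiral k σ) : FixedSetIn σ (range k) :=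
  ⟨nonempty_of_ncard_ne_zero (by rw [h.two_fixed]; norm_num), h.fixed_on_knot⟩

theorem hasExactlyTwoLiftsOfOrderFour_ball {F : Type*} [TopologicalSpace F]
    [ChartedSpace (EuclideanHalfSpace 2) F] [IsManifold (𝓡∂ 2) ∞ F] [CompactSpace F]
    {f : F → B4} {k : Circle → S3} {σ : B4 → B4} {Y : Type*} [TopologicalSpace Y] {p : Y → B4}
    (hf : IsProperSmoothEmbedding f (range k)) (hsm : SmoothOnB4 σ)
    (hσ : IsInvolutionOfPair σ (range f))
    (hfix : (∃ σ₀ : S3 → S3, IsStronglyNegativeAmphichiral k σ₀ ∧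
      ∀ x, σ (boundaryInclusion x) = boundaryInclusion (σ₀ x)) ∨ FixedSetIn σ (range f))
    (hp : IsDoubleBranchedCover (EuclideanHalfSpace 2) p (range f)) :
    HasExactlyTwoLiftsOfOrderFour p σ := by
  obtain ⟨s, hs, hsσ⟩ := hsm
  have hσc : Continuous σ := continuous_induced_rng.2 (by
    have h1 : (Subtype.val ∘ σ : B4 → EuclideanSpace ℝ (Fin 4)) = s ∘ Subtype.val :=
      funext fun x => (hsσ x).symm
    rw [h1]; exact hs.continuous.comp continuous_subtype_val)
  have hball : Convex ℝ (Metric.closedBall (0 : EuclideanSpace ℝ (Fin 4)) 1) :=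
    convex_closedBall 0 1
  have hcontr : ContractibleSpace B4 := hball.contractibleSpace ⟨0, by simp⟩
  have hlpc : LocallyPathConnectedSpace B4 := hball.locallyPathConnectedSpace
  have hfc : Continuous f := continuous_induced_rng.2 hf.embedding.isEmbedding.continuous
  -- the interior of the ball is invariant, and so is the boundary
  have hmaps : ∀ x : EuclideanSpace ℝ (Fin 4), ‖x‖ ≤ 1 → ‖s x‖ ≤ 1 := by
    intro x hx
    rw [show s x = σ ⟨x, mem_closedBall_zero_iff.2 hx⟩ from hsσ ⟨x, mem_closedBall_zero_iff.2 hx⟩]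
    exact mem_closedBall_zero_iff.1 (σ _).2
  have hss : ∀ x : EuclideanSpace ℝ (Fin 4), ‖x‖ ≤ 1 → s (s x) = x := by
    intro x hx
    rw [show s x = σ ⟨x, mem_closedBall_zero_iff.2 hx⟩ from hsσ ⟨x, mem_closedBall_zero_iff.2 hx⟩,
      hsσ, hσ.involutive]
  have hbd : ∀ x : B4, ‖(x : EuclideanSpace ℝ (Fin 4))‖ = 1 →
      ‖(σ x : EuclideanSpace ℝ (Fin 4))‖ = 1 := by
    intro x hx
    have h1 : ‖(x : EuclideanSpace ℝ (Fin 4))‖ ≤ 1 := hx.le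
    refine le_antisymm (by rw [← hsσ]; exact hmaps _ h1) (not_lt.1 fun h2 => ?_)
    have h3 := norm_map_lt_one (hs.differentiable (by simp)) hmaps hss h2
    rw [hsσ, hσ.involutive, hx] at h3
    exact lt_irrefl _ h3
  -- a fixed point on the surface
  obtain ⟨q, hq, hcase⟩ : ∃ q, σ (f q) = f q ∧
      ((‖(f q : EuclideanSpace ℝ (Fin 4))‖ = 1 ∧
        ∀ x : B4, ‖(x : EuclideanSpace ℝ (Fin 4))‖ = 1 → σ x = x → x ∈ range f) ∨
      (‖(f q : EuclideanSpace ℝ (Fin 4))‖ < 1 ∧ ∀ x : B4, σ x = x → x ∈ range f)) := by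
    rcases hfix with ⟨σ₀, hσ₀, hσσ₀⟩ | hfix
    · have hsub : ∀ x, x ∈ range k → ∃ q, f q = boundaryInclusion x ∧
          ‖(f q : EuclideanSpace ℝ (Fin 4))‖ = 1 := by
        intro x hx
        have h1 : boundaryInclusion x ∈ f '' (𝓡∂ 2).boundary F := by
          rw [hf.boundary]; exact mem_image_of_mem _ hx
        obtain ⟨q, -, hq⟩ := h1
        refine ⟨q, hq, ?_⟩
        rw [hq]; exact mem_sphere_zero_iff_norm.1 x.2
      obtain ⟨x, hx⟩ := hσ₀.fixedSetIn.nonempty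
      obtain ⟨q, hq, hq1⟩ := hsub x (hσ₀.fixed_on_knot hx)
      refine ⟨q, by rw [hq, hσσ₀, hx], Or.inl ⟨hq1, fun x' hx' hσx' => ?_⟩⟩
      let z : S3 := ⟨x', mem_sphere_zero_iff_norm.2 hx'⟩
      have hz : boundaryInclusion z = x' := rfl
      have hσz : σ₀ z = z := by
        have h1 := hσσ₀ z
        rw [hz, hσx'] at h1
        exact Subtype.ext (congrArg Subtype.val h1).symm
      obtain ⟨q', hq', -⟩ := hsub z (hσ₀.fixed_on_knot hσz)
      exact ⟨q', hq'⟩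
    · obtain ⟨x, hx⟩ := hfix.nonempty
      obtain ⟨q, rfl⟩ := hfix.subset hx
      have h1 : ‖(f q : EuclideanSpace ℝ (Fin 4))‖ ≤ 1 := mem_closedBall_zero_iff.1 (f q).2
      refine ⟨q, hx, ?_⟩
      rcases h1.eq_or_lt with h1 | h1
      · exact Or.inl ⟨h1, fun x _ hx => hfix.subset hx⟩
      · exact Or.inr ⟨h1, fun x hx => hfix.subset hx⟩
  refine hp.hasExactlyTwoLiftsOfOrderFour (isCompact_range hfc).isClosed ⟨_, q, rfl⟩
    IsEmbedding.subtypeVal ?_ hσc hσ ?_ ?_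
  · rw [range_euclideanHalfSpace]; exact EuclideanHalfSpace.convex
  · intro hp₁ hp₂ hloc
    exact exists_sheetIso_of_homeomorph hp₁ hp₂ isOpen_univ (Homeomorph.Set.univ B4) hloc
  · intro hp₁ g hg hpg hswap
    rcases hcase with ⟨hq1, hfix'⟩ | ⟨hq1, hfix'⟩
    · exact hf.exists_lift_lift_ne_of_boundary hp₁ hσc hσ.involutive hσ.mem_iff hs
        (fun x => (hsσ x).symm) hbd hfix' hq1 hq hg hpg hswap
    · refine hp₁.exists_lift_lift_ne_of_interior (by simp) hf.embedding IsEmbedding.subtypeVal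
        (fun x => by simp only [mem_range, Subtype.coe_inj]) (x := f q) ?_ (q := q) rfl ?_ hσc
        hσ.involutive hq hfix' hs.contMDiff (fun x => (hsσ x).symm) hg hpg hswap
      · rw [Subtype.range_coe]
        exact mem_of_superset (Metric.isOpen_ball.mem_nhds (by simpa using hq1))
          Metric.ball_subset_closedBall
      · rw [ModelWithCorners.isInteriorPoint_iff_not_isBoundaryPoint]
        exact fun h => hq1.ne ((hf.proper q).2 h)

end Assembly

end BranchedLift

theorem proposition2p1 :
    -- closed connected surfaces in the 4-sphere
    (∀ (F : Type*) [TopologicalSpace F] [ChartedSpace (EuclideanSpace ℝ (Fin 2)) F]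
        [IsManifold (𝓡 2) ∞ F] [CompactSpace F] [ConnectedSpace F]
        (f : F → BranchedLift.S4) (σ : BranchedLift.S4 → BranchedLift.S4)
        (Y : Type*) [TopologicalSpace Y] (p : Y → BranchedLift.S4),
      Manifold.IsSmoothEmbedding (𝓡 2) (𝓡 4) ∞ f →
      ContMDiff (𝓡 4) (𝓡 4) ∞ σ →
      BranchedLift.IsInvolutionOfPair σ (Set.range f) →
      BranchedLift.FixedSetIn σ (Set.range f) →
      BranchedLift.IsDoubleBranchedCover (EuclideanSpace ℝ (Fin 2)) p (Set.range f) →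
      BranchedLift.HasExactlyTwoLiftsOfOrderFour p σ) ∧
    -- properly embedded surfaces in the 4-ball, bounded by a knot
    (∀ (F : Type*) [TopologicalSpace F] [ChartedSpace (EuclideanHalfSpace 2) F]
        [IsManifold (𝓡∂ 2) ∞ F] [CompactSpace F]
        (f : F → BranchedLift.B4) (k : Circle → BranchedLift.S3)
        (σ : BranchedLift.B4 → BranchedLift.B4)
        (Y : Type*) [TopologicalSpace Y] (p : Y → BranchedLift.B4),
      Manifold.IsSmoothEmbedding (𝓡 1) (𝓡 3) ∞ k →
      BranchedLift.IsProperSmoothEmbedding f (Set.range k) →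
      BranchedLift.SmoothOnB4 σ →
      BranchedLift.IsInvolutionOfPair σ (Set.range f) →
      ((∃ σ₀ : BranchedLift.S3 → BranchedLift.S3,
          BranchedLift.IsStronglyNegativeAmphichiral k σ₀ ∧
          ∀ x, σ (BranchedLift.boundaryInclusion x) = BranchedLift.boundaryInclusion (σ₀ x)) ∨
        BranchedLift.FixedSetIn σ (Set.range f)) →
      BranchedLift.IsDoubleBranchedCover (EuclideanHalfSpace 2) p (Set.range f) →
      BranchedLift.HasExactlyTwoLiftsOfOrderFour p σ) ∧
    -- knots in the 3-sphere
    (∀ (k : Circle → BranchedLift.S3) (σ : BranchedLift.S3 → BranchedLift.S3)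
        (Y : Type*) [TopologicalSpace Y] (p : Y → BranchedLift.S3),
      (BranchedLift.IsStronglyNegativeAmphichiral k σ ∨
        (Manifold.IsSmoothEmbedding (𝓡 1) (𝓡 3) ∞ k ∧ ContMDiff (𝓡 3) (𝓡 3) ∞ σ ∧
          BranchedLift.IsInvolutionOfPair σ (Set.range k) ∧
          BranchedLift.FixedSetIn σ (Set.range k))) →
      BranchedLift.IsDoubleBranchedCover (EuclideanSpace ℝ (Fin 1)) p (Set.range k) →
      BranchedLift.HasExactlyTwoLiftsOfOrderFour p σ) := by
  have : Fact (Module.finrank ℝ (EuclideanSpace ℝ (Fin 5)) = 4 + 1) :=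
    ⟨finrank_euclideanSpace_fin⟩
  have : Fact (Module.finrank ℝ (EuclideanSpace ℝ (Fin 4)) = 3 + 1) :=
    ⟨finrank_euclideanSpace_fin⟩
  refine ⟨fun F _ _ _ _ _ f σ Y _ p hf hsm hσ hfix hp =>
      BranchedLift.hasExactlyTwoLiftsOfOrderFour_sphere (n := 4) rfl hf hsm hσ hfix hp,
    fun F _ _ _ _ f k σ Y _ p _ hf hsm hσ hfix hp =>
      BranchedLift.hasExactlyTwoLiftsOfOrderFour_ball hf hsm hσ hfix hp,
    fun k σ Y _ p h hp => ?_⟩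
  rcases h with h | ⟨hk, hsm, hσ, hfix⟩
  · exact BranchedLift.hasExactlyTwoLiftsOfOrderFour_sphere (n := 3) rfl h.knot h.smooth
      h.involution h.fixedSetIn hp
  · exact BranchedLift.hasExactlyTwoLiftsOfOrderFour_sphere (n := 3) rfl hk hsm hσ hfix hp
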